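/- Let $M$ be a complex manifold and $\pi:V\to M$ a holomorphic vector bundle of finite rank. Suppose given, all holomorphic: a Frobenius structure $(\circ_M,e_M,g_M)$ on $M$ (i.e. $(M,\circ_M,e_M)$ is an $F$-manifold and $g_M$ is an invariant flat metric whose Levi-Civita connection annihilates $e_M$; here a metric is a nondegenerate symmetric complex bilinear form); on the fibers of $V$, Frobenius algebra structures $(\circ_V,e_V,g_V)$ depending holomorphically on the point; a connection $D$ on $V$; and a bundle morphism $\alpha:V\to T^{1,0}M$ preserving multiplications and units. Let $\tilde X$ be the $D$-horizontal lift of $X$, and regard vectors of $V$ as vertical vectors on the manifold $V$. Define a multiplication and a bilinear form on $T^{1,0}V$ by $$\tilde X\circ\tilde Y=[X\circ_M Y]^{\sim},\quad v\circ w=v\circ_V w,\quad v\circ\tilde X=\tilde X\circ v=[\alpha(v)\circ_M X]^{\sim},$$ $$g(\tilde X,\tilde Y)=g_M(X,Y),\quad g(v,w)=g_V(v,w),\quad g(v,\tilde X)=g(\tilde X,v)=g_M(\alpha(v),X).$$ Assume that $g$ is nondegenerate and that $(V,\circ,e_V)$ is an $F$-manifold (that is, $L_{\mathcal X\circ\mathcal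 Y}(\circ)=\mathcal X\circ L_{\mathcal Y}(\circ)+\mathcal Y\circ L_{\mathcal X}(\circ)$ for holomorphic vector fields on $V$, with unit field $e_V$). Let $k_M$ and $k_V$ be real structures (smooth fiberwise antilinear involutions) on $T^{1,0}M$ and $V$ with $g_M(k_M\cdot,k_M\cdot)=\overline{g_M}$, $g_V(k_V\cdot,k_V\cdot)=\overline{g_V}$ and $\alpha\circ k_V=k_M\circ\alpha$. Let $k$ be the real structure on $T^{1,0}V$ equal to $k_M$ on horizontal and to $k_V$ on vertical vectors, and put $h_M=g_M(\cdot,k_M\cdot)$, $h_V=g_V(\cdot,k_V\cdot)$, $h=g(\cdot,k\cdot)$. For a multiplication $\circ$ on the holomorphic tangent bundle of a complex manifold and a pseudo-Hermitian metric $h$ with Chern connection $D^h$, put $\phi_X Y=-X\circ Y$ and let $\phi^\dagger_{\bar X}$ be the $h$-adjoint of $\phi_X$. The $tt^*$-equations are, for all $(1,0)$-fields $Z_1,Z_2$, $$D^h_{Z_1}(\phi_{Z_2})-D^h_{Z_2}(\phi_{Z_1})-\phi_{[Z_1,Z_2]}=0,\qquad R^{D^h}_{Z_1,\bar Z_2}+[\phi_{Z_1},\phi^\dagger_{\bar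 Z_2}]=0.$$ Theorem. The $tt^*$-equations hold on $(V,\circ,h)$ if and only if they hold on $(M,\circ_M,h_M)$ and the following conditions hold, where $X,Y,Z$ are local holomorphic vector fields on $M$, $s,s_1,s_2$ are local holomorphic sections of $V$, $D^M,D^V,D^{M,V}$ are the Chern connections of $h_M$, $h_V$, $h_V-\alpha^*h_M$, and $\phi^M,\phi^V$ are the Higgs fields of $\circ_M,\circ_V$ ($\phi^M_XY=-X\circ_MY$, $\phi^V_{s_1}s_2=-s_1\circ_Vs_2$): (i) $D^M_X(\alpha(s)\circ_M Z)=\alpha(s)\circ_M D^M_XZ$ whenever $s$ is $D$-parallel; (ii) $D^V_Xs=D_Xs+(D^V_Xe_V)\circ_V s$; (iii) $[\phi^M_X,k_M\phi^M_{\alpha(s)}k_M]=0$ and $[\phi^V_{s_1},k_V\phi^V_{s_2}k_V]=0$; (iv) $h_V(R^{D^V}_{X,\bar Y}s,s_1)-h_M(R^{D^M}_{X,\bar Y}\alpha(s),\alpha(s_1))=h_M\big(D^M_X(\alpha(s))-\alpha(D^V_Xs),\;D^M_Y(\alpha(s_1))-\alpha(D^{M,V}_Ys_1)\big)$. -/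

import Mathlib

open Bundle Set FiberBundle
open scoped Manifold ContDiff Topology

noncomputable section

namespace TTGeometry

/-! ## Holomorphic sections and (1,0)- and (0,1)-derivatives

A complex manifold is a manifold over `ℂ` of class `C^ω`; its holomorphic tangent bundle `T^{1,0}M`
is the (complex) tangent bundle `TangentSpace I`. -/

section Calculus

variable {E : Type*} [NormedAddCommGroup E] [NormedSpace ℂ E]
  {H : Type*} [TopologicalSpace H] (I : ModelWithCorners ℂ E H)
  {M : Type*} [TopologicalSpace M] [ChartedSpace H M]
  (F : Type*) [NormedAddCommGroup F] [NormedSpace ℂ F]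
  {V : M → Type*} [TopologicalSpace (TotalSpace F V)]
  [∀ x, AddCommGroup (V x)] [∀ x, TopologicalSpace (V x)] [FiberBundle F V]
  {G : Type*} [NormedAddCommGroup G] [NormedSpace ℂ G]

/-- The section `s` of `V` is holomorphic on `U`. -/
def IsHolSection (U : Set M) (s : ∀ x, V x) : Prop :=
  ContMDiffOn I (I.prod 𝓘(ℂ, F)) ω (fun x => TotalSpace.mk' F x (s x)) U

/-- A function `M → G` is smooth (of class `C^∞` in the real sense) at `x`. -/
def SmoothFunAt (f : M → G) (x : M) : Prop :=
  ContDiffAt ℝ ∞ (fun u : E => f ((extChartAt I x).symm u)) (extChartAt I x x)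

/-- The real derivative of a function `M → G` at `x`; the real tangent space is
identified with `T^{1,0}_x M` as usual, i.e. with `TangentSpace I x`. -/
def realDeriv (f : M → G) (x : M) (X : TangentSpace I x) : G :=
  fderiv ℝ (fun u : E => f ((extChartAt I x).symm u)) (extChartAt I x x) (show E from X)

/-- The derivative `X f` of a smooth function in the direction of the (1,0)-vector `X`. -/
def del (f : M → G) (x : M) (X : TangentSpace I x) : G :=
  (1 / 2 : ℂ) • (realDeriv I f x X - Complex.I • realDeriv I f x (Complex.I • X))

/-- The derivative `X̄ f` of a smooth function in the direction of the (0,1)-vector conjugate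
to `X`. -/
def delbar (f : M → G) (x : M) (X : TangentSpace I x) : G :=
  (1 / 2 : ℂ) • (realDeriv I f x X + Complex.I • realDeriv I f x (Complex.I • X))

/-- The coordinates of a section in the preferred (holomorphic) trivialization around `x`. -/
def sectionCoord (s : ∀ x, V x) (x y : M) : F :=
  (trivializationAt F V x (TotalSpace.mk' F y (s y))).2

/-- The section `s` of `V` is smooth (of class `C^∞` in the real sense) at `x`. -/
def SmoothSectionAt (s : ∀ x, V x) (x : M) : Prop :=
  SmoothFunAt I (sectionCoord F s x) x

/-- The operator `∂̄` of a holomorphic vector bundle on smooth sections: `∂̄_X̄ s` at `x`. -/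
def delbarSection (s : ∀ x, V x) (x : M) (X : TangentSpace I x) : V x :=
  (trivializationAt F V x).symm x (delbar I (sectionCoord F s x) x X)

/-! ## The Chern connection -/

/-- The (1,0)-part of the Chern connection of a pseudo-Hermitian metric `h` (linear in the first
and antilinear in the second argument): `D_X s` is the vector with
`X (h (s, t)) = h (D_X s, t) + h (s, ∂̄_X̄ t) = h (D_X s, t)` for all local holomorphic sections
`t`. The (0,1)-part of the Chern connection is `delbarSection`. -/
def chern (h : ∀ x, V x → V x → ℂ) (s : ∀ x, V x) (x : M) (X : TangentSpace I x) : V x :=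
  Classical.epsilon fun w : V x => ∀ (U : Set M) (t : ∀ y, V y), IsOpen U → x ∈ U →
    IsHolSection I F U t → del I (fun y => h y (s y) (t y)) x X = h x w (t x)

/-- The curvature `R_{X, Ȳ} s = D_X D_Ȳ s - D_Ȳ D_X s` of the Chern connection of `h`, for
holomorphic vector fields `X`, `Y`. (The term `D_{[X, Ȳ]} s` is absent because a holomorphic
vector field commutes with an antiholomorphic one.) -/
def chernCurvature (h : ∀ x, V x → V x → ℂ) (X Y : ∀ x : M, TangentSpace I x)
    (s : ∀ x, V x) (x : M) : V x :=
  chern I F h (fun y => delbarSection I F s y (Y y)) x (X x)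
    - delbarSection I F (fun y => chern I F h s y (X y)) x (Y x)

end Calculus

/-- The adjoint with respect to `h` of an endomorphism `A` of a fibre:
`h (A a, b) = h (a, A† b)`. -/
def adjointWrt {W : Type*} [AddCommGroup W] (h : W → W → ℂ) (A : W → W) : W → W :=
  Classical.epsilon fun B : W → W => ∀ a b, h (A a) b = h a (B b)

/-- The pseudo-Hermitian metric `h = g (·, k ·)`. -/
def herm {B : Type*} {V : B → Type*} (g : ∀ x, V x → V x → ℂ) (k : ∀ x, V x → V x) :
    ∀ x, V x → V x → ℂ :=
  fun x v w => g x v (k x w)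

/-- The Higgs field `φ_a b = - a ∘ b` of a multiplication. -/
def higgs {W : Type*} [AddCommGroup W] (mul : W → W → W) (a b : W) : W := - mul a b

/-! ## Algebraic structures on holomorphic vector bundles -/

section Structures

variable {E : Type*} [NormedAddCommGroup E] [NormedSpace ℂ E]
  {H : Type*} [TopologicalSpace H] (I : ModelWithCorners ℂ E H)
  {M : Type*} [TopologicalSpace M] [ChartedSpace H M]
  (F : Type*) [NormedAddCommGroup F] [NormedSpace ℂ F]
  {V : M → Type*} [TopologicalSpace (TotalSpace F V)]
  [∀ x, AddCommGroup (V x)] [∀ x, Module ℂ (V x)] [∀ x, TopologicalSpace (V x)]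
  [FiberBundle F V]

/-- A holomorphic fibre-preserving commutative, associative multiplication with unit section. -/
structure IsHolMultiplication (mul : ∀ x, V x → V x → V x) (e : ∀ x, V x) : Prop where
  add_mul : ∀ x a b c, mul x (a + b) c = mul x a c + mul x b c
  smul_mul : ∀ x (r : ℂ) a b, mul x (r • a) b = r • mul x a b
  comm : ∀ x a b, mul x a b = mul x b a
  assoc : ∀ x a b c, mul x (mul x a b) c = mul x a (mul x b c)
  one_mul : ∀ x a, mul x (e x) a = a
  hol : ∀ (U : Set M) (s t : ∀ x, V x), IsOpen U → IsHolSection I F U s → IsHolSection I F U t →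
    IsHolSection I F U (fun x => mul x (s x) (t x))
  unit_hol : IsHolSection I F univ e

/-- A holomorphic metric: a holomorphic nondegenerate symmetric complex bilinear form on the
fibres. -/
structure IsHolMetric (g : ∀ x, V x → V x → ℂ) : Prop where
  add_left : ∀ x a b c, g x (a + b) c = g x a c + g x b c
  smul_left : ∀ x (r : ℂ) a b, g x (r • a) b = r * g x a b
  symm : ∀ x a b, g x a b = g x b a
  nondegenerate : ∀ x a, (∀ b, g x a b = 0) → a = 0
  hol : ∀ (U : Set M) (s t : ∀ x, V x), IsOpen U → IsHolSection I F U s → IsHolSection I F U t →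
    ContMDiffOn I 𝓘(ℂ, ℂ) ω (fun x => g x (s x) (t x)) U

/-- The fibres are Frobenius algebras, depending holomorphically on the base point. -/
structure IsFrobeniusAlgebraBundle (mul : ∀ x, V x → V x → V x) (e : ∀ x, V x)
    (g : ∀ x, V x → V x → ℂ) : Prop where
  mult : IsHolMultiplication I F mul e
  metric : IsHolMetric I F g
  invariant : ∀ x a b c, g x (mul x a b) c = g x a (mul x b c)

/-- A real structure (smooth fibre-preserving complex antilinear involution), compatible with
`g`. -/
structure IsCompatibleRealStructure (g : ∀ x, V x → V x → ℂ) (k : ∀ x, V x → V x) : Prop where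
  add : ∀ x a b, k x (a + b) = k x a + k x b
  smul : ∀ x (r : ℂ) a, k x (r • a) = starRingEnd ℂ r • k x a
  involutive : ∀ x a, k x (k x a) = a
  smooth : ∀ (U : Set M) (s : ∀ x, V x), IsOpen U → IsHolSection I F U s →
    ∀ x ∈ U, SmoothSectionAt I F (fun y => k y (s y)) x
  compatible : ∀ x a b, g x (k x a) (k x b) = starRingEnd ℂ (g x a b)

end Structures

section Connections

variable {E : Type*} [NormedAddCommGroup E] [NormedSpace ℂ E]
  {H : Type*} [TopologicalSpace H] {I : ModelWithCorners ℂ E H}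
  {M : Type*} [TopologicalSpace M] [ChartedSpace H M] [IsManifold I ω M]
  {F : Type*} [NormedAddCommGroup F] [NormedSpace ℂ F]
  {V : M → Type*} [TopologicalSpace (TotalSpace F V)]
  [∀ x, AddCommGroup (V x)] [∀ x, Module ℂ (V x)] [∀ x, TopologicalSpace (V x)]
  [∀ x, IsTopologicalAddGroup (V x)] [∀ x, ContinuousSMul ℂ (V x)]
  [FiberBundle F V] [VectorBundle ℂ F V]

/-- The connection is holomorphic: covariant derivatives of local holomorphic sections are
holomorphic. Note that `D s x X` is `(D_X s) (x)`. -/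
def IsHolConnection (D : CovariantDerivative I F V) : Prop :=
  ∀ U : Set M, IsOpen U → ContMDiffCovariantDerivativeOn F ω D.toFun U

/-- The connection is flat: `D_X D_Y s - D_Y D_X s - D_{[X, Y]} s = 0` on local holomorphic
sections. -/
def IsFlat (D : CovariantDerivative I F V) : Prop :=
  ∀ (U : Set M) (X Y : ∀ x, TangentSpace I x) (s : ∀ x, V x), IsOpen U →
    IsHolSection I E U X → IsHolSection I E U Y → IsHolSection I F U s → ∀ x ∈ U,
    D (fun y => D s y (Y y)) x (X x) - D (fun y => D s y (X y)) x (Y x)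
      - D s x (VectorField.mlieBracket I X Y x) = 0

/-- The connection preserves the holomorphic metric `g`. -/
def PreservesMetric (D : CovariantDerivative I F V) (g : ∀ x, V x → V x → ℂ) : Prop :=
  ∀ (U : Set M) (s t : ∀ x, V x), IsOpen U → IsHolSection I F U s → IsHolSection I F U t →
    ∀ x ∈ U, ∀ X : TangentSpace I x,
    mvfderiv I (fun y => g y (s y) (t y)) x X
      = g x (D s x X) (t x) + g x (s x) (D t x X)

end Connections

/-! ## F-manifolds, Frobenius manifolds and the tt*-equations -/

section Manifolds

variable {E : Type*} [NormedAddCommGroup E] [NormedSpace ℂ E]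
  {H : Type*} [TopologicalSpace H] (I : ModelWithCorners ℂ E H)
  {M : Type*} [TopologicalSpace M] [ChartedSpace H M] [IsManifold I ω M]

/-- The Lie derivative `L_X (∘) (Z, T) = [X, Z ∘ T] - [X, Z] ∘ T - Z ∘ [X, T]`. -/
def lieDerivMul (mul : ∀ x : M, TangentSpace I x → TangentSpace I x → TangentSpace I x)
    (X Z T : ∀ x : M, TangentSpace I x) (x : M) : TangentSpace I x :=
  VectorField.mlieBracket I X (fun y => mul y (Z y) (T y)) x
    - mul x (VectorField.mlieBracket I X Z x) (T x)
    - mul x (Z x) (VectorField.mlieBracket I X T x)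

/-- `(M, ∘, e)` is a (holomorphic) F-manifold:
`L_{X ∘ Y} (∘) = X ∘ L_Y (∘) + Y ∘ L_X (∘)`. -/
structure IsFManifold (mul : ∀ x : M, TangentSpace I x → TangentSpace I x → TangentSpace I x)
    (e : ∀ x : M, TangentSpace I x) : Prop where
  mult : IsHolMultiplication I E mul e
  integrable : ∀ (U : Set M) (X Y Z T : ∀ x : M, TangentSpace I x), IsOpen U →
    IsHolSection I E U X → IsHolSection I E U Y → IsHolSection I E U Z → IsHolSection I E U T →
    ∀ x ∈ U, lieDerivMul I mul (fun y => mul y (X y) (Y y)) Z T x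
      = mul x (X x) (lieDerivMul I mul Y Z T x) + mul x (Y x) (lieDerivMul I mul X Z T x)

/-- `(M, ∘, e, g)` is a (holomorphic) Frobenius manifold: an F-manifold with an invariant flat
metric whose Levi-Civita connection `∇` satisfies `∇ e = 0`. -/
structure IsFrobeniusManifold [FiniteDimensional ℂ E]
    (mul : ∀ x : M, TangentSpace I x → TangentSpace I x → TangentSpace I x)
    (e : ∀ x : M, TangentSpace I x) (g : ∀ x : M, TangentSpace I x → TangentSpace I x → ℂ) :
    Prop where
  almost : IsFrobeniusAlgebraBundle I E mul e g
  fmanifold : IsFManifold I mul e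
  flat_admissible : letI := FiniteDimensional.complete ℂ E
    ∃ nabla : CovariantDerivative I E (TangentSpace I : M → Type _),
      IsHolConnection nabla ∧ nabla.torsion = 0 ∧ PreservesMetric nabla g ∧ IsFlat nabla ∧
        ∀ x, nabla e x = 0

/-- The tt*-equations for a multiplication `∘` on `T^{1,0}M` and a pseudo-Hermitian metric `h`,
with Chern connection `D` and Higgs field `φ`: `(∂^D φ)_{Z₁, Z₂} = 0` and
`R^D_{Z₁, Z̄₂} + [φ_{Z₁}, φ†_{Z̄₂}] = 0`. These are equations of tensors (forms of type (2,0) and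
(1,1) with values in endomorphisms), evaluated on local holomorphic sections. -/
structure TTStar (mul : ∀ x : M, TangentSpace I x → TangentSpace I x → TangentSpace I x)
    (h : ∀ x : M, TangentSpace I x → TangentSpace I x → ℂ) : Prop where
  first : ∀ (U : Set M) (Z₁ Z₂ S : ∀ x : M, TangentSpace I x), IsOpen U →
    IsHolSection I E U Z₁ → IsHolSection I E U Z₂ → IsHolSection I E U S → ∀ x ∈ U,
    (chern I E h (fun y => higgs (mul y) (Z₂ y) (S y)) x (Z₁ x)
        - higgs (mul x) (Z₂ x) (chern I E h S x (Z₁ x)))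
      - (chern I E h (fun y => higgs (mul y) (Z₁ y) (S y)) x (Z₂ x)
        - higgs (mul x) (Z₁ x) (chern I E h S x (Z₂ x)))
      - higgs (mul x) (VectorField.mlieBracket I Z₁ Z₂ x) (S x) = 0
  second : ∀ (U : Set M) (Z₁ Z₂ S : ∀ x : M, TangentSpace I x), IsOpen U →
    IsHolSection I E U Z₁ → IsHolSection I E U Z₂ → IsHolSection I E U S → ∀ x ∈ U,
    chernCurvature I E h Z₁ Z₂ S x
      + (higgs (mul x) (Z₁ x) (adjointWrt (h x) (higgs (mul x) (Z₂ x)) (S x))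
        - adjointWrt (h x) (higgs (mul x) (Z₂ x)) (higgs (mul x) (Z₁ x) (S x))) = 0

end Manifolds

/-! ## The induced structures on the total space -/

section TotalSpace

variable {E : Type*} [NormedAddCommGroup E] [NormedSpace ℂ E]
  {H : Type*} [TopologicalSpace H] {I : ModelWithCorners ℂ E H}
  {M : Type*} [TopologicalSpace M] [ChartedSpace H M] [IsManifold I ω M]
  {F : Type*} [NormedAddCommGroup F] [NormedSpace ℂ F]
  {V : M → Type*} [TopologicalSpace (TotalSpace F V)]
  [∀ x, AddCommGroup (V x)] [∀ x, Module ℂ (V x)] [∀ x, TopologicalSpace (V x)]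
  [∀ x, IsTopologicalAddGroup (V x)] [∀ x, ContinuousSMul ℂ (V x)]
  [FiberBundle F V] [VectorBundle ℂ F V]

variable (I) in
/-- A vector `w` of the fibre through `v` as a vertical tangent vector at `v`: the velocity at
`0` of `t ↦ v + t w`. -/
def vertLift (v : TotalSpace F V) (w : V v.proj) : TangentSpace (I.prod 𝓘(ℂ, F)) v :=
  show TangentSpace (I.prod 𝓘(ℂ, F)) v from
    mfderiv 𝓘(ℂ, ℂ) (I.prod 𝓘(ℂ, F)) (fun t : ℂ => TotalSpace.mk' F v.proj (v.snd + t • w)) 0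
      ((NormedSpace.fromTangentSpace (0 : ℂ)).symm 1)

/-- The `D`-horizontal lift to `v` of a tangent vector `X` of the base:
`X̃ = ds (X) - D_X s` for a local holomorphic section `s` through `v`. The section
`extend F v.snd` is constant in the preferred trivialization. -/
def horLift (D : CovariantDerivative I F V) (v : TotalSpace F V) (X : TangentSpace I v.proj) :
    TangentSpace (I.prod 𝓘(ℂ, F)) v :=
  (show TangentSpace (I.prod 𝓘(ℂ, F)) v from
    mfderiv I (I.prod 𝓘(ℂ, F)) (fun y => TotalSpace.mk' F y (extend F v.snd y)) v.proj X)
  - vertLift I v (D (extend F v.snd) v.proj X)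

variable (I) in
/-- The horizontal component of a tangent vector of the total space, as a vector of the base. -/
def horPart (v : TotalSpace F V) (W : TangentSpace (I.prod 𝓘(ℂ, F)) v) : TangentSpace I v.proj :=
  mfderiv (I.prod 𝓘(ℂ, F)) I (π F V) v W

/-- The vertical component (with respect to `D`) of a tangent vector of the total space, as a
vector of the fibre: if `W` is the velocity of a curve `∑ aⁱ(t) eᵢ` of vectors of `V` over a curve
with velocity `X`, with `eᵢ` the frame of the preferred trivialization, then the vertical component
is the covariant derivative `∑ (aⁱ)' eᵢ + aⁱ D_X eᵢ`. -/
def vertPart (D : CovariantDerivative I F V) (v : TotalSpace F V)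
    (W : TangentSpace (I.prod 𝓘(ℂ, F)) v) : V v.proj :=
  (trivializationAt F V v.proj).symm v.proj
      (mvfderiv (I.prod 𝓘(ℂ, F)) (fun u : TotalSpace F V => (trivializationAt F V v.proj u).2) v W)
    + D (extend F v.snd) v.proj (horPart I v W)

/-- The multiplication on the tangent bundle of the total space: `X̃ ∘ Ỹ = (X ∘_M Y)~`,
`v ∘ w = v ∘_V w`, `v ∘ X̃ = X̃ ∘ v = (α v ∘_M X)~`. -/
def totalMul (D : CovariantDerivative I F V)
    (mulM : ∀ x : M, TangentSpace I x → TangentSpace I x → TangentSpace I x)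
    (mulV : ∀ x, V x → V x → V x) (α : ∀ x, V x → TangentSpace I x) (v : TotalSpace F V)
    (W W' : TangentSpace (I.prod 𝓘(ℂ, F)) v) : TangentSpace (I.prod 𝓘(ℂ, F)) v :=
  horLift D v (mulM v.proj (horPart I v W) (horPart I v W')
      + mulM v.proj (α v.proj (vertPart D v W)) (horPart I v W')
      + mulM v.proj (α v.proj (vertPart D v W')) (horPart I v W))
    + vertLift I v (mulV v.proj (vertPart D v W) (vertPart D v W'))

/-- The metric on the total space: `g (X̃, Ỹ) = g_M (X, Y)`, `g (v, w) = g_V (v, w)`,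
`g (v, X̃) = g (X̃, v) = g_M (α v, X)`. -/
def totalMetric (D : CovariantDerivative I F V)
    (gM : ∀ x : M, TangentSpace I x → TangentSpace I x → ℂ)
    (gV : ∀ x, V x → V x → ℂ) (α : ∀ x, V x → TangentSpace I x) (v : TotalSpace F V)
    (W W' : TangentSpace (I.prod 𝓘(ℂ, F)) v) : ℂ :=
  gM v.proj (horPart I v W) (horPart I v W')
    + gM v.proj (α v.proj (vertPart D v W)) (horPart I v W')
    + gM v.proj (α v.proj (vertPart D v W')) (horPart I v W)
    + gV v.proj (vertPart D v W) (vertPart D v W')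

/-- The real structure on the total space, equal to `k_M` on horizontal and to `k_V` on vertical
vectors. -/
def totalReal (D : CovariantDerivative I F V) (kM : ∀ x : M, TangentSpace I x → TangentSpace I x)
    (kV : ∀ x, V x → V x) (v : TotalSpace F V) (W : TangentSpace (I.prod 𝓘(ℂ, F)) v) :
    TangentSpace (I.prod 𝓘(ℂ, F)) v :=
  horLift D v (kM v.proj (horPart I v W)) + vertLift I v (kV v.proj (vertPart D v W))

variable (I) in
/-- A section of `V` as a vertical vector field on the total space. -/
def totalSection (s : ∀ x, V x) (v : TotalSpace F V) : TangentSpace (I.prod 𝓘(ℂ, F)) v :=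
  vertLift I v (s v.proj)

variable (I F) in
/-- A holomorphic morphism of bundles `α : V → T^{1,0}M`, preserving multiplications and units. -/
structure IsAlgebraMorphism (mulM : ∀ x : M, TangentSpace I x → TangentSpace I x → TangentSpace I x)
    (eM : ∀ x : M, TangentSpace I x) (mulV : ∀ x, V x → V x → V x) (eV : ∀ x, V x)
    (α : ∀ x, V x → TangentSpace I x) : Prop where
  add : ∀ x a b, α x (a + b) = α x a + α x b
  smul : ∀ x (r : ℂ) a, α x (r • a) = r • α x a
  hol : ∀ (U : Set M) (s : ∀ x, V x), IsOpen U → IsHolSection I F U s →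
    IsHolSection I E U (fun x => α x (s x))
  mul : ∀ x a b, α x (mulV x a b) = mulM x (α x a) (α x b)
  unit : ∀ x, α x (eV x) = eM x

end TotalSpace

end TTGeometry

end

/-! The tt*-equations see a metric `g (·, k ·)` only through the real structure `k`. If `g` is
holomorphic and compatible with `k`, then `h (s, t)` is the conjugate of `g (k s, t)`. For
holomorphic `t` the derivative along `X` therefore falls on `k s` alone, and the Chern connection is
`D_X s = k ∂̄_X̄ (k s)`, the operator `nabla` (`IsHolMetric.chern_eq`). If `g` is also invariant,
the adjoint of `φ_b` is `k φ_b k` (`adjointWrt_higgs`). Both equations thus become statements about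
`∘` and `k` only (`ttStar_iff`); nondegeneracy of `g` enters as uniqueness of the connection and of
the adjoint.

An operator of the form `k ∂̄ k` commutes with every holomorphic bundle map that intertwines the
real structures, also along a holomorphic map of the bases (`IsHolMorphism.nabla`,
`IsHolMorphism.nablaCurvature`). The horizontal and vertical lifts are such maps, from the pullbacks
of `T^{1,0}M` and `V` to the tangent bundle of the total space. Hence the Chern connection upstairs
is the pullback of `D^M` on horizontal lifts and of `D^V` on vertical ones, and derivatives of lifts
along the fibres vanish. The map `α` is another such map, so `D^M (α s) = α (D^V s)` and `R^M (α s)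
= α (R^V s)`.

The F-manifold identity supplies two facts through its vertical part. Evaluated on horizontal lifts,
with the lift of `eM` in two of the four places, it shows that brackets of horizontal lifts are
horizontal, so `D` is flat (`bracket_horField`, `connCurvature_frameAt`). Evaluated on two vertical
fields it shows that `D` acts by derivations of `∘_V` (`conn_mul`).

Both tt*-expressions are tensors on holomorphic fields, so it suffices to insert lifts. In the first
equation three horizontal fields give the equation of `M`. Two horizontal directions acting on a
vertical field give the same equation at `α s`. One horizontal and one vertical direction give
`D^M_X (α s ∘ Z) = α s ∘ D^M_X Z + α (D_X s) ∘ Z` on horizontal fields, and `D^V_X (s ∘ t) = s ∘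
D^V_X t + D_X s ∘ t` on vertical ones. Two vertical directions give nothing (`ttFirst_total_iff`).
The second equation splits into the equation of `M`, the flatness `R^V = 0` of the Chern connection
of `V`, and the two commutator identities (iii) (`ttSecond_total_iff`).

These identities then have to be matched with the stated conditions. The one for `α s ∘ Z` is
tensorial in `s`, and for parallel `s` it is (i). It follows from (i) because a flat holomorphic
connection has parallel sections through every vector (`exists_parallel_section`). The one for `s ∘
t` gives (ii) at `t = eV`, and conversely (ii) gives it because `D` is a derivation
(`nabla_mul_iff`). In (iv) the right side vanishes by `D^M α = α D^V`, while the left side is `(h_V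
- α^* h_M) (R^V s, s₁)`. Nondegeneracy of the total metric forces the form `h_V - α^* h_M` to be
nondegenerate, so (iv) says `R^V = 0` (`chernCurvature_condition_iff`).

Parallel sections come from linear differential equations along the rays of a chart. The integral
equation on a ray is inverted in a Banach space of paths, which gives analytic dependence on the
ray; flatness then makes the radial solution parallel in all directions
(`exists_parallel_solution`). -/

noncomputable section

set_option linter.unusedSectionVars false

namespace TTGeometry

/-! ### Real derivatives, `∂` and `∂̄` of functions on a complex manifold -/

section Calculus

variable {E : Type*} [NormedAddCommGroup E] [NormedSpace ℂ E]
  {H : Type*} [TopologicalSpace H] {I : ModelWithCorners ℂ E H}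
  {M : Type*} [TopologicalSpace M] [ChartedSpace H M]
  {G : Type*} [NormedAddCommGroup G] [NormedSpace ℂ G]
  {G' : Type*} [NormedAddCommGroup G'] [NormedSpace ℂ G']
  {E' : Type*} [NormedAddCommGroup E'] [NormedSpace ℂ E']
  {H' : Type*} [TopologicalSpace H'] {I' : ModelWithCorners ℂ E' H'}
  {N : Type*} [TopologicalSpace N] [ChartedSpace H' N]

variable (I) in
/-- Real differentiability of a function at a point of a complex manifold. -/
def RealDiffAt (f : M → G) (x : M) : Prop :=
  DifferentiableAt ℝ (fun u : E => f ((extChartAt I x).symm u)) (extChartAt I x x)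

theorem eventually_chart_symm [I.Boundaryless] {x : M} {p : M → Prop} (h : ∀ᶠ y in 𝓝 x, p y) :
    ∀ᶠ u in 𝓝 (extChartAt I x x), p ((extChartAt I x).symm u) := by
  have hc : ContinuousAt (extChartAt I x).symm (extChartAt I x x) := continuousAt_extChartAt_symm x
  have := hc.eventually (p := p) (by simpa using h)
  exact this

theorem SmoothFunAt.congr [I.Boundaryless] {f g : M → G} {x : M} (hf : SmoothFunAt I f x)
    (h : f =ᶠ[𝓝 x] g) : SmoothFunAt I g x :=
  ContDiffAt.congr_of_eventuallyEq hf
    ((eventually_chart_symm (I := I) h).mono fun _ hu => hu.symm)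

theorem RealDiffAt.congr [I.Boundaryless] {f g : M → G} {x : M} (hf : RealDiffAt I f x)
    (h : f =ᶠ[𝓝 x] g) : RealDiffAt I g x :=
  DifferentiableAt.congr_of_eventuallyEq hf
    ((eventually_chart_symm (I := I) h).mono fun _ hu => hu.symm)

theorem realDeriv_congr [I.Boundaryless] {f g : M → G} {x : M} (h : f =ᶠ[𝓝 x] g)
    (X : TangentSpace I x) : realDeriv I f x X = realDeriv I g x X := by
  have h' : (fun u : E => f ((extChartAt I x).symm u)) =ᶠ[𝓝 (extChartAt I x x)]
      fun u : E => g ((extChartAt I x).symm u) := eventually_chart_symm (I := I) h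
  unfold realDeriv
  rw [h'.fderiv_eq]

theorem delbar_congr [I.Boundaryless] {f g : M → G} {x : M} (h : f =ᶠ[𝓝 x] g)
    (X : TangentSpace I x) : delbar I f x X = delbar I g x X := by
  simp only [delbar, realDeriv_congr h]

theorem SmoothFunAt.realDiffAt {f : M → G} {x : M} (hf : SmoothFunAt I f x) : RealDiffAt I f x :=
  ContDiffAt.differentiableAt hf (by simp)

theorem SmoothFunAt.const (c : G) (x : M) : SmoothFunAt I (fun _ : M => c) x := contDiffAt_const

theorem SmoothFunAt.add {f g : M → G} {x : M} (hf : SmoothFunAt I f x) (hg : SmoothFunAt I g x) :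
    SmoothFunAt I (fun y => f y + g y) x := ContDiffAt.add hf hg

theorem SmoothFunAt.smul {f : M → ℂ} {g : M → G} {x : M} (hf : SmoothFunAt I f x)
    (hg : SmoothFunAt I g x) : SmoothFunAt I (fun y => f y • g y) x := ContDiffAt.smul hf hg

theorem SmoothFunAt.sum {ι : Type*} {s : Finset ι} {f : ι → M → G} {x : M}
    (hf : ∀ i ∈ s, SmoothFunAt I (f i) x) : SmoothFunAt I (fun y => ∑ i ∈ s, f i y) x :=
  ContDiffAt.sum hf

theorem SmoothFunAt.clm {f : M → G} {x : M} (hf : SmoothFunAt I f x) (L : G →L[ℝ] G') :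
    SmoothFunAt I (fun y => L (f y)) x := L.contDiff.contDiffAt.comp _ hf

theorem SmoothFunAt.conj {f : M → ℂ} {x : M} (hf : SmoothFunAt I f x) :
    SmoothFunAt I (fun y => starRingEnd ℂ (f y)) x :=
  hf.clm (Complex.conjCLE : ℂ →L[ℝ] ℂ)

theorem RealDiffAt.smul {f : M → ℂ} {g : M → G} {x : M} (hf : RealDiffAt I f x)
    (hg : RealDiffAt I g x) : RealDiffAt I (fun y => f y • g y) x := DifferentiableAt.smul hf hg

theorem realDeriv_smul {f : M → ℂ} {g : M → G} {x : M} (hf : RealDiffAt I f x)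
    (hg : RealDiffAt I g x) (X : TangentSpace I x) :
    realDeriv I (fun y => f y • g y) x X = f x • realDeriv I g x X + realDeriv I f x X • g x := by
  unfold realDeriv
  rw [fderiv_fun_smul hf hg, extChartAt_to_inv]
  rfl

theorem realDeriv_sum {ι : Type*} {s : Finset ι} {f : ι → M → G} {x : M}
    (hf : ∀ i ∈ s, RealDiffAt I (f i) x) (X : TangentSpace I x) :
    realDeriv I (fun y => ∑ i ∈ s, f i y) x X = ∑ i ∈ s, realDeriv I (f i) x X := by
  unfold realDeriv
  rw [fderiv_fun_sum hf]
  exact sum_apply _ _ _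

theorem realDeriv_clm {f : M → G} {x : M} (hf : RealDiffAt I f x) (L : G →L[ℝ] G')
    (X : TangentSpace I x) : realDeriv I (fun y => L (f y)) x X = L (realDeriv I f x X) := by
  unfold realDeriv
  rw [show (fun u : E => L (f ((extChartAt I x).symm u)))
    = L ∘ (fun u : E => f ((extChartAt I x).symm u)) from rfl,
    fderiv_comp _ L.differentiableAt hf, L.fderiv]
  rfl

theorem realDeriv_add_vec {f : M → G} {x : M} (X Y : TangentSpace I x) :
    realDeriv I f x (X + Y) = realDeriv I f x X + realDeriv I f x Y := by
  unfold realDeriv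
  exact map_add _ _ _

theorem realDeriv_smul_vec {f : M → G} {x : M} (r : ℝ) (X : TangentSpace I x) :
    realDeriv I f x ((r : ℂ) • X) = (r : ℂ) • realDeriv I f x X := by
  unfold realDeriv
  have h : (show E from (r : ℂ) • X) = r • (show E from X) := by
    exact Complex.coe_smul r (show E from X)
  rw [h, map_smul, Complex.coe_smul]

theorem delbar_smul {f : M → ℂ} {g : M → G} {x : M} (hf : RealDiffAt I f x)
    (hg : RealDiffAt I g x) (X : TangentSpace I x) :
    delbar I (fun y => f y • g y) x X = f x • delbar I g x X + delbar I f x X • g x := by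
  simp only [delbar, realDeriv_smul hf hg, smul_eq_mul]
  module

theorem delbar_sum {ι : Type*} {s : Finset ι} {f : ι → M → G} {x : M}
    (hf : ∀ i ∈ s, RealDiffAt I (f i) x) (X : TangentSpace I x) :
    delbar I (fun y => ∑ i ∈ s, f i y) x X = ∑ i ∈ s, delbar I (f i) x X := by
  simp only [delbar, realDeriv_sum hf, Finset.smul_sum, Finset.sum_add_distrib, smul_add]

/-- Conjugation exchanges types. This is what makes `k ∂̄ k` an operator of type (1,0). -/
theorem conj_delbar {f : M → ℂ} {x : M} (hf : RealDiffAt I f x) (X : TangentSpace I x) :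
    starRingEnd ℂ (delbar I f x X) = del I (fun y => starRingEnd ℂ (f y)) x X := by
  have h := fun Y => realDeriv_clm hf (Complex.conjCLE : ℂ →L[ℝ] ℂ) (I := I) Y
  simp only [ContinuousLinearEquiv.coe_coe, Complex.conjCLE_apply] at h
  simp only [del, delbar, h, smul_eq_mul, map_mul, map_add, Complex.conj_I]
  have h2 : starRingEnd ℂ (1 / 2) = 1 / 2 := by simp [Complex.conj_ofNat]
  rw [h2]
  ring

theorem delbar_add_vec {f : M → G} {x : M} (X Y : TangentSpace I x) :
    delbar I f x (X + Y) = delbar I f x X + delbar I f x Y := by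
  simp only [delbar, smul_add, realDeriv_add_vec]
  module

theorem delbar_smul_vec {f : M → G} {x : M} (c : ℂ) (X : TangentSpace I x) :
    delbar I f x (c • X) = starRingEnd ℂ c • delbar I f x X := by
  -- The real derivative is only `ℝ`-linear in the vector, so `c` is split into real and imaginary
  -- parts.
  have hc : c • X = (c.re : ℂ) • X + (c.im : ℂ) • (Complex.I • X) := by
    conv_lhs => rw [← Complex.re_add_im c]
    module
  have hc' : Complex.I • c • X = (c.re : ℂ) • (Complex.I • X) + ((-c.im : ℝ) : ℂ) • X := by
    rw [hc]
    push_cast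
    have : Complex.I * ((c.im : ℂ) * Complex.I) = -(c.im : ℂ) := by
      rw [mul_left_comm, Complex.I_mul_I]; ring
    simp only [smul_add, smul_smul, this]
    module
  simp only [delbar]
  rw [hc', hc]
  simp only [realDeriv_add_vec, realDeriv_smul_vec]
  have hcc : starRingEnd ℂ c = (c.re : ℂ) - c.im * Complex.I := by
    apply Complex.ext <;> simp
  rw [hcc]
  push_cast
  match_scalars
  · ring
  · linear_combination ((c.im : ℂ) / 2) * Complex.I_sq

/-! ### Holomorphic functions and holomorphic changes of variables -/

/-- Near the point the chart expression of `f ∘ φ` is that of `f` composed with that of `φ`, and the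
latter is complex differentiable, hence real differentiable with the same derivative. -/
theorem realDiffAt_and_realDeriv_comp [I.Boundaryless] [I'.Boundaryless] {φ : N → M} {f : M → G}
    {x : N} (hφ : MDifferentiableAt I' I φ x) (hf : RealDiffAt I f (φ x)) (X : TangentSpace I' x) :
    RealDiffAt I' (fun y => f (φ y)) x ∧
    realDeriv I' (fun y => f (φ y)) x X = realDeriv I f (φ x) (mfderiv I' I φ x X) := by
  have hd := hφ.differentiableWithinAt_writtenInExtChartAt
  rw [I'.range_eq_univ, differentiableWithinAt_univ] at hd
  have hval : writtenInExtChartAt I' I x φ (extChartAt I' x x) = extChartAt I (φ x) (φ x) := by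
    simp [writtenInExtChartAt]
  have hf' : DifferentiableAt ℝ (fun u : E => f ((extChartAt I (φ x)).symm u))
    (writtenInExtChartAt I' I x φ (extChartAt I' x x)) := by rw [hval]; exact hf
  have hcomp : (fun u : E' => f (φ ((extChartAt I' x).symm u))) =ᶠ[𝓝 (extChartAt I' x x)]
      (fun u : E => f ((extChartAt I (φ x)).symm u)) ∘ writtenInExtChartAt I' I x φ := by
    have h1 : ∀ᶠ y in 𝓝 x, φ y ∈ (extChartAt I (φ x)).source :=
      hφ.continuousAt.eventually (extChartAt_source_mem_nhds (φ x))
    filter_upwards [eventually_chart_symm (I := I') h1] with u hu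
    simp only [Function.comp, writtenInExtChartAt]
    rw [(extChartAt I (φ x)).left_inv hu]
  refine ⟨DifferentiableAt.congr_of_eventuallyEq (hf'.comp _ (hd.restrictScalars ℝ)) hcomp, ?_⟩
  unfold realDeriv
  rw [hcomp.fderiv_eq, fderiv_comp _ hf' (hd.restrictScalars ℝ), hval, hφ.mfderiv,
    I'.range_eq_univ, fderivWithin_univ, hd.fderiv_restrictScalars ℝ]
  rfl

theorem RealDiffAt.comp [I.Boundaryless] [I'.Boundaryless] {φ : N → M} {f : M → G}
    {x : N} (hf : RealDiffAt I f (φ x)) (hφ : MDifferentiableAt I' I φ x) :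
    RealDiffAt I' (fun y => f (φ y)) x := (realDiffAt_and_realDeriv_comp hφ hf 0).1

theorem realDeriv_comp [I.Boundaryless] [I'.Boundaryless] {φ : N → M} {f : M → G}
    {x : N} (hf : RealDiffAt I f (φ x)) (hφ : MDifferentiableAt I' I φ x) (X : TangentSpace I' x) :
    realDeriv I' (fun y => f (φ y)) x X = realDeriv I f (φ x) (mfderiv I' I φ x X) :=
  (realDiffAt_and_realDeriv_comp hφ hf X).2

/-- The derivative of a holomorphic map is complex linear, so it respects the multiplication by `I`
that separates the types. -/
theorem delbar_comp [I.Boundaryless] [I'.Boundaryless] {φ : N → M} {f : M → G}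
    {x : N} (hf : RealDiffAt I f (φ x)) (hφ : MDifferentiableAt I' I φ x) (X : TangentSpace I' x) :
    delbar I' (fun y => f (φ y)) x X = delbar I f (φ x) (mfderiv I' I φ x X) := by
  simp only [delbar, realDeriv_comp hf hφ, map_smul]

theorem SmoothFunAt.comp [I.Boundaryless] [I'.Boundaryless] {φ : N → M} {f : M → G}
    {x : N} (hf : SmoothFunAt I f (φ x)) (hφ : ContMDiffAt I' I ω φ x) :
    SmoothFunAt I' (fun y => f (φ y)) x := by
  have hd := (contMDiffAt_iff.1 hφ).2
  rw [I'.range_eq_univ, contDiffWithinAt_univ] at hd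
  have hval : writtenInExtChartAt I' I x φ (extChartAt I' x x) = extChartAt I (φ x) (φ x) := by
    simp [writtenInExtChartAt]
  have hf' : ContDiffAt ℝ ∞ (fun u : E => f ((extChartAt I (φ x)).symm u))
    (writtenInExtChartAt I' I x φ (extChartAt I' x x)) := by rw [hval]; exact hf
  have hcomp : (fun u : E' => f (φ ((extChartAt I' x).symm u))) =ᶠ[𝓝 (extChartAt I' x x)]
      (fun u : E => f ((extChartAt I (φ x)).symm u)) ∘ writtenInExtChartAt I' I x φ := by
    have h1 : ∀ᶠ y in 𝓝 x, φ y ∈ (extChartAt I (φ x)).source :=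
      hφ.continuousAt.eventually (extChartAt_source_mem_nhds (φ x))
    filter_upwards [eventually_chart_symm (I := I') h1] with u hu
    simp only [Function.comp, writtenInExtChartAt]
    rw [(extChartAt I (φ x)).left_inv hu]
  exact ContDiffAt.congr_of_eventuallyEq
    (hf'.comp _ ((hd.restrict_scalars ℝ).of_le le_top)) hcomp

theorem realDeriv_of_hol [I.Boundaryless] {f : M → G} {x : M}
    (hf : MDifferentiableAt I 𝓘(ℂ, G) f x) (X : TangentSpace I x) :
    RealDiffAt I f x ∧ realDeriv I f x X = mvfderiv I f x X := by
  have hd := hf.differentiableWithinAt_writtenInExtChartAt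
  rw [I.range_eq_univ, differentiableWithinAt_univ] at hd
  refine ⟨hd.restrictScalars ℝ, ?_⟩
  simp only [mvfderiv, hf.mfderiv, I.range_eq_univ, fderivWithin_univ, realDeriv]
  have := hd.fderiv_restrictScalars ℝ
  exact DFunLike.congr_fun this X

theorem realDiffAt_of_hol [I.Boundaryless] {f : M → G} {x : M}
    (hf : MDifferentiableAt I 𝓘(ℂ, G) f x) : RealDiffAt I f x := (realDeriv_of_hol hf 0).1

theorem delbar_of_hol [I.Boundaryless] {f : M → G} {x : M}
    (hf : MDifferentiableAt I 𝓘(ℂ, G) f x) (X : TangentSpace I x) : delbar I f x X = 0 := by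
  simp only [delbar, (realDeriv_of_hol hf _).2, map_smul, smul_smul, Complex.I_mul_I]
  simp

theorem del_of_hol [I.Boundaryless] {f : M → G} {x : M}
    (hf : MDifferentiableAt I 𝓘(ℂ, G) f x) (X : TangentSpace I x) :
    del I f x X = mvfderiv I f x X := by
  simp only [del, (realDeriv_of_hol hf _).2, map_smul, smul_smul, Complex.I_mul_I]
  module

theorem SmoothFunAt.of_hol [I.Boundaryless] {f : M → G} {x : M}
    (hf : ContMDiffAt I 𝓘(ℂ, G) ω f x) : SmoothFunAt I f x := by
  have hd := (contMDiffAt_iff.1 hf).2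
  rw [I.range_eq_univ, contDiffWithinAt_univ] at hd
  exact (hd.restrict_scalars ℝ).of_le le_top

/-- Smoothness at `x` is expressed in the chart at `x`, differentiability at a nearby `y` in the
chart at `y`. Factoring `f` through the chart at `x` and applying the chain rule compares the two.
-/
theorem SmoothFunAt.eventually_realDiffAt [I.Boundaryless] [IsManifold I ω M] {f : M → G} {x : M}
    (hf : SmoothFunAt I f x) :
    (∀ᶠ y in 𝓝 x, DifferentiableAt ℝ (fun u : E => f ((extChartAt I x).symm u)) (extChartAt I x y)) ∧
    ∀ᶠ y in 𝓝 x, RealDiffAt I f y := by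
  have h1 : ∀ᶠ u in 𝓝 (extChartAt I x x),
      ContDiffAt ℝ 1 (fun u : E => f ((extChartAt I x).symm u)) u :=
    (ContDiffAt.of_le hf (by simp : (1 : ℕ∞ω) ≤ ∞)).eventually (by simp)
  have h2 := (continuousAt_extChartAt (I := I) x).eventually h1
  have h3 : ∀ᶠ y in 𝓝 x,
      DifferentiableAt ℝ (fun u : E => f ((extChartAt I x).symm u)) (extChartAt I x y) :=
    h2.mono fun y hy => hy.differentiableAt (by simp)
  refine ⟨h3, ?_⟩
  filter_upwards [h3, (chartAt H x).open_source.mem_nhds (mem_chart_source H x),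
    eventually_eventually_nhds.2 ((chartAt H x).open_source.mem_nhds (mem_chart_source H x))]
    with y hy hys hys'
  have hφ : MDifferentiableAt I 𝓘(ℂ, E) (extChartAt I x) y :=
    (contMDiffAt_extChartAt' (n := ω) hys).mdifferentiableAt (by simp)
  have hy' : RealDiffAt 𝓘(ℂ, E) (fun u : E => f ((extChartAt I x).symm u)) (extChartAt I x y) := by
    simpa only [RealDiffAt, extChartAt_model_space_eq_id, PartialEquiv.refl_coe,
      PartialEquiv.refl_symm, id] using hy
  refine (hy'.comp hφ).congr ?_
  filter_upwards [hys'] with z hz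
  rw [(extChartAt I x).left_inv (by rwa [extChartAt_source])]

theorem realDeriv_eq_fderiv_chart [I.Boundaryless] [IsManifold I ω M] {f : M → G} {x y : M}
    (hy : DifferentiableAt ℝ (fun u : E => f ((extChartAt I x).symm u)) (extChartAt I x y))
    (hys : y ∈ (chartAt H x).source) (X : TangentSpace I y) :
    realDeriv I f y X = fderiv ℝ (fun u : E => f ((extChartAt I x).symm u)) (extChartAt I x y)
      (show E from mfderiv I 𝓘(ℂ, E) (extChartAt I x) y X) := by
  have hφ : MDifferentiableAt I 𝓘(ℂ, E) (extChartAt I x) y :=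
    (contMDiffAt_extChartAt' (n := ω) hys).mdifferentiableAt (by simp)
  have hy' : RealDiffAt 𝓘(ℂ, E) (fun u : E => f ((extChartAt I x).symm u)) (extChartAt I x y) := by
    simpa only [RealDiffAt, extChartAt_model_space_eq_id, PartialEquiv.refl_coe,
      PartialEquiv.refl_symm, id] using hy
  have h := realDeriv_comp hy' hφ X
  rw [← realDeriv_congr (f := fun y => f ((extChartAt I x).symm (extChartAt I x y))), h]
  · simp only [realDeriv, extChartAt_model_space_eq_id, PartialEquiv.refl_coe,
      PartialEquiv.refl_symm, id]
  · filter_upwards [(chartAt H x).open_source.mem_nhds hys] with z hz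
    rw [(extChartAt I x).left_inv (by rwa [extChartAt_source])]

end Calculus

/-! ### Germs of holomorphic sections -/

section HolSections

variable {E : Type*} [NormedAddCommGroup E] [NormedSpace ℂ E]
  {H : Type*} [TopologicalSpace H] (I : ModelWithCorners ℂ E H)
  {M : Type*} [TopologicalSpace M] [ChartedSpace H M]
  (F : Type*) [NormedAddCommGroup F] [NormedSpace ℂ F]
  {V : M → Type*} [TopologicalSpace (TotalSpace F V)]
  [∀ x, AddCommGroup (V x)] [∀ x, TopologicalSpace (V x)] [FiberBundle F V]

/-- The section `s` is holomorphic near `x`. -/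
def HolAt (s : ∀ x, V x) (x : M) : Prop :=
  ContMDiffAt I (I.prod 𝓘(ℂ, F)) ω (fun y => TotalSpace.mk' F y (s y)) x

variable {I F}

theorem IsHolSection.holAt {U : Set M} {s : ∀ x, V x} (h : IsHolSection I F U s) (hU : IsOpen U)
    {x : M} (hx : x ∈ U) : HolAt I F s x := ContMDiffOn.contMDiffAt h (hU.mem_nhds hx)

theorem HolAt.congr {s t : ∀ x, V x} {x : M} (hs : HolAt I F s x) (h : ∀ᶠ y in 𝓝 x, s y = t y) :
    HolAt I F t x :=
  ContMDiffAt.congr_of_eventuallyEq hs (h.mono fun y hy => by simp only [hy])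

variable [∀ x, Module ℂ (V x)] [VectorBundle ℂ F V]

theorem HolAt.add {s t : ∀ x, V x} {x : M} (hs : HolAt I F s x) (ht : HolAt I F t x) :
    HolAt I F (fun y => s y + t y) x := ContMDiffAt.add_section hs ht

theorem HolAt.sub {s t : ∀ x, V x} {x : M} (hs : HolAt I F s x) (ht : HolAt I F t x) :
    HolAt I F (fun y => s y - t y) x := ContMDiffAt.sub_section hs ht

theorem HolAt.neg {s : ∀ x, V x} {x : M} (hs : HolAt I F s x) :
    HolAt I F (fun y => - s y) x := ContMDiffAt.neg_section hs

theorem HolAt.smul {f : M → ℂ} {s : ∀ x, V x} {x : M} (hf : ContMDiffAt I 𝓘(ℂ, ℂ) ω f x)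
    (hs : HolAt I F s x) : HolAt I F (fun y => f y • s y) x := ContMDiffAt.smul_section hf hs

theorem HolAt.zero (x : M) : HolAt I F (fun y => (0 : V y)) x :=
  (contMDiff_zeroSection ℂ V).contMDiffAt

theorem HolAt.mdifferentiableAt {s : ∀ x, V x} {x : M} (hs : HolAt I F s x) :
    MDifferentiableAt I (I.prod 𝓘(ℂ, F)) (fun y => TotalSpace.mk' F y (s y)) x :=
  ContMDiffAt.mdifferentiableAt hs (by simp)

variable [IsManifold I ω M] [ContMDiffVectorBundle ω F V I]

theorem HolAt.exists_isHolSection {s : ∀ x, V x} {x : M} (hs : HolAt I F s x) :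
    ∃ U : Set M, IsOpen U ∧ x ∈ U ∧ IsHolSection I F U s := by
  obtain ⟨u, hu, h⟩ := (contMDiffAt_iff_contMDiffOn_nhds (by simp)).1 hs
  obtain ⟨U, hU, hUo, hx⟩ := mem_nhds_iff.1 hu
  exact ⟨U, hUo, hx, ContMDiffOn.mono h hU⟩

theorem HolAt.eventually {s : ∀ x, V x} {x : M} (hs : HolAt I F s x) :
    ∀ᶠ y in 𝓝 x, HolAt I F s y := by
  obtain ⟨U, hU, hx, h⟩ := hs.exists_isHolSection
  exact Filter.mem_of_superset (hU.mem_nhds hx) fun y hy => h.holAt hU hy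

theorem contMDiffAt_eventually {G : Type*} [NormedAddCommGroup G] [NormedSpace ℂ G] {f : M → G}
    {x : M} (hf : ContMDiffAt I 𝓘(ℂ, G) ω f x) : ∀ᶠ y in 𝓝 x, ContMDiffAt I 𝓘(ℂ, G) ω f y := by
  obtain ⟨u, hu, h⟩ := (contMDiffAt_iff_contMDiffOn_nhds (by simp)).1 hf
  obtain ⟨U, hU, hUo, hx⟩ := mem_nhds_iff.1 hu
  exact Filter.mem_of_superset (hUo.mem_nhds hx) fun y hy => h.contMDiffAt
    (Filter.mem_of_superset (hUo.mem_nhds hy) hU)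

end HolSections

/-! ### The operator `∂̄` on sections and holomorphic frames -/

section Frames

variable {E : Type*} [NormedAddCommGroup E] [NormedSpace ℂ E]
  {H : Type*} [TopologicalSpace H] {I : ModelWithCorners ℂ E H} [I.Boundaryless]
  {M : Type*} [TopologicalSpace M] [ChartedSpace H M]
  {F : Type*} [NormedAddCommGroup F] [NormedSpace ℂ F]
  {V : M → Type*} [TopologicalSpace (TotalSpace F V)]
  [∀ x, AddCommGroup (V x)] [∀ x, TopologicalSpace (V x)] [FiberBundle F V]

theorem eventually_mem_baseSet (x : M) : ∀ᶠ y in 𝓝 x, y ∈ (trivializationAt F V x).baseSet :=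
  (trivializationAt F V x).open_baseSet.mem_nhds (mem_baseSet_trivializationAt' x)

omit [I.Boundaryless] in
theorem HolAt.sectionCoord {s : ∀ x, V x} {x : M} (hs : HolAt I F s x) :
    ContMDiffAt I 𝓘(ℂ, F) ω (sectionCoord F s x) x := (contMDiffAt_section x).1 hs

omit [I.Boundaryless] in
theorem holAt_of_sectionCoord {s : ∀ x, V x} {x : M}
    (hs : ContMDiffAt I 𝓘(ℂ, F) ω (TTGeometry.sectionCoord F s x) x) : HolAt I F s x :=
  (contMDiffAt_section x).2 hs

theorem HolAt.smooth {s : ∀ x, V x} {x : M} (hs : HolAt I F s x) : SmoothSectionAt I F s x :=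
  SmoothFunAt.of_hol hs.sectionCoord

theorem sectionCoord_congr {s t : ∀ x, V x} {x : M} (h : ∀ᶠ y in 𝓝 x, s y = t y) :
    sectionCoord F s x =ᶠ[𝓝 x] sectionCoord F t x :=
  h.mono fun y hy => by simp only [sectionCoord, hy]

theorem SmoothSectionAt.congr {s t : ∀ x, V x} {x : M} (hs : SmoothSectionAt I F s x)
    (h : ∀ᶠ y in 𝓝 x, s y = t y) : SmoothSectionAt I F t x :=
  SmoothFunAt.congr hs (sectionCoord_congr h)

theorem delbarSection_congr {s t : ∀ x, V x} {x : M}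
    (h : ∀ᶠ y in 𝓝 x, s y = t y) (X : TangentSpace I x) :
    delbarSection I F s x X = delbarSection I F t x X := by
  unfold delbarSection
  rw [delbar_congr (sectionCoord_congr h)]

theorem symm_sectionCoord (s : ∀ x, V x) (x : M) :
    (trivializationAt F V x).symm x (sectionCoord F s x x) = s x :=
  (trivializationAt F V x).symm_apply_apply_mk (mem_baseSet_trivializationAt' x) (s x)

variable [∀ x, Module ℂ (V x)] [VectorBundle ℂ F V]

theorem delbarSection_eq_symmL (s : ∀ x, V x) (x : M) (X : TangentSpace I x) :
    delbarSection I F s x X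
      = (trivializationAt F V x).symmL ℂ x (delbar I (sectionCoord F s x) x X) :=
  ((trivializationAt F V x).symmL_apply (mem_baseSet_trivializationAt' x) _).symm

theorem symmL_sectionCoord (s : ∀ x, V x) (x : M) :
    (trivializationAt F V x).symmL ℂ x (sectionCoord F s x x) = s x := by
  rw [(trivializationAt F V x).symmL_apply (mem_baseSet_trivializationAt' x), symm_sectionCoord]

theorem sectionCoord_sum {ι : Type*} (t : Finset ι) (c : ι → M → ℂ) (e : ι → ∀ x, V x) (x : M) :
    sectionCoord F (fun y => ∑ i ∈ t, c i y • e i y) x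
      =ᶠ[𝓝 x] fun y => ∑ i ∈ t, c i y • sectionCoord F (e i) x y := by
  filter_upwards [eventually_mem_baseSet (F := F) (V := V) x] with y hy
  simp only [sectionCoord]
  have h := ((trivializationAt F V x).linear ℂ hy)
  exact (by simp [map_sum] : h.mk' _ (∑ i ∈ t, c i y • e i y) = ∑ i ∈ t, c i y • h.mk' _ (e i y))

theorem sectionCoord_add (s s' : ∀ x, V x) (x : M) :
    sectionCoord F (fun y => s y + s' y) x
      =ᶠ[𝓝 x] fun y => sectionCoord F s x y + sectionCoord F s' x y := by
  filter_upwards [eventually_mem_baseSet (F := F) (V := V) x] with y hy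
  exact ((trivializationAt F V x).linear ℂ hy).map_add _ _

theorem sectionCoord_smul (f : M → ℂ) (s : ∀ x, V x) (x : M) :
    sectionCoord F (fun y => f y • s y) x =ᶠ[𝓝 x] fun y => f y • sectionCoord F s x y := by
  filter_upwards [eventually_mem_baseSet (F := F) (V := V) x] with y hy
  exact ((trivializationAt F V x).linear ℂ hy).map_smul _ _

theorem SmoothSectionAt.sum {ι : Type*} {t : Finset ι} {c : ι → M → ℂ} {e : ι → ∀ x, V x} {x : M}
    (hc : ∀ i ∈ t, SmoothFunAt I (c i) x) (he : ∀ i ∈ t, SmoothSectionAt I F (e i) x) :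
    SmoothSectionAt I F (fun y => ∑ i ∈ t, c i y • e i y) x :=
  SmoothFunAt.congr (SmoothFunAt.sum fun i hi => (hc i hi).smul (he i hi))
    (sectionCoord_sum t c e x).symm

theorem SmoothSectionAt.add {s s' : ∀ x, V x} {x : M} (hs : SmoothSectionAt I F s x)
    (hs' : SmoothSectionAt I F s' x) : SmoothSectionAt I F (fun y => s y + s' y) x :=
  SmoothFunAt.congr (SmoothFunAt.add hs hs') (sectionCoord_add s s' x).symm

theorem SmoothSectionAt.smul {f : M → ℂ} {s : ∀ x, V x} {x : M} (hf : SmoothFunAt I f x)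
    (hs : SmoothSectionAt I F s x) : SmoothSectionAt I F (fun y => f y • s y) x :=
  SmoothFunAt.congr (SmoothFunAt.smul hf hs) (sectionCoord_smul f s x).symm

theorem delbarSection_add {s s' : ∀ x, V x} {x : M} (hs : SmoothSectionAt I F s x)
    (hs' : SmoothSectionAt I F s' x) (X : TangentSpace I x) :
    delbarSection I F (fun y => s y + s' y) x X
      = delbarSection I F s x X + delbarSection I F s' x X := by
  have h : delbar I (sectionCoord F (fun y => s y + s' y) x) x X
      = delbar I (sectionCoord F s x) x X + delbar I (sectionCoord F s' x) x X := by
    rw [delbar_congr (sectionCoord_add s s' x)]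
    -- A sum indexed by `Bool` turns `delbar_sum` into additivity for two terms.
    have := delbar_sum (I := I) (s := Finset.univ) (x := x)
      (f := fun i : Bool => if i then sectionCoord F s x else sectionCoord F s' x)
      (fun i _ => by cases i <;> simp <;> [exact hs'.realDiffAt; exact hs.realDiffAt]) X
    simpa using this
  simp only [delbarSection_eq_symmL, h, map_add]

theorem delbarSection_smul {f : M → ℂ} {s : ∀ x, V x} {x : M} (hf : SmoothFunAt I f x)
    (hs : SmoothSectionAt I F s x) (X : TangentSpace I x) :
    delbarSection I F (fun y => f y • s y) x X
      = f x • delbarSection I F s x X + delbar I f x X • s x := by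
  conv_rhs => rw [← symmL_sectionCoord (F := F) s x]
  simp only [delbarSection_eq_symmL]
  rw [delbar_congr (sectionCoord_smul f s x), delbar_smul hf.realDiffAt hs.realDiffAt]
  simp only [map_add, map_smul]

omit [∀ x, Module ℂ (V x)] [VectorBundle ℂ F V] in
theorem delbar_sectionCoord_of_hol {s : ∀ x, V x} {x : M} (hs : HolAt I F s x)
    (X : TangentSpace I x) : delbar I (sectionCoord F s x) x X = 0 :=
  delbar_of_hol (hs.sectionCoord.mdifferentiableAt (by simp)) X

theorem delbarSection_of_hol {s : ∀ x, V x} {x : M} (hs : HolAt I F s x) (X : TangentSpace I x) :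
    delbarSection I F s x X = 0 := by
  rw [delbarSection_eq_symmL, delbar_sectionCoord_of_hol hs, map_zero]

/-- Only the coefficients are differentiated, since the `e i` are holomorphic. The frame is not tied
to the trivialization preferred at `x`, so a single frame computes `∂̄` at all nearby points. -/
theorem delbarSection_sum {ι : Type*} {t : Finset ι} {s : ∀ x, V x} {c : ι → M → ℂ}
    {e : ι → ∀ x, V x} {x : M} (hc : ∀ i ∈ t, RealDiffAt I (c i) x)
    (he : ∀ i ∈ t, HolAt I F (e i) x)
    (h : ∀ᶠ y in 𝓝 x, s y = ∑ i ∈ t, c i y • e i y) (X : TangentSpace I x) :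
    delbarSection I F s x X = ∑ i ∈ t, delbar I (c i) x X • e i x := by
  rw [delbarSection_congr h, delbarSection_eq_symmL]
  have hd : ∀ i ∈ t, RealDiffAt I (sectionCoord F (e i) x) x :=
    fun i hi => realDiffAt_of_hol ((he i hi).sectionCoord.mdifferentiableAt (by simp))
  rw [delbar_congr (sectionCoord_sum t c e x), delbar_sum fun i hi => (hc i hi).smul (hd i hi)]
  rw [map_sum]
  refine Finset.sum_congr rfl fun i hi => ?_
  rw [delbar_smul (hc i hi) (hd i hi), delbar_sectionCoord_of_hol (he i hi), smul_zero, zero_add,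
    map_smul, symmL_sectionCoord]

theorem delbarSection_add_vec {s : ∀ x, V x} {x : M} (X Y : TangentSpace I x) :
    delbarSection I F s x (X + Y) = delbarSection I F s x X + delbarSection I F s x Y := by
  simp only [delbarSection_eq_symmL, delbar_add_vec, map_add]

theorem delbarSection_smul_vec {s : ∀ x, V x} {x : M} (c : ℂ) (X : TangentSpace I x) :
    delbarSection I F s x (c • X) = starRingEnd ℂ c • delbarSection I F s x X := by
  simp only [delbarSection_eq_symmL, delbar_smul_vec, map_smul]

variable [FiniteDimensional ℂ F] [IsManifold I ω M] [ContMDiffVectorBundle ω F V I]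

variable (I F) in
/-- The frame of the preferred trivialization at `x`. -/
def frameAt (V : M → Type*) [TopologicalSpace (TotalSpace F V)]
    [∀ x, AddCommGroup (V x)] [∀ x, TopologicalSpace (V x)] [FiberBundle F V]
    [∀ x, Module ℂ (V x)] [VectorBundle ℂ F V] (x : M) (i : Fin (Module.finrank ℂ F)) : ∀ y, V y :=
  (trivializationAt F V x).localFrame (Module.finBasis ℂ F) i

/-- The coefficients of a section in the frame of the preferred trivialization at `x`. -/
def frameCoeff (s : ∀ x, V x) (x : M) (i : Fin (Module.finrank ℂ F)) (y : M) : ℂ :=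
  (Module.finBasis ℂ F).repr (sectionCoord F s x y) i

omit [I.Boundaryless] in
theorem holAt_frameAt (x : M) (i : Fin (Module.finrank ℂ F)) : HolAt I F (frameAt F V x i) x :=
  contMDiffAt_localFrame_of_mem _ _ _ _ (mem_baseSet_trivializationAt' x)

theorem eq_sum_frame (s : ∀ x, V x) (x : M) :
    ∀ᶠ y in 𝓝 x, s y = ∑ i, frameCoeff (F := F) s x i y • frameAt F V x i y := by
  filter_upwards [eventually_mem_baseSet (F := F) (V := V) x] with y hy
  have h := ((trivializationAt F V x).basisAt (Module.finBasis ℂ F) hy).sum_repr (s y)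
  conv_lhs => rw [← h]
  refine Finset.sum_congr rfl fun i _ => ?_
  rw [frameAt, Trivialization.localFrame_apply_of_mem_baseSet _ _ hy]
  simp [frameCoeff, sectionCoord, Trivialization.basisAt]

theorem SmoothSectionAt.frameCoeff {s : ∀ x, V x} {x : M} (hs : SmoothSectionAt I F s x)
    (i : Fin (Module.finrank ℂ F)) : SmoothFunAt I (frameCoeff (F := F) s x i) x :=
  SmoothFunAt.clm hs (((Module.finBasis ℂ F).coord i).toContinuousLinearMap.restrictScalars ℝ)

omit [I.Boundaryless] in
theorem HolAt.frameCoeff {s : ∀ x, V x} {x : M} (hs : HolAt I F s x)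
    (i : Fin (Module.finrank ℂ F)) :
    ContMDiffAt I 𝓘(ℂ, ℂ) ω (TTGeometry.frameCoeff (F := F) s x i) x :=
  (((Module.finBasis ℂ F).coord i).toContinuousLinearMap.contMDiff.contMDiffAt).comp x
    hs.sectionCoord

omit [I.Boundaryless] in
theorem holAt_extend {x : M} (w : V x) : HolAt I F (extend F w) x := by
  refine holAt_of_sectionCoord ?_
  refine (contMDiffAt_const (c := (trivializationAt F V x ⟨x, w⟩).2)).congr_of_eventuallyEq ?_
  filter_upwards [eventually_mem_baseSet (F := F) (V := V) x] with y hy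
  simp only [sectionCoord, extend]
  rw [(trivializationAt F V x).apply_mk_symm hy]

end Frames

/-! ### Derivatives along holomorphic vector fields -/

section Smoothness

variable {E : Type*} [NormedAddCommGroup E] [NormedSpace ℂ E]
  {H : Type*} [TopologicalSpace H] {I : ModelWithCorners ℂ E H} [I.Boundaryless]
  {M : Type*} [TopologicalSpace M] [ChartedSpace H M] [IsManifold I ω M]
  {G : Type*} [NormedAddCommGroup G] [NormedSpace ℂ G]

/-- The preferred trivialization of the tangent bundle is the derivative of the chart. -/
theorem sectionCoord_tangent {x y : M} (Y : ∀ y : M, TangentSpace I y)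
    (hy : y ∈ (chartAt H x).source) :
    sectionCoord E Y x y = (show E from mfderiv I 𝓘(ℂ, E) (extChartAt I x) y (Y y)) := by
  have : IsManifold I 1 M := .of_le (n := ω) le_top
  have h1 := TangentBundle.continuousLinearMapAt_trivializationAt (I := I) hy
  have h2 := congrFun (Trivialization.coe_linearMapAt_of_mem (R := ℂ)
    (trivializationAt E (TangentSpace I : M → Type _) x) (b := y) (by simpa using hy)) (Y y)
  exact h2.symm.trans (DFunLike.congr_fun h1 (Y y))

theorem contMDiffAt_mvfderiv {f : M → G} {x : M} (hf : ContMDiffAt I 𝓘(ℂ, G) ω f x)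
    {Y : ∀ y : M, TangentSpace I y} (hY : HolAt I E Y x) :
    ContMDiffAt I 𝓘(ℂ, G) ω (fun y => mvfderiv I f y (Y y)) x := by
  have hd : ContDiffAt ℂ ω (fun u : E => f ((extChartAt I x).symm u)) (extChartAt I x x) := by
    have h := (contMDiffAt_iff.1 hf).2
    rwa [I.range_eq_univ, contDiffWithinAt_univ] at h
  have hfd : ContDiffAt ℂ ω (fderiv ℂ (fun u : E => f ((extChartAt I x).symm u)))
      (extChartAt I x x) := ContDiffAt.fderiv_right hd (by simp)
  have h1 : ContMDiffAt I 𝓘(ℂ, G) ω (fun y => fderiv ℂ (fun u : E => f ((extChartAt I x).symm u))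
      (extChartAt I x y) (sectionCoord E Y x y)) x :=
    ContMDiffAt.clm_apply (hfd.contMDiffAt.comp x (contMDiffAt_extChartAt (n := ω)))
      hY.sectionCoord
  refine h1.congr_of_eventuallyEq ?_
  have hd1 : ∀ᶠ y in 𝓝 x,
      DifferentiableAt ℂ (fun u : E => f ((extChartAt I x).symm u)) (extChartAt I x y) :=
    ((continuousAt_extChartAt (I := I) x).eventually (hd.eventually (by simp))).mono
      fun y hy => hy.differentiableAt (by simp)
  filter_upwards [hd1, (chartAt H x).open_source.mem_nhds (mem_chart_source H x),
    contMDiffAt_eventually hf] with y hy hys hfy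
  rw [← (realDeriv_of_hol (hfy.mdifferentiableAt (by simp)) _).2,
    realDeriv_eq_fderiv_chart (hy.restrictScalars ℝ) hys, hy.fderiv_restrictScalars ℝ,
    sectionCoord_tangent Y hys]
  rfl

/-- The derivative at `y` refers to the chart at `y`. Rewritten in the fixed chart at `x`, it pairs
the Fréchet derivative of `f` with the coordinates of `Y`, and both depend smoothly on `y`. Second
derivatives, hence curvatures, need this. -/
theorem SmoothFunAt.delbar {f : M → G} {x : M} (hf : SmoothFunAt I f x)
    {Y : ∀ y : M, TangentSpace I y} (hY : HolAt I E Y x) :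
    SmoothFunAt I (fun y => TTGeometry.delbar I f y (Y y)) x := by
  set A : M → E := sectionCoord E Y x with hA
  have hAs : ContDiffAt ℝ ∞ (fun u : E => A ((extChartAt I x).symm u)) (extChartAt I x x) :=
    SmoothFunAt.of_hol hY.sectionCoord
  have hfd : ContDiffAt ℝ ∞ (fderiv ℝ (fun u : E => f ((extChartAt I x).symm u)))
      (extChartAt I x x) := ContDiffAt.fderiv_right hf (by simp)
  have key : ∀ᶠ y in 𝓝 x, TTGeometry.delbar I f y (Y y) = (1 / 2 : ℂ) •
      (fderiv ℝ (fun u : E => f ((extChartAt I x).symm u)) (extChartAt I x y) (A y) +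
       Complex.I • fderiv ℝ (fun u : E => f ((extChartAt I x).symm u)) (extChartAt I x y)
        (Complex.I • A y)) := by
    filter_upwards [hf.eventually_realDiffAt.1,
      (chartAt H x).open_source.mem_nhds (mem_chart_source H x)] with y hy hys
    have hAy : A y = (show E from mfderiv I 𝓘(ℂ, E) (extChartAt I x) y (Y y)) :=
      sectionCoord_tangent Y hys
    have hAy' : Complex.I • A y
        = (show E from mfderiv I 𝓘(ℂ, E) (extChartAt I x) y (Complex.I • Y y)) := by
      rw [hAy, map_smul]; rfl
    simp only [TTGeometry.delbar, realDeriv_eq_fderiv_chart hy hys, ← hAy, ← hAy']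
  have : SmoothFunAt I (fun y => (1 / 2 : ℂ) •
      (fderiv ℝ (fun u : E => f ((extChartAt I x).symm u)) (extChartAt I x y) (A y) +
       Complex.I • fderiv ℝ (fun u : E => f ((extChartAt I x).symm u)) (extChartAt I x y)
        (Complex.I • A y))) x := by
    have h2 : ContDiffAt ℝ ∞ (fun u => (1 / 2 : ℂ) •
      (fderiv ℝ (fun u : E => f ((extChartAt I x).symm u)) u (A ((extChartAt I x).symm u)) +
       Complex.I • fderiv ℝ (fun u : E => f ((extChartAt I x).symm u)) u
        (Complex.I • A ((extChartAt I x).symm u)))) (extChartAt I x x) := by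
      refine contDiffAt_const.smul (ContDiffAt.add ?_ (contDiffAt_const.smul ?_))
      · exact hfd.clm_apply hAs
      · exact hfd.clm_apply (contDiffAt_const.smul hAs)
    refine ContDiffAt.congr_of_eventuallyEq h2 ?_
    filter_upwards [extChartAt_target_mem_nhds (I := I) x] with u hu
    rw [(extChartAt I x).right_inv hu]
  exact this.congr (key.mono fun y hy => hy.symm)

end Smoothness

/-! ### Holomorphic families of linear maps commute with `∂̄` -/

section Push

variable {E : Type*} [NormedAddCommGroup E] [NormedSpace ℂ E]
  {H : Type*} [TopologicalSpace H] {I : ModelWithCorners ℂ E H} [I.Boundaryless]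
  {M : Type*} [TopologicalSpace M] [ChartedSpace H M] [IsManifold I ω M]
  {F : Type*} [NormedAddCommGroup F] [NormedSpace ℂ F] [FiniteDimensional ℂ F]
  {V : M → Type*} [TopologicalSpace (TotalSpace F V)]
  [∀ x, AddCommGroup (V x)] [∀ x, Module ℂ (V x)] [∀ x, TopologicalSpace (V x)] [FiberBundle F V]
  [VectorBundle ℂ F V] [ContMDiffVectorBundle ω F V I]

theorem SmoothSectionAt.delbarSection {s : ∀ x, V x} {x : M} (hs : SmoothSectionAt I F s x)
    {Y : ∀ y : M, TangentSpace I y} (hY : HolAt I E Y x) :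
    SmoothSectionAt I F (fun y => TTGeometry.delbarSection I F s y (Y y)) x := by
  refine SmoothSectionAt.congr (SmoothSectionAt.sum (t := Finset.univ)
    (fun i _ => (hs.frameCoeff i).delbar hY) fun i _ => (holAt_frameAt x i).smooth) ?_
  have h1 : ∀ᶠ y in 𝓝 x, ∀ i, RealDiffAt I (TTGeometry.frameCoeff (F := F) s x i) y :=
    Filter.eventually_all.2 fun i => (hs.frameCoeff i).eventually_realDiffAt.2
  have h2 : ∀ᶠ y in 𝓝 x, ∀ i, HolAt I F (frameAt F V x i) y :=
    Filter.eventually_all.2 fun i => (holAt_frameAt x i).eventually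
  filter_upwards [h1, h2, eventually_eventually_nhds.2 (eq_sum_frame (F := F) s x)] with y h1 h2 h3
  exact (delbarSection_sum (fun i _ => h1 i) (fun i _ => h2 i) h3 _).symm

variable {E' : Type*} [NormedAddCommGroup E'] [NormedSpace ℂ E']
  {H' : Type*} [TopologicalSpace H'] {I' : ModelWithCorners ℂ E' H'} [I'.Boundaryless]
  {N : Type*} [TopologicalSpace N] [ChartedSpace H' N]
  {F' : Type*} [NormedAddCommGroup F'] [NormedSpace ℂ F']
  {W : N → Type*} [TopologicalSpace (TotalSpace F' W)]
  [∀ x, AddCommGroup (W x)] [∀ x, Module ℂ (W x)] [∀ x, TopologicalSpace (W x)] [FiberBundle F' W]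
  [VectorBundle ℂ F' W]

variable (I F I' F') in
/-- A holomorphic family of linear maps over a holomorphic map `φ`. -/
structure IsHolMorphism (φ : N → M) (L : ∀ n, V (φ n) → W n) : Prop where
  add : ∀ n a b, L n (a + b) = L n a + L n b
  smul : ∀ n (r : ℂ) a, L n (r • a) = r • L n a
  hol_base : ContMDiff I' I ω φ
  hol : ∀ n s, HolAt I F s (φ n) → HolAt I' F' (fun y => L y (s (φ y))) n

namespace IsHolMorphism

variable {φ : N → M} {L : ∀ n, V (φ n) → W n} (hL : IsHolMorphism I F I' F' φ L)
include hL

theorem map_sum_smul {ι : Type*} (t : Finset ι) (n : N) (c : ι → ℂ) (w : ι → V (φ n)) :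
    L n (∑ i ∈ t, c i • w i) = ∑ i ∈ t, c i • L n (w i) := by
  let l : V (φ n) →ₗ[ℂ] W n := ⟨⟨L n, hL.add n⟩, hL.smul n⟩
  change l _ = ∑ i ∈ t, c i • l (w i)
  simp

theorem eq_sum {s : ∀ x, V x} (n : N) :
    ∀ᶠ y in 𝓝 n, L y (s (φ y)) = ∑ i, frameCoeff (F := F) s (φ n) i (φ y) •
      L y (frameAt F V (φ n) i (φ y)) := by
  have h := hL.hol_base.continuous.continuousAt.eventually (eq_sum_frame (F := F) s (φ n))
  filter_upwards [h] with y hy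
  conv_lhs => rw [hy]
  exact hL.map_sum_smul _ _ _ _

theorem smooth {s : ∀ x, V x} {n : N} (hs : SmoothSectionAt I F s (φ n)) :
    SmoothSectionAt I' F' (fun y => L y (s (φ y))) n := by
  refine SmoothSectionAt.congr (SmoothSectionAt.sum (t := Finset.univ) 
    (c := fun i y => frameCoeff (F := F) s (φ n) i (φ y))
    (e := fun i y => L y (frameAt F V (φ n) i (φ y)))
    (fun i _ => (hs.frameCoeff i).comp hL.hol_base.contMDiffAt)
    fun i _ => (hL.hol _ _ (holAt_frameAt (φ n) i)).smooth) ?_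
  exact (hL.eq_sum n).mono fun y hy => hy.symm

/-- In a holomorphic frame of `V` the map acts only on the frame, and its image is a holomorphic
family; the coefficients are pulled back along `φ`, where `delbar_comp` applies. -/
theorem delbarSection {s : ∀ x, V x} {n : N} (hs : SmoothSectionAt I F s (φ n))
    (X : TangentSpace I' n) :
    TTGeometry.delbarSection I' F' (fun y => L y (s (φ y))) n X
      = L n (TTGeometry.delbarSection I F s (φ n) (mfderiv I' I φ n X)) := by
  have hφ : MDifferentiableAt I' I φ n := hL.hol_base.contMDiffAt.mdifferentiableAt (by simp)
  rw [delbarSection_sum (t := Finset.univ) (fun i _ => (hs.frameCoeff i).realDiffAt.comp hφ)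
    (fun i _ => hL.hol _ _ (holAt_frameAt (φ n) i)) (hL.eq_sum n),
    delbarSection_sum (t := Finset.univ) (fun i _ => (hs.frameCoeff i).realDiffAt)
    (fun i _ => holAt_frameAt (φ n) i) (eq_sum_frame s (φ n)), hL.map_sum_smul]
  refine Finset.sum_congr rfl fun i _ => ?_
  rw [delbar_comp (hs.frameCoeff i).realDiffAt hφ]

end IsHolMorphism

end Push

/-! ### The operator `k ∂̄ k` and its identification with the Chern connection -/

section RealStructure

variable {E : Type*} [NormedAddCommGroup E] [NormedSpace ℂ E]
  {H : Type*} [TopologicalSpace H] {I : ModelWithCorners ℂ E H} [I.Boundaryless]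
  {M : Type*} [TopologicalSpace M] [ChartedSpace H M] [IsManifold I ω M]
  {F : Type*} [NormedAddCommGroup F] [NormedSpace ℂ F] [FiniteDimensional ℂ F]
  {V : M → Type*} [TopologicalSpace (TotalSpace F V)]
  [∀ x, AddCommGroup (V x)] [∀ x, Module ℂ (V x)] [∀ x, TopologicalSpace (V x)] [FiberBundle F V]
  [VectorBundle ℂ F V] [ContMDiffVectorBundle ω F V I]

variable (I F) in
/-- The (1,0)-part `s ↦ k ∂̄ (k s)` of the connection conjugate to `∂̄` under a real structure. -/
def nabla (k : ∀ x, V x → V x) (s : ∀ x, V x) (x : M) (X : TangentSpace I x) : V x :=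
  k x (delbarSection I F (fun y => k y (s y)) x X)

variable (I F) in
/-- The curvature `R_{X, Ȳ} s` of `nabla` on holomorphic sections. -/
def nablaCurvature (k : ∀ x, V x → V x) (X : ∀ x : M, TangentSpace I x) (s : ∀ x, V x) (x : M)
    (Y : TangentSpace I x) : V x :=
  - delbarSection I F (fun y => nabla I F k s y (X y)) x Y

theorem nabla_congr (k : ∀ x, V x → V x) {s t : ∀ x, V x} {x : M} (h : ∀ᶠ y in 𝓝 x, s y = t y)
    (X : TangentSpace I x) : nabla I F k s x X = nabla I F k t x X := by
  unfold nabla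
  rw [delbarSection_congr (h.mono fun y hy => by rw [hy])]

theorem nablaCurvature_congr (k : ∀ x, V x → V x) {X X' : ∀ x : M, TangentSpace I x}
    {s t : ∀ x, V x} {x : M} (hX : ∀ᶠ y in 𝓝 x, X y = X' y) (h : ∀ᶠ y in 𝓝 x, s y = t y)
    (Y : TangentSpace I x) :
    nablaCurvature I F k X s x Y = nablaCurvature I F k X' t x Y := by
  unfold nablaCurvature
  rw [delbarSection_congr]
  filter_upwards [hX, eventually_eventually_nhds.2 h] with y hy h
  rw [nabla_congr k h, hy]

variable {g : ∀ x, V x → V x → ℂ} {k : ∀ x, V x → V x}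

namespace IsCompatibleRealStructure

variable (hk : IsCompatibleRealStructure I F g k)
include hk

theorem map_zero (x : M) : k x 0 = 0 := by
  simpa using hk.add x 0 0

theorem map_neg (x : M) (a : V x) : k x (-a) = - k x a := by
  have := hk.smul x (-1) a
  simpa using this

theorem map_sub (x : M) (a b : V x) : k x (a - b) = k x a - k x b := by
  rw [sub_eq_add_neg, hk.add, hk.map_neg, ← sub_eq_add_neg]

theorem map_sum_smul {ι : Type*} (t : Finset ι) (x : M) (c : ι → ℂ) (w : ι → V x) :
    k x (∑ i ∈ t, c i • w i) = ∑ i ∈ t, starRingEnd ℂ (c i) • k x (w i) := by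
  let l : V x →+ V x := ⟨⟨k x, hk.map_zero x⟩, hk.add x⟩
  change l _ = _
  rw [_root_.map_sum]
  exact Finset.sum_congr rfl fun i _ => hk.smul x _ _

theorem smoothAt {s : ∀ x, V x} {x : M} (hs : HolAt I F s x) :
    SmoothSectionAt I F (fun y => k y (s y)) x := by
  obtain ⟨U, hU, hx, h⟩ := hs.exists_isHolSection
  exact hk.smooth U s hU h x hx

/-- Smoothness of `k` is assumed on holomorphic sections only. Expansion in a holomorphic frame
extends it to smooth sections, the coefficients being conjugated. -/
theorem map_smooth {s : ∀ x, V x} {x : M} (hs : SmoothSectionAt I F s x) :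
    SmoothSectionAt I F (fun y => k y (s y)) x := by
  refine SmoothSectionAt.congr (SmoothSectionAt.sum (t := Finset.univ)
    (fun i _ => (hs.frameCoeff i).conj) fun i _ => hk.smoothAt (holAt_frameAt x i)) ?_
  filter_upwards [eq_sum_frame (F := F) s x] with y hy
  conv_rhs => rw [hy]
  exact (hk.map_sum_smul _ _ _ _).symm

theorem nabla_smooth {s : ∀ x, V x} {x : M} (hs : SmoothSectionAt I F s x)
    {Y : ∀ y : M, TangentSpace I y} (hY : HolAt I E Y x) :
    SmoothSectionAt I F (fun y => nabla I F k s y (Y y)) x :=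
  hk.map_smooth ((hk.map_smooth hs).delbarSection hY)

theorem nabla_add {s t : ∀ x, V x} {x : M} (hs : SmoothSectionAt I F s x)
    (ht : SmoothSectionAt I F t x) (X : TangentSpace I x) :
    nabla I F k (fun y => s y + t y) x X = nabla I F k s x X + nabla I F k t x X := by
  simp only [nabla, hk.add, delbarSection_add (hk.map_smooth hs) (hk.map_smooth ht)]

/-- Under `k` the coefficient is conjugated, and conjugating back turns `∂̄` of the conjugate into
`∂` of `f`. -/
theorem nabla_smul {f : M → ℂ} {s : ∀ x, V x} {x : M} (hf : SmoothFunAt I f x)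
    (hs : SmoothSectionAt I F s x) (X : TangentSpace I x) :
    nabla I F k (fun y => f y • s y) x X = f x • nabla I F k s x X + del I f x X • s x := by
  simp only [nabla, hk.smul, hk.add, hk.involutive, delbarSection_smul hf.conj (hk.map_smooth hs),
    conj_delbar hf.conj.realDiffAt, starRingEnd_self_apply]

theorem nabla_add_vec {s : ∀ x, V x} {x : M} (X Y : TangentSpace I x) :
    nabla I F k s x (X + Y) = nabla I F k s x X + nabla I F k s x Y := by
  simp only [nabla, delbarSection_add_vec, hk.add]

theorem nabla_smul_vec {s : ∀ x, V x} {x : M} (c : ℂ) (X : TangentSpace I x) :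
    nabla I F k s x (c • X) = c • nabla I F k s x X := by
  simp only [nabla, delbarSection_smul_vec, hk.smul, starRingEnd_self_apply]

theorem nabla_zero_vec {s : ∀ x, V x} {x : M} : nabla I F k s x 0 = 0 := by
  simpa using hk.nabla_smul_vec (s := s) (x := x) 0 0

theorem nabla_neg {s : ∀ x, V x} {x : M} (hs : SmoothSectionAt I F s x) (X : TangentSpace I x) :
    nabla I F k (fun y => - s y) x X = - nabla I F k s x X := by
  have h := hk.nabla_smul (f := fun _ => -1) (SmoothFunAt.const (I := I) (-1 : ℂ) x) hs X
  have h0 : del I (fun _ : M => (-1 : ℂ)) x X = 0 := by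
    rw [del_of_hol mdifferentiableAt_const]
    simp [mvfderiv, mfderiv_const]
  simpa [h0] using h

/-- Tensoriality of the curvature in the section. -/
theorem nablaCurvature_smul {f : M → ℂ} {s : ∀ x, V x} {x : M} {X : ∀ x : M, TangentSpace I x}
    (hf : ContMDiffAt I 𝓘(ℂ, ℂ) ω f x) (hs : HolAt I F s x) (hX : HolAt I E X x)
    (Y : TangentSpace I x) :
    nablaCurvature I F k X (fun y => f y • s y) x Y = f x • nablaCurvature I F k X s x Y := by
  unfold nablaCurvature
  have hfs := SmoothFunAt.of_hol hf
  -- The correction term `(X f) s` in the Leibniz rule is again holomorphic, so the outer `∂̄`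
  -- annihilates it.
  have hd : ContMDiffAt I 𝓘(ℂ, ℂ) ω (fun y => mvfderiv I f y (X y)) x :=
    contMDiffAt_mvfderiv hf hX
  rw [delbarSection_congr (t := fun y => f y • nabla I F k s y (X y)
    + mvfderiv I f y (X y) • s y)]
  · rw [delbarSection_add (hk.nabla_smooth hs.smooth hX |>.smul hfs)
      (hs.smooth.smul (SmoothFunAt.of_hol hd)),
      delbarSection_of_hol (HolAt.smul hd hs), add_zero,
      delbarSection_smul hfs (hk.nabla_smooth hs.smooth hX),
      delbar_of_hol (hf.mdifferentiableAt (by simp)), zero_smul, add_zero, smul_neg]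
  · filter_upwards [contMDiffAt_eventually hf, hs.eventually] with y hy hys
    rw [hk.nabla_smul (SmoothFunAt.of_hol hy) hys.smooth,
      del_of_hol (hy.mdifferentiableAt (by simp))]

theorem nablaCurvature_add {s t : ∀ x, V x} {x : M} {X : ∀ x : M, TangentSpace I x}
    (hs : HolAt I F s x) (ht : HolAt I F t x) (hX : HolAt I E X x) (Y : TangentSpace I x) :
    nablaCurvature I F k X (fun y => s y + t y) x Y
      = nablaCurvature I F k X s x Y + nablaCurvature I F k X t x Y := by
  unfold nablaCurvature
  rw [delbarSection_congr (t := fun y => nabla I F k s y (X y) + nabla I F k t y (X y))]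
  · rw [delbarSection_add (hk.nabla_smooth hs.smooth hX) (hk.nabla_smooth ht.smooth hX), neg_add]
  · filter_upwards [ht.eventually, hs.eventually] with y hy hys
    rw [hk.nabla_add hys.smooth hy.smooth]

theorem nablaCurvature_add_left {s : ∀ x, V x} {x : M} {X X' : ∀ x : M, TangentSpace I x}
    (hs : HolAt I F s x) (hX : HolAt I E X x) (hX' : HolAt I E X' x) (Y : TangentSpace I x) :
    nablaCurvature I F k (fun y => X y + X' y) s x Y
      = nablaCurvature I F k X s x Y + nablaCurvature I F k X' s x Y := by
  unfold nablaCurvature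
  simp only [hk.nabla_add_vec]
  rw [delbarSection_add (hk.nabla_smooth hs.smooth hX) (hk.nabla_smooth hs.smooth hX'), neg_add]

theorem nablaCurvature_smul_left {f : M → ℂ} {s : ∀ x, V x} {x : M} {X : ∀ x : M, TangentSpace I x}
    (hf : ContMDiffAt I 𝓘(ℂ, ℂ) ω f x)
    (hs : HolAt I F s x) (hX : HolAt I E X x) (Y : TangentSpace I x) :
    nablaCurvature I F k (fun y => f y • X y) s x Y = f x • nablaCurvature I F k X s x Y := by
  unfold nablaCurvature
  simp only [hk.nabla_smul_vec]
  rw [delbarSection_smul (SmoothFunAt.of_hol hf) (hk.nabla_smooth hs.smooth hX),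
    delbar_of_hol (hf.mdifferentiableAt (by simp)), zero_smul, add_zero, smul_neg]

end IsCompatibleRealStructure

namespace IsHolMetric

variable (hg : IsHolMetric I F g)
include hg

theorem holAt {s t : ∀ x, V x} {x : M} (hs : HolAt I F s x) (ht : HolAt I F t x) :
    ContMDiffAt I 𝓘(ℂ, ℂ) ω (fun y => g y (s y) (t y)) x := by
  obtain ⟨U, hU, hx, h⟩ := hs.exists_isHolSection
  obtain ⟨U', hU', hx', h'⟩ := ht.exists_isHolSection
  exact (hg.hol (U ∩ U') s t (hU.inter hU') (ContMDiffOn.mono h inter_subset_left)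
    (ContMDiffOn.mono h' inter_subset_right)).contMDiffAt ((hU.inter hU').mem_nhds ⟨hx, hx'⟩)

theorem map_sum_smul {ι : Type*} (t : Finset ι) (x : M) (c : ι → ℂ) (w : ι → V x) (v : V x) :
    g x (∑ i ∈ t, c i • w i) v = ∑ i ∈ t, c i * g x (w i) v := by
  let l : V x →ₗ[ℂ] ℂ := ⟨⟨fun a => g x a v, fun a b => hg.add_left x a b v⟩,
    fun r a => hg.smul_left x r a v⟩
  change l _ = ∑ i ∈ t, c i • l (w i)
  simp

/-- Both `g` and `t` are holomorphic, so `∂̄` falls on `s` alone. -/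
theorem delbar_left {s t : ∀ x, V x} {x : M} (hs : SmoothSectionAt I F s x) (ht : HolAt I F t x)
    (X : TangentSpace I x) :
    SmoothFunAt I (fun y => g y (s y) (t y)) x ∧
    delbar I (fun y => g y (s y) (t y)) x X = g x (delbarSection I F s x X) (t x) := by
  have h : ∀ᶠ y in 𝓝 x, g y (s y) (t y)
      = ∑ i, frameCoeff (F := F) s x i y • g y (frameAt F V x i y) (t y) := by
    filter_upwards [eq_sum_frame (F := F) s x] with y hy
    conv_lhs => rw [hy]
    exact hg.map_sum_smul _ _ _ _ _
  have hh := fun i => hg.holAt (holAt_frameAt (F := F) (V := V) x i) ht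
  have hr : ∀ i, RealDiffAt I (fun y => g y (frameAt F V x i y) (t y)) x :=
    fun i => realDiffAt_of_hol ((hh i).mdifferentiableAt (by simp))
  refine ⟨SmoothFunAt.congr (SmoothFunAt.sum (s := Finset.univ)
    fun i _ => (hs.frameCoeff i).smul (SmoothFunAt.of_hol (hh i))) (h.mono fun y hy => hy.symm), ?_⟩
  rw [delbar_congr h, delbar_sum fun i _ => (hs.frameCoeff i).realDiffAt.smul (hr i),
    delbarSection_sum (t := Finset.univ) (fun i _ => (hs.frameCoeff i).realDiffAt)
    (fun i _ => holAt_frameAt x i) (eq_sum_frame s x), hg.map_sum_smul]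
  refine Finset.sum_congr rfl fun i _ => ?_
  rw [delbar_smul (hs.frameCoeff i).realDiffAt (hr i),
    delbar_of_hol ((hh i).mdifferentiableAt (by simp)), smul_zero, zero_add, smul_eq_mul]

theorem sub_left (x : M) (a b c : V x) : g x (a - b) c = g x a c - g x b c := by
  have h := hg.add_left x (a - b) b c
  rw [sub_add_cancel] at h
  rw [h, add_sub_cancel_right]

/-- The Chern connection of `g (·, k ·)` is `nabla`. -/
theorem chern_eq (hk : IsCompatibleRealStructure I F g k) {s : ∀ x, V x} {x : M}
    (hs : SmoothSectionAt I F s x) (X : TangentSpace I x) :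
    chern I F (herm g k) s x X = nabla I F k s x X := by
  have key : ∀ t : ∀ y, V y, HolAt I F t x →
      del I (fun y => herm g k y (s y) (t y)) x X = herm g k x (nabla I F k s x X) (t x) := by
    intro t ht
    have h := hg.delbar_left (hk.map_smooth hs) ht X
    -- Compatibility and `k² = 1` write `h (s, t)` as the conjugate of `g (k s, t)`, to which
    -- `delbar_left` applies.
    have hc : (fun y => herm g k y (s y) (t y))
        = fun y => starRingEnd ℂ (g y (k y (s y)) (t y)) := by
      funext y
      rw [← hk.compatible, hk.involutive]
      rfl
    rw [hc, ← conj_delbar h.1.realDiffAt, h.2, ← hk.compatible]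
    rfl
  have hex : ∃ w : V x, ∀ (U : Set M) (t : ∀ y, V y), IsOpen U → x ∈ U →
      IsHolSection I F U t → del I (fun y => herm g k y (s y) (t y)) x X = herm g k x w (t x) :=
    ⟨_, fun U t hU hx ht => key t (ht.holAt hU hx)⟩
  have hsp := Classical.epsilon_spec hex
  rw [← sub_eq_zero]
  refine hg.nondegenerate x _ fun b => ?_
  rw [hg.sub_left]
  -- With a test section through `k b`, the value `h (w, k b)` is `g (w, b)`. Nondegeneracy of `g`
  -- then determines the chosen vector.
  obtain ⟨U, hU, hx, ht⟩ := (holAt_extend (I := I) (F := F) (k x b)).exists_isHolSection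
  have h1 := hsp U _ hU hx ht
  rw [key _ (ht.holAt hU hx)] at h1
  simp only [herm, extend_apply_self, hk.involutive] at h1
  rw [h1]
  exact sub_self _

/-- A holomorphic section is annihilated by `∂̄` on a whole neighbourhood, so the term `D_X D_Ȳ s`
drops out and the curvature depends on `Y` through its value at the point only. -/
theorem chernCurvature_eq (hk : IsCompatibleRealStructure I F g k) {X Y : ∀ x : M, TangentSpace I x}
    {s : ∀ x, V x} {x : M} (hs : HolAt I F s x) :
    chernCurvature I F (herm g k) X Y s x = nablaCurvature I F k X s x (Y x) := by
  unfold chernCurvature nablaCurvature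
  have h0 : ∀ᶠ y in 𝓝 x, (0 : V y) = delbarSection I F s y (Y y) := by
    filter_upwards [hs.eventually] with y hy
    rw [delbarSection_of_hol hy]
  rw [hg.chern_eq hk ((HolAt.zero x).congr h0).smooth,
    ← nabla_congr k h0,
    delbarSection_congr (t := fun y => nabla I F k s y (X y))]
  · have : nabla I F k (fun y => (0 : V y)) x (X x) = 0 := by
      simp only [nabla, hk.map_zero, delbarSection_of_hol (HolAt.zero x)]
    rw [this, zero_sub]
  · filter_upwards [hs.eventually] with y hy
    rw [hg.chern_eq hk hy.smooth]

end IsHolMetric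

end RealStructure

/-! ### Naturality of `k ∂̄ k` and of its curvature -/

section PushNabla

variable {E : Type*} [NormedAddCommGroup E] [NormedSpace ℂ E]
  {H : Type*} [TopologicalSpace H] {I : ModelWithCorners ℂ E H} [I.Boundaryless]
  {M : Type*} [TopologicalSpace M] [ChartedSpace H M] [IsManifold I ω M]
  {F : Type*} [NormedAddCommGroup F] [NormedSpace ℂ F] [FiniteDimensional ℂ F]
  {V : M → Type*} [TopologicalSpace (TotalSpace F V)]
  [∀ x, AddCommGroup (V x)] [∀ x, Module ℂ (V x)] [∀ x, TopologicalSpace (V x)] [FiberBundle F V]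
  [VectorBundle ℂ F V] [ContMDiffVectorBundle ω F V I]
  {E' : Type*} [NormedAddCommGroup E'] [NormedSpace ℂ E']
  {H' : Type*} [TopologicalSpace H'] {I' : ModelWithCorners ℂ E' H'} [I'.Boundaryless]
  {N : Type*} [TopologicalSpace N] [ChartedSpace H' N]
  {F' : Type*} [NormedAddCommGroup F'] [NormedSpace ℂ F']
  {W : N → Type*} [TopologicalSpace (TotalSpace F' W)]
  [∀ x, AddCommGroup (W x)] [∀ x, Module ℂ (W x)] [∀ x, TopologicalSpace (W x)] [FiberBundle F' W]
  [VectorBundle ℂ F' W]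
  {g : ∀ x, V x → V x → ℂ} {k : ∀ x, V x → V x} {k' : ∀ n, W n → W n}
  {φ : N → M} {L : ∀ n, V (φ n) → W n}

/-- `L` commutes with `∂̄` and intertwines the real structures, hence commutes with `k ∂̄ k`. No
metric occurs. The uses are the two lifts, over the projection, and `α`, over the identity. -/
theorem IsHolMorphism.nabla (hL : IsHolMorphism I F I' F' φ L)
    (hk : IsCompatibleRealStructure I F g k) (hkL : ∀ n a, k' n (L n a) = L n (k (φ n) a))
    {s : ∀ x, V x} {n : N} (hs : SmoothSectionAt I F s (φ n)) (X : TangentSpace I' n) :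
    nabla I' F' k' (fun y => L y (s (φ y))) n X
      = L n (TTGeometry.nabla I F k s (φ n) (mfderiv I' I φ n X)) := by
  unfold TTGeometry.nabla
  rw [← hkL, ← hL.delbarSection (hk.map_smooth hs)]
  simp only [hkL]

/-- For `φ`-related fields `X'` and `X` the connections correspond near `n`; commuting `L` with one
further `∂̄`, applied to the smooth section `∇_X s`, gives the curvature. -/
theorem IsHolMorphism.nablaCurvature [IsManifold I' ω N] (hL : IsHolMorphism I F I' F' φ L)
    (hk : IsCompatibleRealStructure I F g k) (hkL : ∀ n a, k' n (L n a) = L n (k (φ n) a))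
    {s : ∀ x, V x} {n : N} (hs : HolAt I F s (φ n)) {X : ∀ x : M, TangentSpace I x}
    (hX : HolAt I E X (φ n)) {X' : ∀ n : N, TangentSpace I' n}
    (hXX : ∀ᶠ y in 𝓝 n, mfderiv I' I φ y (X' y) = X (φ y)) (Y : TangentSpace I' n) :
    nablaCurvature I' F' k' X' (fun y => L y (s (φ y))) n Y
      = L n (TTGeometry.nablaCurvature I F k X s (φ n) (mfderiv I' I φ n Y)) := by
  have hneg : ∀ a, L n (-a) = - L n a := fun a => by simpa using hL.smul n (-1) a
  unfold TTGeometry.nablaCurvature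
  rw [hneg, ← hL.delbarSection (hk.nabla_smooth hs.smooth hX)]
  congr 1
  refine delbarSection_congr ?_ Y
  filter_upwards [hXX, hL.hol_base.continuous.continuousAt.eventually hs.eventually] with y hy hys
  rw [hL.nabla hk hkL hys.smooth, hy]

end PushNabla

/-! ### The Lie bracket in a chart -/

section Bracket

variable {E : Type*} [NormedAddCommGroup E] [NormedSpace ℂ E]
  {H : Type*} [TopologicalSpace H] {I : ModelWithCorners ℂ E H} [I.Boundaryless]
  {M : Type*} [TopologicalSpace M] [ChartedSpace H M] [IsManifold I ω M]
  {G : Type*} [NormedAddCommGroup G] [NormedSpace ℂ G]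

theorem isInvertible_mfderiv_extChartAt {x y : M} (hy : y ∈ (chartAt H x).source) :
    (mfderiv I 𝓘(ℂ, E) (extChartAt I x) y).IsInvertible := by
  have : IsManifold I 1 M := .of_le (n := ω) le_top
  exact _root_.isInvertible_mfderiv_extChartAt (by rwa [extChartAt_source])

theorem sectionCoord_holAt {F : Type*} [NormedAddCommGroup F] [NormedSpace ℂ F]
    {V : M → Type*} [TopologicalSpace (TotalSpace F V)]
    [∀ x, AddCommGroup (V x)] [∀ x, Module ℂ (V x)] [∀ x, TopologicalSpace (V x)]
    [FiberBundle F V] [VectorBundle ℂ F V] [ContMDiffVectorBundle ω F V I]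
    {s : ∀ x, V x} {x y : M} (hy : y ∈ (trivializationAt F V x).baseSet) (hs : HolAt I F s y) :
    ContMDiffAt I 𝓘(ℂ, F) ω (sectionCoord F s x) y :=
  ((trivializationAt F V x).contMDiffAt_section_iff hy).1 hs

theorem holAt_of_sectionCoord' {F : Type*} [NormedAddCommGroup F] [NormedSpace ℂ F]
    {V : M → Type*} [TopologicalSpace (TotalSpace F V)]
    [∀ x, AddCommGroup (V x)] [∀ x, Module ℂ (V x)] [∀ x, TopologicalSpace (V x)]
    [FiberBundle F V] [VectorBundle ℂ F V] [ContMDiffVectorBundle ω F V I]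
    {s : ∀ x, V x} {x y : M} (hy : y ∈ (trivializationAt F V x).baseSet)
    (hs : ContMDiffAt I 𝓘(ℂ, F) ω (sectionCoord F s x) y) : HolAt I F s y :=
  ((trivializationAt F V x).contMDiffAt_section_iff hy).2 hs

theorem mlieBracket_eq_fderiv (X Y : ∀ u : E, TangentSpace 𝓘(ℂ, E) u) (u : E) :
    VectorField.mlieBracket 𝓘(ℂ, E) X Y u
      = fderiv ℂ (fun u => (show E from Y u)) u (X u)
        - fderiv ℂ (fun u => (show E from X u)) u (Y u) := by
  have h := VectorField.mlieBracketWithin_eq_lieBracketWithin (V := X) (W := Y) (s := univ)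
  have h1 : VectorField.mlieBracket 𝓘(ℂ, E) X Y = VectorField.lieBracketWithin ℂ X Y univ := by
    rw [← VectorField.mlieBracketWithin_univ]; exact h
  exact (congrFun h1 u).trans (congrFun VectorField.lieBracketWithin_univ u)

/-- The Lie bracket in the chart at `x`. -/
theorem sectionCoord_mlieBracket [CompleteSpace E] {x y : M} (hy : y ∈ (chartAt H x).source)
    {X Y : ∀ y : M, TangentSpace I y} (hX : HolAt I E X y) (hY : HolAt I E Y y) :
    sectionCoord E (fun z => VectorField.mlieBracket I X Y z) x y
      = realDeriv I (sectionCoord E Y x) y (X y) - realDeriv I (sectionCoord E X x) y (Y y) := by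
  have : IsManifold I 2 M := .of_le (n := ω) le_top
  have : IsManifold I (minSmoothness ℂ 2) M := .of_le (n := ω) le_top
  set ψ := extChartAt I x with hψ
  have hys : y ∈ ψ.source := by rwa [hψ, extChartAt_source]
  have hψy : ContMDiffAt I 𝓘(ℂ, E) ω ψ y := contMDiffAt_extChartAt' hy
  have hcoord : ∀ {Z : ∀ y : M, TangentSpace I y}, HolAt I E Z y →
      ContDiffAt ℂ ω (fun u => sectionCoord E Z x (ψ.symm u)) (ψ y) := by
    intro Z hZ
    have h1 : ContMDiffAt I 𝓘(ℂ, E) ω (sectionCoord E Z x) y := sectionCoord_holAt (by simpa using hy) hZ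
    have h2 : ContMDiffAt 𝓘(ℂ, E) I ω ψ.symm (ψ y) :=
      (contMDiffOn_extChartAt_symm x).contMDiffAt
        ((isOpen_extChartAt_target x).mem_nhds (ψ.map_source hys))
    have h3 : ContMDiffAt I 𝓘(ℂ, E) ω (sectionCoord E Z x) (ψ.symm (ψ y)) := by
      rwa [ψ.left_inv hys]
    exact (h3.comp _ h2).contDiffAt
  -- Near `y` every field is the pullback of its coordinate expression under the chart, and brackets
  -- commute with pullback.
  have hpull : ∀ Z : ∀ y : M, TangentSpace I y, ∀ᶠ z in 𝓝 y,
      Z z = VectorField.mpullback I 𝓘(ℂ, E) ψ (fun u => sectionCoord E Z x (ψ.symm u)) z := by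
    intro Z
    filter_upwards [(chartAt H x).open_source.mem_nhds hy] with z hz
    change Z z = (mfderiv I 𝓘(ℂ, E) ψ z).inverse (sectionCoord E Z x (ψ.symm (ψ z)))
    rw [ψ.left_inv (by rwa [hψ, extChartAt_source]), sectionCoord_tangent Z hz]
    exact ((isInvertible_mfderiv_extChartAt hz).inverse_apply_eq.2 rfl).symm
  have hder : ∀ {Z : ∀ y : M, TangentSpace I y}, HolAt I E Z y → ∀ W : TangentSpace I y,
      realDeriv I (sectionCoord E Z x) y W = fderiv ℂ (fun u => sectionCoord E Z x (ψ.symm u)) (ψ y)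
        (show E from mfderiv I 𝓘(ℂ, E) ψ y W) := by
    intro Z hZ W
    have hd := (hcoord hZ).differentiableAt (by simp)
    rw [realDeriv_eq_fderiv_chart (hd.restrictScalars ℝ) hy, hd.fderiv_restrictScalars ℝ]
    rfl
  have hm : ∀ {Z : ∀ y : M, TangentSpace I y}, HolAt I E Z y →
      MDifferentiableAt 𝓘(ℂ, E) 𝓘(ℂ, E).tangent
      (fun u => (⟨u, sectionCoord E Z x (ψ.symm u)⟩ : TangentBundle 𝓘(ℂ, E) E)) (ψ y) := by
    intro Z hZ
    exact (contMDiffAt_vectorSpace_iff_contDiffAt.2 (hcoord hZ)).mdifferentiableAt (by simp)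
  rw [sectionCoord_tangent _ hy,
    Filter.EventuallyEq.mlieBracket_vectorField_eq (hpull X) (hpull Y),
    ← VectorField.mpullback_mlieBracket (hm hX) (hm hY) hψy le_top, hder hX, hder hY]
  set X' : E → E := fun u => sectionCoord E X x (ψ.symm u) with hX'
  set Y' : E → E := fun u => sectionCoord E Y x (ψ.symm u) with hY'
  have h1 : VectorField.mpullback I 𝓘(ℂ, E) ψ (VectorField.mlieBracket 𝓘(ℂ, E) X' Y') y
      = (mfderiv I 𝓘(ℂ, E) ψ y).inverse
        (fderiv ℂ Y' (ψ y) (X' (ψ y)) - fderiv ℂ X' (ψ y) (Y' (ψ y))) := by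
    exact congrArg _ (mlieBracket_eq_fderiv X' Y' (ψ y))
  have hx : ∀ Z : ∀ y : M, TangentSpace I y, sectionCoord E Z x (ψ.symm (ψ y))
      = (show E from mfderiv I 𝓘(ℂ, E) ψ y (Z y)) := fun Z => by
    rw [ψ.left_inv hys, sectionCoord_tangent _ hy]
  have h2 : X' (ψ y) = _ := hx X
  have h3 : Y' (ψ y) = _ := hx Y
  rw [← h2, ← h3]
  exact (congrArg _ h1).trans ((isInvertible_mfderiv_extChartAt hy).inverse_apply_eq.1 rfl).symm

end Bracket

/-! ### Holomorphic connections in a trivialization -/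

section Connection

variable {E : Type*} [NormedAddCommGroup E] [NormedSpace ℂ E]
  {H : Type*} [TopologicalSpace H] {I : ModelWithCorners ℂ E H} [I.Boundaryless]
  {M : Type*} [TopologicalSpace M] [ChartedSpace H M] [IsManifold I ω M]
  {F : Type*} [NormedAddCommGroup F] [NormedSpace ℂ F] [FiniteDimensional ℂ F]
  {V : M → Type*} [TopologicalSpace (TotalSpace F V)]
  [∀ x, AddCommGroup (V x)] [∀ x, Module ℂ (V x)] [∀ x, TopologicalSpace (V x)]
  [∀ x, IsTopologicalAddGroup (V x)] [∀ x, ContinuousSMul ℂ (V x)]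
  [FiberBundle F V] [VectorBundle ℂ F V] [ContMDiffVectorBundle ω F V I]

/-- The fibre coordinate of the preferred trivialization at `x`. -/
def fibreCoord (x : M) (u : TotalSpace F V) : F := (trivializationAt F V x u).2

theorem fibreCoord_add {x y : M} (hy : y ∈ (trivializationAt F V x).baseSet) (a b : V y) :
    fibreCoord x (TotalSpace.mk' F y (a + b))
      = fibreCoord x (TotalSpace.mk' F y a) + fibreCoord x (TotalSpace.mk' F y b) :=
  ((trivializationAt F V x).linear ℂ hy).map_add _ _

theorem fibreCoord_smul {x y : M} (hy : y ∈ (trivializationAt F V x).baseSet) (c : ℂ) (a : V y) :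
    fibreCoord x (TotalSpace.mk' F y (c • a)) = c • fibreCoord x (TotalSpace.mk' F y a) :=
  ((trivializationAt F V x).linear ℂ hy).map_smul _ _

theorem fibreCoord_sum {x y : M} (hy : y ∈ (trivializationAt F V x).baseSet) {ι : Type*}
    (t : Finset ι) (w : ι → V y) :
    fibreCoord x (TotalSpace.mk' F y (∑ i ∈ t, w i))
      = ∑ i ∈ t, fibreCoord x (TotalSpace.mk' F y (w i)) := by
  have h := ((trivializationAt F V x).linear ℂ hy)
  exact (by simp [map_sum] : h.mk' _ (∑ i ∈ t, w i) = ∑ i ∈ t, h.mk' _ (w i))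

theorem fibreCoord_symm {x y : M} (hy : y ∈ (trivializationAt F V x).baseSet) (a : F) :
    fibreCoord x (TotalSpace.mk' F y ((trivializationAt F V x).symm y a)) = a := by
  simp only [fibreCoord]
  rw [(trivializationAt F V x).apply_mk_symm hy]

theorem symm_fibreCoord {x y : M} (hy : y ∈ (trivializationAt F V x).baseSet) (a : V y) :
    (trivializationAt F V x).symm y (fibreCoord x (TotalSpace.mk' F y a)) = a :=
  (trivializationAt F V x).symm_apply_apply_mk hy a

theorem fibreCoord_injective {x y : M} (hy : y ∈ (trivializationAt F V x).baseSet) {a b : V y}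
    (h : fibreCoord x (TotalSpace.mk' F y a) = fibreCoord x (TotalSpace.mk' F y b)) : a = b := by
  rw [← symm_fibreCoord hy a, h, symm_fibreCoord hy b]

theorem fibreCoord_frameAt {x y : M} (hy : y ∈ (trivializationAt F V x).baseSet)
    (i : Fin (Module.finrank ℂ F)) :
    fibreCoord x (TotalSpace.mk' F y (frameAt F V x i y)) = Module.finBasis ℂ F i := by
  rw [frameAt, Trivialization.localFrame_apply_of_mem_baseSet _ _ hy]
  simp [fibreCoord, Trivialization.basisAt, hy]

theorem holAt_frameAt' {x y : M} (hy : y ∈ (trivializationAt F V x).baseSet)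
    (i : Fin (Module.finrank ℂ F)) : HolAt I F (frameAt F V x i) y :=
  contMDiffAt_localFrame_of_mem _ _ _ _ hy

theorem eq_sum_frame' {x y : M} (hy : y ∈ (trivializationAt F V x).baseSet) (a : V y) :
    a = ∑ i, (Module.finBasis ℂ F).repr (fibreCoord x (TotalSpace.mk' F y a)) i •
      frameAt F V x i y := by
  refine fibreCoord_injective hy ?_
  simp only [fibreCoord_sum hy, fibreCoord_smul hy, fibreCoord_frameAt hy]
  exact ((Module.finBasis ℂ F).sum_repr _).symm

theorem holAt_extend' {x y : M} (w : V x) (hy : y ∈ (trivializationAt F V x).baseSet) :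
    HolAt I F (extend F w) y := by
  refine holAt_of_sectionCoord' hy ?_
  refine (contMDiffAt_const (c := (trivializationAt F V x ⟨x, w⟩).2)).congr_of_eventuallyEq ?_
  filter_upwards [(trivializationAt F V x).open_baseSet.mem_nhds hy] with y hy
  exact fibreCoord_symm hy _

theorem realDeriv_const {G : Type*} [NormedAddCommGroup G] [NormedSpace ℂ G] (c : G) (x : M)
    (X : TangentSpace I x) : realDeriv I (fun _ : M => c) x X = 0 := by
  simp only [realDeriv, fderiv_fun_const]
  rfl

variable (D : CovariantDerivative I F V)

theorem conn_congr {s t : ∀ x, V x} {x : M} (hs : HolAt I F s x) (h : ∀ᶠ y in 𝓝 x, s y = t y) :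
    D s x = D t x :=
  (D.isCovariantDerivativeOn (s := univ)).congr_of_eventuallyEq hs.mdifferentiableAt
    (hs.congr h).mdifferentiableAt Filter.univ_mem h

theorem conn_add {s t : ∀ x, V x} {x : M} (hs : HolAt I F s x) (ht : HolAt I F t x)
    (X : TangentSpace I x) :
    D (fun y => s y + t y) x X = D s x X + D t x X := by
  have h := (D.isCovariantDerivativeOn (s := univ)).add hs.mdifferentiableAt ht.mdifferentiableAt
  exact DFunLike.congr_fun h X

theorem conn_smul {f : M → ℂ} {s : ∀ x, V x} {x : M} (hf : ContMDiffAt I 𝓘(ℂ, ℂ) ω f x)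
    (hs : HolAt I F s x) (X : TangentSpace I x) :
    D (fun y => f y • s y) x X = f x • D s x X + mvfderiv I f x X • s x := by
  have h := (D.isCovariantDerivativeOn (s := univ)).leibniz hs.mdifferentiableAt
    (hf.mdifferentiableAt (by simp))
  exact DFunLike.congr_fun h X

theorem conn_zero (x : M) (X : TangentSpace I x) : D (fun y => (0 : V y)) x X = 0 := by
  have h := (D.isCovariantDerivativeOn (s := univ)).zero (x := x)
  exact DFunLike.congr_fun h X

theorem conn_sum {ι : Type*} (t : Finset ι) {s : ι → ∀ x, V x} {x : M}
    (hs : ∀ i ∈ t, HolAt I F (s i) x) (X : TangentSpace I x) :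
    HolAt I F (fun y => ∑ i ∈ t, s i y) x ∧
    D (fun y => ∑ i ∈ t, s i y) x X = ∑ i ∈ t, D (s i) x X := by
  classical
  induction t using Finset.induction_on with
  | empty => simpa using ⟨HolAt.zero x, conn_zero D x X⟩
  | insert a t ha ih =>
    simp only [Finset.sum_insert ha]
    have h := ih fun i hi => hs i (Finset.mem_insert_of_mem hi)
    have ha := hs a (Finset.mem_insert_self a t)
    exact ⟨ha.add h.1, by rw [conn_add D ha h.1, h.2]⟩

/-- The connection matrix in the preferred trivialization at `x`, applied to `a`. -/
def connForm (x y : M) (X : TangentSpace I y) (a : F) : F :=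
  ∑ i, (Module.finBasis ℂ F).repr a i •
    fibreCoord x (TotalSpace.mk' F y (D (frameAt F V x i) y X))

theorem connForm_add_right (x y : M) (X : TangentSpace I y) (a b : F) :
    connForm D x y X (a + b) = connForm D x y X a + connForm D x y X b := by
  simp [connForm, add_smul, Finset.sum_add_distrib]

theorem connForm_smul_right (x y : M) (X : TangentSpace I y) (c : ℂ) (a : F) :
    connForm D x y X (c • a) = c • connForm D x y X a := by
  simp [connForm, Finset.smul_sum, mul_smul]

theorem connForm_basis (x y : M) (X : TangentSpace I y) (i : Fin (Module.finrank ℂ F)) :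
    connForm D x y X (Module.finBasis ℂ F i)
      = fibreCoord x (TotalSpace.mk' F y (D (frameAt F V x i) y X)) := by
  simp [connForm, Finsupp.single_apply]

theorem mvfderiv_clm {G G' : Type*} [NormedAddCommGroup G] [NormedSpace ℂ G]
    [NormedAddCommGroup G'] [NormedSpace ℂ G'] {f : M → G} {x : M}
    (hf : ContMDiffAt I 𝓘(ℂ, G) ω f x) (L : G →L[ℂ] G') (X : TangentSpace I x) :
    mvfderiv I (fun y => L (f y)) x X = L (realDeriv I f x X) := by
  have h1 : ContMDiffAt I 𝓘(ℂ, G') ω (fun y => L (f y)) x := L.contMDiff.contMDiffAt.comp x hf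
  rw [← (realDeriv_of_hol (h1.mdifferentiableAt (by simp)) X).2]
  exact realDeriv_clm (SmoothFunAt.of_hol hf).realDiffAt (L.restrictScalars ℝ) X

/-- The connection in the preferred trivialization at `x`. -/
theorem fibreCoord_conn {x y : M} (hy : y ∈ (trivializationAt F V x).baseSet) {s : ∀ x, V x}
    (hs : HolAt I F s y) (X : TangentSpace I y) :
    fibreCoord x (TotalSpace.mk' F y (D s y X)) = realDeriv I (sectionCoord F s x) y X
      + connForm D x y X (sectionCoord F s x y) := by
  set b := Module.finBasis ℂ F
  have hc := sectionCoord_holAt hy hs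
  have hci : ∀ i, ContMDiffAt I 𝓘(ℂ, ℂ) ω (frameCoeff (F := F) s x i) y := fun i =>
    ((b.coord i).toContinuousLinearMap.contMDiff.contMDiffAt).comp y hc
  have hsum : ∀ᶠ z in 𝓝 y, s z = ∑ i, frameCoeff (F := F) s x i z • frameAt F V x i z := by
    filter_upwards [(trivializationAt F V x).open_baseSet.mem_nhds hy] with z hz
    exact eq_sum_frame' hz (s z)
  -- The Leibniz rule on the frame expansion produces the connection form from the frame and the
  -- ordinary derivative from the coefficients.
  rw [conn_congr D hs hsum, (conn_sum D _ (fun i _ => (holAt_frameAt' hy i).smul (hci i)) X).2,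
    fibreCoord_sum hy]
  simp only [conn_smul D (hci _) (holAt_frameAt' hy _), fibreCoord_add hy, fibreCoord_smul hy,
    Finset.sum_add_distrib, fibreCoord_frameAt hy]
  rw [add_comm]
  congr 1
  have : ∀ i, mvfderiv I (frameCoeff (F := F) s x i) y X
      = b.repr (realDeriv I (sectionCoord F s x) y X) i := fun i =>
    mvfderiv_clm hc (b.coord i).toContinuousLinearMap X
  simp only [this]
  exact b.sum_repr _

theorem fibreCoord_conn_extend {x y : M} (w : V x) (hy : y ∈ (trivializationAt F V x).baseSet)
    (X : TangentSpace I y) :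
    fibreCoord x (TotalSpace.mk' F y (D (extend F w) y X))
      = connForm D x y X (fibreCoord x (TotalSpace.mk' F x w)) := by
  have h : sectionCoord F (extend F w) x =ᶠ[𝓝 y] fun _ => fibreCoord x (TotalSpace.mk' F x w) := by
    filter_upwards [(trivializationAt F V x).open_baseSet.mem_nhds hy] with z hz
    exact fibreCoord_symm hz _
  rw [fibreCoord_conn D hy (holAt_extend' w hy), realDeriv_congr h, h.eq_of_nhds, realDeriv_const,
    zero_add]

theorem IsHolConnection.holAt {D : CovariantDerivative I F V} (hD : IsHolConnection D)
    {s : ∀ x, V x} {X : ∀ x : M, TangentSpace I x} {x : M} (hs : HolAt I F s x)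
    (hX : HolAt I E X x) : HolAt I F (fun y => D s y (X y)) x := by
  have : IsManifold I 1 M := .of_le (n := ω) le_top
  obtain ⟨U, hU, hx, h⟩ := hs.exists_isHolSection
  have h1 := (hD U hU).contMDiff (σ := s) h
  have h2 := h1.contMDiffAt (hU.mem_nhds hx)
  exact ContMDiffAt.clm_bundle_apply h2 hX

end Connection

/-! ### Coordinates on the total space -/

section TotalSpaceGeometry

variable {E : Type*} [NormedAddCommGroup E] [NormedSpace ℂ E]
  {H : Type*} [TopologicalSpace H] {I : ModelWithCorners ℂ E H} [I.Boundaryless]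
  {M : Type*} [TopologicalSpace M] [ChartedSpace H M] [IsManifold I ω M]
  {F : Type*} [NormedAddCommGroup F] [NormedSpace ℂ F] [FiniteDimensional ℂ F]
  {V : M → Type*} [TopologicalSpace (TotalSpace F V)]
  [∀ x, AddCommGroup (V x)] [∀ x, Module ℂ (V x)] [∀ x, TopologicalSpace (V x)]
  [∀ x, IsTopologicalAddGroup (V x)] [∀ x, ContinuousSMul ℂ (V x)]
  [FiberBundle F V] [VectorBundle ℂ F V] [ContMDiffVectorBundle ω F V I]

theorem mem_chartAt_source_total {v u : TotalSpace F V}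
    (h1 : u.proj ∈ (chartAt H v.proj).source)
    (h2 : u.proj ∈ (trivializationAt F V v.proj).baseSet) :
    u ∈ (chartAt (ModelProd H F) v).source := by
  rw [FiberBundle.chartedSpace_chartAt]
  simp [h1, h2, Trivialization.mem_source]

theorem extChartAt_total {v u : TotalSpace F V}
    (h2 : u.proj ∈ (trivializationAt F V v.proj).baseSet) :
    extChartAt (I.prod 𝓘(ℂ, F)) v u = (extChartAt I v.proj u.proj, fibreCoord v.proj u) := by
  rw [FiberBundle.extChartAt]
  simp [fibreCoord, h2, Trivialization.mem_source, Trivialization.coe_fst]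

theorem contMDiffAt_fibreCoord {x : M} {u : TotalSpace F V}
    (h2 : u.proj ∈ (trivializationAt F V x).baseSet) :
    ContMDiffAt (I.prod 𝓘(ℂ, F)) 𝓘(ℂ, F) ω (fibreCoord (F := F) (V := V) x) u := by
  have h := ((trivializationAt F V x).contMDiffOn (IB := I) (n := ω)).contMDiffAt
    ((trivializationAt F V x).open_source.mem_nhds ((trivializationAt F V x).mem_source.2 h2))
  exact h.snd

theorem isOpen_preimage_proj {s : Set M} (hs : IsOpen s) : IsOpen {u : TotalSpace F V | u.proj ∈ s} :=
  hs.preimage (FiberBundle.continuous_proj F V)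

/-- The components of a tangent vector of the total space in the chart at `v`. -/
theorem sectionCoord_total (W : ∀ u : TotalSpace F V, TangentSpace (I.prod 𝓘(ℂ, F)) u)
    {v u : TotalSpace F V} (h1 : u.proj ∈ (chartAt H v.proj).source)
    (h2 : u.proj ∈ (trivializationAt F V v.proj).baseSet) :
    sectionCoord (E × F) W v u
      = ((show E from mfderiv I 𝓘(ℂ, E) (extChartAt I v.proj) u.proj (horPart I u (W u))),
        realDeriv (I.prod 𝓘(ℂ, F)) (fibreCoord v.proj) u (W u)) := by
  rw [sectionCoord_tangent W (mem_chartAt_source_total h1 h2)]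
  have hu := mem_chartAt_source_total h1 h2
  have hc : ContMDiffAt (I.prod 𝓘(ℂ, F)) 𝓘(ℂ, E × F) ω (extChartAt (I.prod 𝓘(ℂ, F)) v) u :=
    contMDiffAt_extChartAt' hu
  have hnear : ∀ᶠ z : TotalSpace F V in 𝓝 u, z.proj ∈ (trivializationAt F V v.proj).baseSet :=
    (isOpen_preimage_proj (trivializationAt F V v.proj).open_baseSet).mem_nhds h2
  have hd := realDeriv_of_hol (hc.mdifferentiableAt (by simp)) (W u)
  change mvfderiv (I.prod 𝓘(ℂ, F)) (extChartAt (I.prod 𝓘(ℂ, F)) v) u (W u) = _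
  rw [← hd.2]
  have hψ : ContMDiffAt I 𝓘(ℂ, E) ω (extChartAt I v.proj) u.proj := contMDiffAt_extChartAt' h1
  refine Prod.ext ?_ ?_
  · have := realDeriv_clm hd.1 (ContinuousLinearMap.fst ℝ E F) (W u)
    refine this.symm.trans ?_
    rw [realDeriv_congr (g := fun z => extChartAt I v.proj z.proj)
      (hnear.mono fun z hz => by rw [extChartAt_total hz]; rfl)]
    have hψd := realDeriv_of_hol (hψ.mdifferentiableAt (by simp)) (horPart I u (W u))
    exact (realDeriv_comp (φ := π F V) hψd.1
      ((contMDiff_proj V (n := ω)).mdifferentiable (by simp) u) (W u)).trans hψd.2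
  · have := realDeriv_clm hd.1 (ContinuousLinearMap.snd ℝ E F) (W u)
    refine this.symm.trans ?_
    rw [realDeriv_congr (g := fibreCoord v.proj)
      (hnear.mono fun z hz => by rw [extChartAt_total hz]; rfl)]

/-- A tangent vector of the total space is determined by its components. -/
theorem tangent_total_ext {u : TotalSpace F V} {W W' : TangentSpace (I.prod 𝓘(ℂ, F)) u}
    (h1 : horPart I u W = horPart I u W')
    (h2 : realDeriv (I.prod 𝓘(ℂ, F)) (fibreCoord u.proj) u W
      = realDeriv (I.prod 𝓘(ℂ, F)) (fibreCoord u.proj) u W') : W = W' := by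
  have hu : u ∈ (chartAt (ModelProd H F) u).source := mem_chart_source _ u
  have key : ∀ W : TangentSpace (I.prod 𝓘(ℂ, F)) u,
      (show E × F from mfderiv (I.prod 𝓘(ℂ, F)) 𝓘(ℂ, E × F) (extChartAt (I.prod 𝓘(ℂ, F)) u) u W)
      = ((show E from mfderiv I 𝓘(ℂ, E) (extChartAt I u.proj) u.proj (horPart I u W)),
        realDeriv (I.prod 𝓘(ℂ, F)) (fibreCoord u.proj) u W) := by
    intro W
    -- The component formula is known for fields, so the tangent vector is extended to one.
    let Wf : ∀ u : TotalSpace F V, TangentSpace (I.prod 𝓘(ℂ, F)) u :=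
      extend (E × F) (E := (TangentSpace (I.prod 𝓘(ℂ, F)) : TotalSpace F V → Type _)) W
    have hW : Wf u = W := extend_apply_self (F := E × F)
      (E := (TangentSpace (I.prod 𝓘(ℂ, F)) : TotalSpace F V → Type _)) W
    have h := sectionCoord_total Wf (mem_chart_source H u.proj)
      (mem_baseSet_trivializationAt' u.proj)
    rw [sectionCoord_tangent Wf hu, hW] at h
    exact h
  have hinj := (isInvertible_mfderiv_extChartAt (I := I.prod 𝓘(ℂ, F)) hu).injective
  refine hinj ?_
  refine (key W).trans (Eq.trans ?_ (key W').symm)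
  rw [h1, h2]

end TotalSpaceGeometry

/-! ### Horizontal and vertical lifts and the splitting of the tangent space -/

section Lifts

variable {E : Type*} [NormedAddCommGroup E] [NormedSpace ℂ E]
  {H : Type*} [TopologicalSpace H] {I : ModelWithCorners ℂ E H} [I.Boundaryless]
  {M : Type*} [TopologicalSpace M] [ChartedSpace H M] [IsManifold I ω M]
  {F : Type*} [NormedAddCommGroup F] [NormedSpace ℂ F] [FiniteDimensional ℂ F]
  {V : M → Type*} [TopologicalSpace (TotalSpace F V)]
  [∀ x, AddCommGroup (V x)] [∀ x, Module ℂ (V x)] [∀ x, TopologicalSpace (V x)]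
  [∀ x, IsTopologicalAddGroup (V x)] [∀ x, ContinuousSMul ℂ (V x)]
  [FiberBundle F V] [VectorBundle ℂ F V] [ContMDiffVectorBundle ω F V I]

variable (I) in
theorem contMDiff_vertical_line (x : M) (a w : V x) :
    ContMDiff 𝓘(ℂ, ℂ) (I.prod 𝓘(ℂ, F)) ω (fun t : ℂ => TotalSpace.mk' F x (a + t • w)) := by
  intro t
  rw [contMDiffAt_totalSpace]
  refine ⟨contMDiffAt_const, ?_⟩
  have hx := mem_baseSet_trivializationAt' (F := F) (E := V) x
  have h : ∀ t : ℂ, ((trivializationAt F V x) (TotalSpace.mk' F x (a + t • w))).2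
      = fibreCoord x (TotalSpace.mk' F x a) + t • fibreCoord x (TotalSpace.mk' F x w) := fun t => by
    rw [← fibreCoord_smul hx, ← fibreCoord_add hx]; rfl
  simp only [h]
  exact (contDiff_const.add (contDiff_id.smul contDiff_const)).contMDiff.contMDiffAt

theorem contMDiff_projection : ContMDiff (I.prod 𝓘(ℂ, F)) I ω (π F V) := contMDiff_proj V

/-- The line `t ↦ v + t w` projects to a constant map. -/
theorem horPart_vertLift (u : TotalSpace F V) (w : V u.proj) :
    horPart I u (vertLift I u w) = 0 := by
  have hγ := (contMDiff_vertical_line (F := F) I u.proj u.snd w).mdifferentiable (by simp) 0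
  have hπ : MDifferentiableAt (I.prod 𝓘(ℂ, F)) I (π F V)
    (TotalSpace.mk' F u.proj (u.snd + (0 : ℂ) • w)) :=
      contMDiff_projection.mdifferentiable (by simp) _
  have h := mfderiv_comp (0 : ℂ) hπ hγ
  have h0 : mfderiv 𝓘(ℂ, ℂ) I (π F V ∘ fun t : ℂ => TotalSpace.mk' F u.proj (u.snd + t • w)) 0
      = 0 := mfderiv_const
  have h1 := DFunLike.congr_fun (h0.symm.trans h) (show TangentSpace 𝓘(ℂ, ℂ) (0 : ℂ) from (1 : ℂ))
  have hu : TotalSpace.mk' F u.proj (u.snd + (0 : ℂ) • w) = u := by simp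
  rw [hu] at h1
  exact h1.symm

/-- The chain rule at a point known only to equal `φ n`. It is needed because `v + 0 • w`, or the
value at its centre of a section through `v`, equals `v` by an identity and not by definition. -/
theorem realDeriv_comp_at {E' : Type*} [NormedAddCommGroup E'] [NormedSpace ℂ E']
    {H' : Type*} [TopologicalSpace H'] {I' : ModelWithCorners ℂ E' H'} [I'.Boundaryless]
    {N : Type*} [TopologicalSpace N] [ChartedSpace H' N]
    {G : Type*} [NormedAddCommGroup G] [NormedSpace ℂ G] {φ : N → M} {f : M → G} {n : N} {p : M}
    (hp : φ n = p) (hf : RealDiffAt I f p) (hφ : MDifferentiableAt I' I φ n)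
    (X : TangentSpace I' n) {Y : TangentSpace I p}
    (hY : Y = (show TangentSpace I p from mfderiv I' I φ n X)) :
    realDeriv I f p Y = realDeriv I' (fun y => f (φ y)) n X := by
  subst hp
  subst hY
  exact (realDeriv_comp hf hφ X).symm

theorem realDeriv_line {G : Type*} [NormedAddCommGroup G] [NormedSpace ℂ G] (a b : G) :
    realDeriv 𝓘(ℂ, ℂ) (fun t : ℂ => a + t • b) (0 : ℂ)
      (show TangentSpace 𝓘(ℂ, ℂ) (0 : ℂ) from (1 : ℂ)) = b := by
  have hd : HasFDerivAt (fun t : ℂ => a + t • b)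
      ((ContinuousLinearMap.id ℂ ℂ).smulRight b) (0 : ℂ) :=
    ((ContinuousLinearMap.id ℂ ℂ).smulRight b).hasFDerivAt.const_add _
  have h : realDeriv 𝓘(ℂ, ℂ) (fun t : ℂ => a + t • b) (0 : ℂ)
      (show TangentSpace 𝓘(ℂ, ℂ) (0 : ℂ) from (1 : ℂ))
      = fderiv ℝ (fun t : ℂ => a + t • b) 0 1 := rfl
  rw [h, (hd.restrictScalars ℝ).fderiv]
  exact one_smul ℂ b

/-- In a trivialization the line `t ↦ v + t w` is affine, with direction the coordinate of `w`. -/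
theorem realDeriv_vertLift {x : M} {u : TotalSpace F V}
    (h2 : u.proj ∈ (trivializationAt F V x).baseSet) (w : V u.proj) :
    realDeriv (I.prod 𝓘(ℂ, F)) (fibreCoord x) u (vertLift I u w)
      = fibreCoord x (TotalSpace.mk' F u.proj w) := by
  have hγ := (contMDiff_vertical_line (F := F) I u.proj u.snd w).mdifferentiable (by simp) 0
  have hu : TotalSpace.mk' F u.proj (u.snd + (0 : ℂ) • w) = u := by simp
  have h := realDeriv_comp_at (φ := fun t : ℂ => TotalSpace.mk' F u.proj (u.snd + t • w))
    hu (SmoothFunAt.of_hol (contMDiffAt_fibreCoord h2)).realDiffAt hγ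
    (show TangentSpace 𝓘(ℂ, ℂ) (0 : ℂ) from (1 : ℂ)) (Y := vertLift I u w) rfl
  have h3 : (fun t : ℂ => fibreCoord x (TotalSpace.mk' F u.proj (u.snd + t • w)))
      = fun t => fibreCoord x u + t • fibreCoord x (TotalSpace.mk' F u.proj w) := by
    funext t
    rw [fibreCoord_add h2, fibreCoord_smul h2]
  rw [h3] at h
  exact h.trans (realDeriv_line _ _)

theorem vertLift_add (u : TotalSpace F V) (a b : V u.proj) :
    vertLift I u (a + b) = vertLift I u a + vertLift I u b := by
  have hu := mem_baseSet_trivializationAt' (F := F) (E := V) u.proj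
  refine tangent_total_ext ?_ ?_
  · rw [horPart_vertLift, horPart, map_add]
    exact (by rw [← horPart, ← horPart, horPart_vertLift, horPart_vertLift, add_zero])
  · rw [realDeriv_add_vec, realDeriv_vertLift hu, realDeriv_vertLift hu, realDeriv_vertLift hu,
      fibreCoord_add hu]

theorem horPart_add (u : TotalSpace F V) (W W' : TangentSpace (I.prod 𝓘(ℂ, F)) u) :
    horPart I u (W + W') = horPart I u W + horPart I u W' := map_add _ _ _

theorem horPart_sub (u : TotalSpace F V) (W W' : TangentSpace (I.prod 𝓘(ℂ, F)) u) :
    horPart I u (W - W') = horPart I u W - horPart I u W' := map_sub _ _ _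

theorem horPart_smul (u : TotalSpace F V) (c : ℂ) (W : TangentSpace (I.prod 𝓘(ℂ, F)) u) :
    horPart I u (c • W) = c • horPart I u W := map_smul _ _ _

theorem realDeriv_fibreCoord_smul {x : M} {u : TotalSpace F V}
    (h2 : u.proj ∈ (trivializationAt F V x).baseSet) (c : ℂ)
    (W : TangentSpace (I.prod 𝓘(ℂ, F)) u) :
    realDeriv (I.prod 𝓘(ℂ, F)) (fibreCoord x) u (c • W)
      = c • realDeriv (I.prod 𝓘(ℂ, F)) (fibreCoord x) u W := by
  have h := fun W => (realDeriv_of_hol (I := I.prod 𝓘(ℂ, F))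
    ((contMDiffAt_fibreCoord h2).mdifferentiableAt (by simp)) W).2
  rw [h, h, map_smul]

theorem realDeriv_fibreCoord_sub {x : M} {u : TotalSpace F V}
    (h2 : u.proj ∈ (trivializationAt F V x).baseSet)
    (W W' : TangentSpace (I.prod 𝓘(ℂ, F)) u) :
    realDeriv (I.prod 𝓘(ℂ, F)) (fibreCoord x) u (W - W')
      = realDeriv (I.prod 𝓘(ℂ, F)) (fibreCoord x) u W
        - realDeriv (I.prod 𝓘(ℂ, F)) (fibreCoord x) u W' := by
  have h := fun W => (realDeriv_of_hol (I := I.prod 𝓘(ℂ, F))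
    ((contMDiffAt_fibreCoord h2).mdifferentiableAt (by simp)) W).2
  rw [h, h, h, map_sub]

theorem vertLift_smul (u : TotalSpace F V) (c : ℂ) (a : V u.proj) :
    vertLift I u (c • a) = c • vertLift I u a := by
  have hu := mem_baseSet_trivializationAt' (F := F) (E := V) u.proj
  refine tangent_total_ext ?_ ?_
  · rw [horPart_vertLift, horPart_smul, horPart_vertLift, smul_zero]
  · rw [realDeriv_fibreCoord_smul hu, realDeriv_vertLift hu, realDeriv_vertLift hu,
      fibreCoord_smul hu]

variable (D : CovariantDerivative I F V)

theorem horPart_horLift (u : TotalSpace F V) (X : TangentSpace I u.proj) :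
    horPart I u (horLift D u X) = X := by
  have hu : TotalSpace.mk' F u.proj (extend F u.snd u.proj) = u := by
    rw [extend_apply_self]
  have hs := (holAt_extend (I := I) (F := F) u.snd).mdifferentiableAt
  have hπ : MDifferentiableAt (I.prod 𝓘(ℂ, F)) I (π F V)
    (TotalSpace.mk' F u.proj (extend F u.snd u.proj)) :=
      contMDiff_projection.mdifferentiable (by simp) _
  have h := DFunLike.congr_fun (mfderiv_comp u.proj hπ hs) X
  have h0 : mfderiv I I (π F V ∘ fun y => TotalSpace.mk' F y (extend F u.snd y)) u.proj
      = ContinuousLinearMap.id ℂ (TangentSpace I u.proj) := mfderiv_id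
  rw [h0, hu] at h
  rw [horLift, horPart_sub, horPart_vertLift, sub_zero]
  exact h.symm

/-- The ordinary derivative of the auxiliary section occurs in both terms of the lift and cancels,
leaving minus the connection form. This holds in the trivialization at any `x` whose domain contains
the base point. -/
theorem realDeriv_horLift {x : M} {u : TotalSpace F V}
    (h2 : u.proj ∈ (trivializationAt F V x).baseSet) (X : TangentSpace I u.proj) :
    realDeriv (I.prod 𝓘(ℂ, F)) (fibreCoord x) u (horLift D u X)
      = - connForm D x u.proj X (fibreCoord x u) := by
  have hu : TotalSpace.mk' F u.proj (extend F u.snd u.proj) = u := by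
    rw [extend_apply_self]
  have hs := (holAt_extend (I := I) (F := F) u.snd)
  have h := realDeriv_comp_at (φ := fun y => TotalSpace.mk' F y (extend F u.snd y)) hu
    (SmoothFunAt.of_hol (contMDiffAt_fibreCoord h2)).realDiffAt hs.mdifferentiableAt X rfl
  rw [horLift, realDeriv_fibreCoord_sub h2, realDeriv_vertLift h2, fibreCoord_conn D h2 hs]
  have h3 : sectionCoord F (extend F u.snd) x u.proj = fibreCoord x u := by
    rw [sectionCoord, extend_apply_self]; rfl
  rw [h3]
  refine (congrArg (· - _) h).trans ?_
  exact sub_add_cancel_left _ _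

theorem connForm_add_vec (x y : M) (X Y : TangentSpace I y) (a : F)
    (hy : y ∈ (trivializationAt F V x).baseSet) :
    connForm D x y (X + Y) a = connForm D x y X a + connForm D x y Y a := by
  simp [connForm, fibreCoord_add hy, Finset.sum_add_distrib]

theorem connForm_smul_vec (x y : M) (c : ℂ) (X : TangentSpace I y) (a : F)
    (hy : y ∈ (trivializationAt F V x).baseSet) :
    connForm D x y (c • X) a = c • connForm D x y X a := by
  simp [connForm, fibreCoord_smul hy, Finset.smul_sum, smul_comm c]

theorem horLift_add (u : TotalSpace F V) (X Y : TangentSpace I u.proj) :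
    horLift D u (X + Y) = horLift D u X + horLift D u Y := by
  have hu := mem_baseSet_trivializationAt' (F := F) (E := V) u.proj
  refine tangent_total_ext ?_ ?_
  · rw [horPart_horLift, horPart_add, horPart_horLift, horPart_horLift]
  · rw [realDeriv_add_vec, realDeriv_horLift D hu, realDeriv_horLift D hu, realDeriv_horLift D hu,
      connForm_add_vec D _ _ _ _ _ hu, neg_add]

theorem horLift_smul (u : TotalSpace F V) (c : ℂ) (X : TangentSpace I u.proj) :
    horLift D u (c • X) = c • horLift D u X := by
  have hu := mem_baseSet_trivializationAt' (F := F) (E := V) u.proj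
  refine tangent_total_ext ?_ ?_
  · rw [horPart_horLift, horPart_smul, horPart_horLift]
  · rw [realDeriv_fibreCoord_smul hu, realDeriv_horLift D hu, realDeriv_horLift D hu,
      connForm_smul_vec D _ _ _ _ _ hu, smul_neg]

theorem mvfderiv_fibreCoord {u : TotalSpace F V} (W : TangentSpace (I.prod 𝓘(ℂ, F)) u) :
    mvfderiv (I.prod 𝓘(ℂ, F)) (fun u' : TotalSpace F V => (trivializationAt F V u.proj u').2) u W
      = realDeriv (I.prod 𝓘(ℂ, F)) (fibreCoord u.proj) u W :=
  (realDeriv_of_hol ((contMDiffAt_fibreCoord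
    (mem_baseSet_trivializationAt' (F := F) (E := V) u.proj)).mdifferentiableAt (by simp)) W).2.symm

theorem fibreCoord_vertPart_self (u : TotalSpace F V) (W : TangentSpace (I.prod 𝓘(ℂ, F)) u) :
    fibreCoord u.proj (TotalSpace.mk' F u.proj (vertPart D u W))
      = realDeriv (I.prod 𝓘(ℂ, F)) (fibreCoord u.proj) u W
        + connForm D u.proj u.proj (horPart I u W) (fibreCoord u.proj u) := by
  have hu := mem_baseSet_trivializationAt' (F := F) (E := V) u.proj
  rw [vertPart, fibreCoord_add hu, fibreCoord_symm hu, mvfderiv_fibreCoord,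
    fibreCoord_conn_extend D _ hu]

theorem vertPart_add (u : TotalSpace F V) (W W' : TangentSpace (I.prod 𝓘(ℂ, F)) u) :
    vertPart D u (W + W') = vertPart D u W + vertPart D u W' := by
  have hu := mem_baseSet_trivializationAt' (F := F) (E := V) u.proj
  refine fibreCoord_injective hu ?_
  rw [fibreCoord_add hu]
  simp only [vertPart, fibreCoord_add hu, fibreCoord_symm hu, map_add, horPart_add]
  exact add_add_add_comm _ _ _ _

theorem vertPart_smul (u : TotalSpace F V) (c : ℂ) (W : TangentSpace (I.prod 𝓘(ℂ, F)) u) :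
    vertPart D u (c • W) = c • vertPart D u W := by
  have hu := mem_baseSet_trivializationAt' (F := F) (E := V) u.proj
  refine fibreCoord_injective hu ?_
  rw [fibreCoord_smul hu]
  simp only [vertPart, fibreCoord_add hu, fibreCoord_symm hu, map_smul, horPart_smul,
    fibreCoord_smul hu, smul_add]

theorem vertPart_vertLift (u : TotalSpace F V) (w : V u.proj) :
    vertPart D u (vertLift I u w) = w := by
  have hu := mem_baseSet_trivializationAt' (F := F) (E := V) u.proj
  refine fibreCoord_injective hu ?_
  rw [fibreCoord_vertPart_self, horPart_vertLift, realDeriv_vertLift hu]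
  simp only [connForm, map_zero]
  have h0 : fibreCoord u.proj (TotalSpace.mk' F u.proj (0 : V u.proj)) = 0 := by
    simpa using fibreCoord_smul hu 0 (0 : V u.proj)
  simp [h0]

theorem vertPart_horLift (u : TotalSpace F V) (X : TangentSpace I u.proj) :
    vertPart D u (horLift D u X) = 0 := by
  have hu := mem_baseSet_trivializationAt' (F := F) (E := V) u.proj
  refine fibreCoord_injective hu ?_
  have h0 : fibreCoord u.proj (TotalSpace.mk' F u.proj (0 : V u.proj)) = 0 := by
    simpa using fibreCoord_smul hu 0 (0 : V u.proj)
  rw [fibreCoord_vertPart_self, horPart_horLift, realDeriv_horLift D hu, h0, neg_add_cancel]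

/-- The connection form added in the vertical part cancels the one subtracted in the horizontal
lift. -/
theorem horLift_add_vertLift (u : TotalSpace F V) (W : TangentSpace (I.prod 𝓘(ℂ, F)) u) :
    horLift D u (horPart I u W) + vertLift I u (vertPart D u W) = W := by
  have hu := mem_baseSet_trivializationAt' (F := F) (E := V) u.proj
  refine tangent_total_ext ?_ ?_
  · rw [horPart_add, horPart_horLift, horPart_vertLift, add_zero]
  · rw [realDeriv_add_vec, realDeriv_horLift D hu, realDeriv_vertLift hu, fibreCoord_vertPart_self]
    abel

/-- The vertical part in the preferred trivialization at `x`. -/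
theorem fibreCoord_vertPart {x : M} {u : TotalSpace F V}
    (h2 : u.proj ∈ (trivializationAt F V x).baseSet) (W : TangentSpace (I.prod 𝓘(ℂ, F)) u) :
    fibreCoord x (TotalSpace.mk' F u.proj (vertPart D u W))
      = realDeriv (I.prod 𝓘(ℂ, F)) (fibreCoord x) u W
        + connForm D x u.proj (horPart I u W) (fibreCoord x u) := by
  conv_rhs => 
    enter [1]
    rw [← horLift_add_vertLift D u W]
  rw [realDeriv_add_vec, realDeriv_horLift D h2, realDeriv_vertLift h2]
  abel

end Lifts

/-! ### Sections along the projection of the total space -/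

section HolAlong

variable {E : Type*} [NormedAddCommGroup E] [NormedSpace ℂ E]
  {H : Type*} [TopologicalSpace H] {I : ModelWithCorners ℂ E H} [I.Boundaryless]
  {M : Type*} [TopologicalSpace M] [ChartedSpace H M] [IsManifold I ω M]
  {F : Type*} [NormedAddCommGroup F] [NormedSpace ℂ F] [FiniteDimensional ℂ F]
  {V : M → Type*} [TopologicalSpace (TotalSpace F V)]
  [∀ x, AddCommGroup (V x)] [∀ x, Module ℂ (V x)] [∀ x, TopologicalSpace (V x)]
  [∀ x, IsTopologicalAddGroup (V x)] [∀ x, ContinuousSMul ℂ (V x)]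
  [FiberBundle F V] [VectorBundle ℂ F V] [ContMDiffVectorBundle ω F V I]
  {F' : Type*} [NormedAddCommGroup F'] [NormedSpace ℂ F'] [FiniteDimensional ℂ F']
  {V' : M → Type*} [TopologicalSpace (TotalSpace F' V')]
  [∀ x, AddCommGroup (V' x)] [∀ x, Module ℂ (V' x)] [∀ x, TopologicalSpace (V' x)]
  [∀ x, IsTopologicalAddGroup (V' x)] [∀ x, ContinuousSMul ℂ (V' x)]
  [FiberBundle F' V'] [VectorBundle ℂ F' V'] [ContMDiffVectorBundle ω F' V' I]
  {F₂ : Type*} [NormedAddCommGroup F₂] [NormedSpace ℂ F₂] [FiniteDimensional ℂ F₂]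
  {V₂ : M → Type*} [TopologicalSpace (TotalSpace F₂ V₂)]
  [∀ x, AddCommGroup (V₂ x)] [∀ x, Module ℂ (V₂ x)] [∀ x, TopologicalSpace (V₂ x)]
  [∀ x, IsTopologicalAddGroup (V₂ x)] [∀ x, ContinuousSMul ℂ (V₂ x)]
  [FiberBundle F₂ V₂] [VectorBundle ℂ F₂ V₂] [ContMDiffVectorBundle ω F₂ V₂ I]

variable (I F') in
/-- Holomorphy at `u` of a section along the projection of `V`. -/
def HolAlong (P : ∀ u : TotalSpace F V, V' u.proj) (u : TotalSpace F V) : Prop :=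
  ContMDiffAt (I.prod 𝓘(ℂ, F)) 𝓘(ℂ, F') ω
    (fun z : TotalSpace F V => fibreCoord u.proj (TotalSpace.mk' F' z.proj (P z))) u

variable (F') in
/-- The frame coefficients of a section along the projection. -/
def alongCoeff (P : ∀ u : TotalSpace F V, V' u.proj) (x : M) (i : Fin (Module.finrank ℂ F'))
    (z : TotalSpace F V) : ℂ :=
  (Module.finBasis ℂ F').repr (fibreCoord x (TotalSpace.mk' F' z.proj (P z))) i

theorem eventually_proj_mem (u : TotalSpace F V) :
    ∀ᶠ z : TotalSpace F V in 𝓝 u, z.proj ∈ (trivializationAt F' V' u.proj).baseSet :=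
  (isOpen_preimage_proj (trivializationAt F' V' u.proj).open_baseSet).mem_nhds
    (mem_baseSet_trivializationAt' u.proj)

theorem eq_sum_alongCoeff (P : ∀ u : TotalSpace F V, V' u.proj) (u : TotalSpace F V) :
    ∀ᶠ z : TotalSpace F V in 𝓝 u,
      P z = ∑ i, alongCoeff F' P u.proj i z • frameAt F' V' u.proj i z.proj := by
  filter_upwards [eventually_proj_mem (V' := V') (F' := F') u] with z hz
  exact eq_sum_frame' hz (P z)

theorem HolAlong.alongCoeff {P : ∀ u : TotalSpace F V, V' u.proj} {u : TotalSpace F V}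
    (hP : HolAlong I F' P u) (i : Fin (Module.finrank ℂ F')) :
    ContMDiffAt (I.prod 𝓘(ℂ, F)) 𝓘(ℂ, ℂ) ω (TTGeometry.alongCoeff F' P u.proj i) u :=
  ((((Module.finBasis ℂ F').coord i).toContinuousLinearMap).contMDiff.contMDiffAt).comp u hP

theorem HolAlong.congr {P Q : ∀ u : TotalSpace F V, V' u.proj} {u : TotalSpace F V}
    (hP : HolAlong I F' P u) (h : ∀ᶠ z in 𝓝 u, P z = Q z) : HolAlong I F' Q u :=
  ContMDiffAt.congr_of_eventuallyEq hP (h.mono fun z hz => by simp only [hz])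

theorem holAlong_pullback {s : ∀ x, V' x} {u : TotalSpace F V} (hs : HolAt I F' s u.proj) :
    HolAlong I F' (fun z : TotalSpace F V => s z.proj) u :=
  ContMDiffAt.comp (g := sectionCoord F' s u.proj) (f := π F V) u hs.sectionCoord
    contMDiff_projection.contMDiffAt

theorem HolAlong.sum {ι : Type*} {t : Finset ι} {c : ι → TotalSpace F V → ℂ}
    {s : ι → ∀ x, V' x} {u : TotalSpace F V}
    (hc : ∀ i ∈ t, ContMDiffAt (I.prod 𝓘(ℂ, F)) 𝓘(ℂ, ℂ) ω (c i) u)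
    (hs : ∀ i ∈ t, HolAt I F' (s i) u.proj) :
    HolAlong I F' (fun z => ∑ i ∈ t, c i z • s i z.proj) u := by
  have h : ContMDiffAt (I.prod 𝓘(ℂ, F)) 𝓘(ℂ, F') ω (fun z : TotalSpace F V =>
      ∑ i ∈ t, c i z • fibreCoord u.proj (TotalSpace.mk' F' z.proj (s i z.proj))) u :=
    contMDiffAt_finsetSum fun i hi => (hc i hi).smul (holAlong_pullback (hs i hi))
  refine h.congr_of_eventuallyEq ?_
  filter_upwards [eventually_proj_mem (V' := V') (F' := F') u] with z hz
  simp only [fibreCoord_sum hz, fibreCoord_smul hz]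

/-- Holomorphic bundle maps along the projection preserve holomorphy. -/
theorem HolAlong.map {E₂ : Type*} [NormedAddCommGroup E₂] [NormedSpace ℂ E₂]
    {W : TotalSpace F V → Type*} [TopologicalSpace (TotalSpace E₂ W)]
    [∀ x, AddCommGroup (W x)] [∀ x, Module ℂ (W x)] [∀ x, TopologicalSpace (W x)]
    [FiberBundle E₂ W] [VectorBundle ℂ E₂ W]
    {L : ∀ u : TotalSpace F V, V' u.proj → W u}
    (hL : IsHolMorphism I F' (I.prod 𝓘(ℂ, F)) E₂ (π F V) L)
    {P : ∀ u : TotalSpace F V, V' u.proj} {u : TotalSpace F V} (hP : HolAlong I F' P u) :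
    HolAt (I.prod 𝓘(ℂ, F)) E₂ (fun z => L z (P z)) u := by
  have h : HolAt (I.prod 𝓘(ℂ, F)) E₂ (fun z => ∑ i, TTGeometry.alongCoeff F' P u.proj i z •
      L z (frameAt F' V' u.proj i z.proj)) u :=
    ContMDiffAt.sum_section fun i _ =>
      HolAt.smul (hP.alongCoeff i) (hL.hol u _ (holAt_frameAt u.proj i))
  refine h.congr ?_
  filter_upwards [eq_sum_alongCoeff (F' := F') P u] with z hz
  conv_rhs => rw [hz]
  exact (hL.map_sum_smul _ z _ _).symm

theorem HolAlong.map_base {α : ∀ x, V' x → V₂ x}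
    (hadd : ∀ x a b, α x (a + b) = α x a + α x b)
    (hsmul : ∀ x (r : ℂ) a, α x (r • a) = r • α x a)
    (hα : ∀ (s : ∀ x, V' x) (x : M), HolAt I F' s x → HolAt I F₂ (fun x => α x (s x)) x)
    {P : ∀ u : TotalSpace F V, V' u.proj} {u : TotalSpace F V} (hP : HolAlong I F' P u) :
    HolAlong I F₂ (fun z => α z.proj (P z)) u := by
  refine HolAlong.congr (HolAlong.sum (t := Finset.univ) (fun i _ => hP.alongCoeff i)
    (fun i _ => hα _ _ (holAt_frameAt u.proj i))) ?_
  filter_upwards [eq_sum_alongCoeff (F' := F') P u] with z hz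
  conv_rhs => rw [hz]
  let l : V' z.proj →ₗ[ℂ] V₂ z.proj := ⟨⟨α z.proj, hadd _⟩, hsmul _⟩
  change ∑ i, _ • l _ = l _
  simp

/-- In a frame pulled back from `M` the function is a polynomial in the coefficients of `P` and `Q`
and in the entries of the Gram matrix, which are pulled back holomorphic functions. -/
theorem HolAlong.metric {g : ∀ x, V' x → V' x → ℂ} (hg : IsHolMetric I F' g)
    {P Q : ∀ u : TotalSpace F V, V' u.proj} {u : TotalSpace F V} (hP : HolAlong I F' P u)
    (hQ : HolAlong I F' Q u) :
    ContMDiffAt (I.prod 𝓘(ℂ, F)) 𝓘(ℂ, ℂ) ω (fun z => g z.proj (P z) (Q z)) u := by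
  have h : ContMDiffAt (I.prod 𝓘(ℂ, F)) 𝓘(ℂ, ℂ) ω (fun z : TotalSpace F V => ∑ i, ∑ j,
      TTGeometry.alongCoeff F' P u.proj i z • TTGeometry.alongCoeff F' Q u.proj j z •
      g z.proj (frameAt F' V' u.proj j z.proj) (frameAt F' V' u.proj i z.proj)) u := by
    refine contMDiffAt_finsetSum fun i _ => contMDiffAt_finsetSum fun j _ =>
      (hP.alongCoeff i).smul ((hQ.alongCoeff j).smul ?_)
    exact (hg.holAt (holAt_frameAt u.proj j) (holAt_frameAt u.proj i)).comp u
      contMDiff_projection.contMDiffAt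
  refine h.congr_of_eventuallyEq ?_
  filter_upwards [eq_sum_alongCoeff (F' := F') P u, eq_sum_alongCoeff (F' := F') Q u] with z hz hz'
  conv_lhs => rw [hz, hg.map_sum_smul]
  refine Finset.sum_congr rfl fun i _ => ?_
  conv_lhs => rw [hg.symm, hz', hg.map_sum_smul, Finset.mul_sum]
  rfl

end HolAlong

/-! ### Holomorphy of lifts and of the components of a vector field -/

section Lifts

variable {E : Type*} [NormedAddCommGroup E] [NormedSpace ℂ E] [FiniteDimensional ℂ E]
  {H : Type*} [TopologicalSpace H] {I : ModelWithCorners ℂ E H} [I.Boundaryless]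
  {M : Type*} [TopologicalSpace M] [ChartedSpace H M] [IsManifold I ω M]
  {F : Type*} [NormedAddCommGroup F] [NormedSpace ℂ F] [FiniteDimensional ℂ F]
  {V : M → Type*} [TopologicalSpace (TotalSpace F V)]
  [∀ x, AddCommGroup (V x)] [∀ x, Module ℂ (V x)] [∀ x, TopologicalSpace (V x)]
  [∀ x, IsTopologicalAddGroup (V x)] [∀ x, ContinuousSMul ℂ (V x)]
  [FiberBundle F V] [VectorBundle ℂ F V] [ContMDiffVectorBundle ω F V I]
  {D : CovariantDerivative I F V}

theorem eventually_proj_mem_chart {x : M} {u : TotalSpace F V}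
    (h1 : u.proj ∈ (chartAt H x).source) (h2 : u.proj ∈ (trivializationAt F V x).baseSet) :
    ∀ᶠ z : TotalSpace F V in 𝓝 u,
      z.proj ∈ (chartAt H x).source ∧ z.proj ∈ (trivializationAt F V x).baseSet :=
  (isOpen_preimage_proj (F := F) (V := V) ((chartAt H x).open_source.inter
    (trivializationAt F V x).open_baseSet)).mem_nhds ⟨h1, h2⟩

/-- Holomorphy of a vector field on the total space in terms of its components. -/
theorem holAt_total_iff (W : ∀ u : TotalSpace F V, TangentSpace (I.prod 𝓘(ℂ, F)) u)
    (u : TotalSpace F V) : HolAt (I.prod 𝓘(ℂ, F)) (E × F) W u ↔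
      HolAlong I E (V' := (TangentSpace I : M → Type _)) (fun z => horPart I z (W z)) u ∧
      ContMDiffAt (I.prod 𝓘(ℂ, F)) 𝓘(ℂ, F) ω
        (fun z => realDeriv (I.prod 𝓘(ℂ, F)) (fibreCoord u.proj) z (W z)) u := by
  have h1 : HolAt (I.prod 𝓘(ℂ, F)) (E × F) W u ↔
      ContMDiffAt (I.prod 𝓘(ℂ, F)) 𝓘(ℂ, E × F) ω (sectionCoord (E × F) W u) u :=
    contMDiffAt_section u
  have hev : sectionCoord (E × F) W u =ᶠ[𝓝 u] fun z =>
      (fibreCoord u.proj (TotalSpace.mk' E z.proj (horPart I z (W z))),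
        realDeriv (I.prod 𝓘(ℂ, F)) (fibreCoord u.proj) z (W z)) := by
    filter_upwards [eventually_proj_mem_chart (mem_chart_source H u.proj)
      (mem_baseSet_trivializationAt' (F := F) (E := V) u.proj)] with z hz
    rw [sectionCoord_total W hz.1 hz.2]
    refine Prod.ext ?_ rfl
    let X : ∀ y : M, TangentSpace I y := 
      extend E (E := (TangentSpace I : M → Type _)) (horPart I z (W z))
    have hX : X z.proj = horPart I z (W z) := extend_apply_self (F := E)
      (E := (TangentSpace I : M → Type _)) _
    have := sectionCoord_tangent X hz.1
    rw [hX] at this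
    rw [← this, sectionCoord, hX]
    rfl
  rw [h1, hev.contMDiffAt_iff, contMDiffAt_prod_module_iff]
  rfl

/-- The lift has no horizontal component, and its fibre component is the coordinate of the section
pulled back from `M`. -/
theorem isHolMorphism_vertLift :
    IsHolMorphism I F (I.prod 𝓘(ℂ, F)) (E × F) (π F V)
      (fun u : TotalSpace F V => (vertLift I u : V u.proj → _)) where
  add u a b := vertLift_add u a b
  smul u r a := vertLift_smul u r a
  hol_base := contMDiff_projection
  hol u s hs := by
    rw [holAt_total_iff]
    constructor
    · refine HolAlong.congr (holAlong_pullback (HolAt.zero u.proj)) (.of_forall fun z => ?_)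
      exact (horPart_vertLift z _).symm
    · refine (holAlong_pullback (F := F) (V := V) hs).congr_of_eventuallyEq ?_
      filter_upwards [eventually_proj_mem (V' := V) (F' := F) u] with z hz
      exact realDeriv_vertLift hz _

/-- The fibre component of the lift is minus the connection form applied to the fibre coordinate: it
is linear in that coordinate, with coefficients the coordinates of `D_X e_i`, which are holomorphic
because `D` is. -/
theorem isHolMorphism_horLift (hD : IsHolConnection D) :
    IsHolMorphism I E (V := (TangentSpace I : M → Type _)) (I.prod 𝓘(ℂ, F)) (E × F) (π F V)
      (fun u : TotalSpace F V => (horLift D u : TangentSpace I u.proj → _)) where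
  add u a b := horLift_add D u a b
  smul u r a := horLift_smul D u r a
  hol_base := contMDiff_projection
  hol u X hX := by
    rw [holAt_total_iff]
    constructor
    · refine HolAlong.congr (holAlong_pullback hX) (.of_forall fun z => ?_)
      exact (horPart_horLift D z _).symm
    · have hu := mem_baseSet_trivializationAt' (F := F) (E := V) u.proj
      have hsum : ContMDiffAt (I.prod 𝓘(ℂ, F)) 𝓘(ℂ, F) ω (fun z : TotalSpace F V => ∑ i,
          (Module.finBasis ℂ F).repr (fibreCoord u.proj z) i •
          fibreCoord u.proj (TotalSpace.mk' F z.proj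
            (D (frameAt F V u.proj i) z.proj (X z.proj)))) u :=
        contMDiffAt_finsetSum fun i _ => ContMDiffAt.smul
          ((((Module.finBasis ℂ F).coord i).toContinuousLinearMap.contMDiff.contMDiffAt).comp u
            (contMDiffAt_fibreCoord hu))
          (holAlong_pullback (hD.holAt (holAt_frameAt u.proj i) hX))
      refine hsum.neg.congr_of_eventuallyEq ?_
      filter_upwards [eventually_proj_mem (V' := V) (F' := F) u] with z hz
      exact realDeriv_horLift D hz _

theorem holAlong_horPart {W : ∀ u : TotalSpace F V, TangentSpace (I.prod 𝓘(ℂ, F)) u}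
    {u : TotalSpace F V} (hW : HolAt (I.prod 𝓘(ℂ, F)) (E × F) W u) :
    HolAlong I E (V' := (TangentSpace I : M → Type _)) (fun z => horPart I z (W z)) u :=
  ((holAt_total_iff W u).1 hW).1

/-- Subtracting the lift of the horizontal part leaves a holomorphic vertical field, whose fibre
coordinate is that of the vertical part. -/
theorem holAlong_vertPart (hD : IsHolConnection D)
    {W : ∀ u : TotalSpace F V, TangentSpace (I.prod 𝓘(ℂ, F)) u}
    {u : TotalSpace F V} (hW : HolAt (I.prod 𝓘(ℂ, F)) (E × F) W u) :
    HolAlong I F (fun z => vertPart D z (W z)) u := by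
  have h1 := (holAlong_horPart hW).map (isHolMorphism_horLift hD)
  have h2 := ((holAt_total_iff _ u).1 (hW.sub h1)).2
  refine h2.congr_of_eventuallyEq ?_
  filter_upwards [eventually_proj_mem (V' := V) (F' := F) u] with z hz
  have : W z - horLift D z (horPart I z (W z)) = vertLift I z (vertPart D z (W z)) := by
    rw [sub_eq_iff_eq_add']
    exact (horLift_add_vertLift D z (W z)).symm
  rw [this, realDeriv_vertLift hz]

end Lifts

/-! ### Brackets of horizontal and vertical lifts -/

section Brackets

variable {E : Type*} [NormedAddCommGroup E] [NormedSpace ℂ E] [FiniteDimensional ℂ E]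
  {H : Type*} [TopologicalSpace H] {I : ModelWithCorners ℂ E H} [I.Boundaryless]
  {M : Type*} [TopologicalSpace M] [ChartedSpace H M] [IsManifold I ω M]
  {F : Type*} [NormedAddCommGroup F] [NormedSpace ℂ F] [FiniteDimensional ℂ F]
  {V : M → Type*} [TopologicalSpace (TotalSpace F V)]
  [∀ x, AddCommGroup (V x)] [∀ x, Module ℂ (V x)] [∀ x, TopologicalSpace (V x)]
  [∀ x, IsTopologicalAddGroup (V x)] [∀ x, ContinuousSMul ℂ (V x)]
  [FiberBundle F V] [VectorBundle ℂ F V] [ContMDiffVectorBundle ω F V I]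
  {D : CovariantDerivative I F V}

theorem HolAt.horLift (hD : IsHolConnection D) {X : ∀ x : M, TangentSpace I x} {u : TotalSpace F V}
    (hX : HolAt I E X u.proj) :
    HolAt (I.prod 𝓘(ℂ, F)) (E × F) (fun z : TotalSpace F V => TTGeometry.horLift D z (X z.proj)) u :=
  (isHolMorphism_horLift hD).hol u X hX

theorem HolAt.vertLift {s : ∀ x, V x} {u : TotalSpace F V} (hs : HolAt I F s u.proj) :
    HolAt (I.prod 𝓘(ℂ, F)) (E × F) (fun z : TotalSpace F V => TTGeometry.vertLift I z (s z.proj)) u :=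
  isHolMorphism_vertLift.hol u s hs

/-- The bracket of projectable vector fields on the total space. -/
theorem bracket_total {x : M} {u : TotalSpace F V} (h1 : u.proj ∈ (chartAt H x).source)
    (h2 : u.proj ∈ (trivializationAt F V x).baseSet)
    {W₁ W₂ : ∀ u : TotalSpace F V, TangentSpace (I.prod 𝓘(ℂ, F)) u}
    {X₁ X₂ : ∀ x : M, TangentSpace I x}
    (hW₁ : HolAt (I.prod 𝓘(ℂ, F)) (E × F) W₁ u) (hW₂ : HolAt (I.prod 𝓘(ℂ, F)) (E × F) W₂ u)
    (hX₁ : HolAt I E X₁ u.proj) (hX₂ : HolAt I E X₂ u.proj)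
    (hp₁ : ∀ z, horPart I z (W₁ z) = X₁ z.proj) (hp₂ : ∀ z, horPart I z (W₂ z) = X₂ z.proj) :
    horPart I u (VectorField.mlieBracket (I.prod 𝓘(ℂ, F)) W₁ W₂ u)
        = VectorField.mlieBracket I X₁ X₂ u.proj ∧
    realDeriv (I.prod 𝓘(ℂ, F)) (fibreCoord x) u
        (VectorField.mlieBracket (I.prod 𝓘(ℂ, F)) W₁ W₂ u)
      = realDeriv (I.prod 𝓘(ℂ, F))
          (fun z => realDeriv (I.prod 𝓘(ℂ, F)) (fibreCoord x) z (W₂ z)) u (W₁ u)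
        - realDeriv (I.prod 𝓘(ℂ, F))
          (fun z => realDeriv (I.prod 𝓘(ℂ, F)) (fibreCoord x) z (W₁ z)) u (W₂ u) := by
  have : CompleteSpace E := FiniteDimensional.complete ℂ E
  have : CompleteSpace F := FiniteDimensional.complete ℂ F
  -- The zero vector only names a chart: the charts of the total space depend on the base point
  -- alone.
  let v : TotalSpace F V := TotalSpace.mk' F x 0
  have hu := mem_chartAt_source_total (v := v) h1 h2
  have hb := sectionCoord_mlieBracket (I := I.prod 𝓘(ℂ, F)) hu hW₁ hW₂
  rw [sectionCoord_total (v := v) _ h1 h2] at hb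
  have hev : ∀ {W : ∀ u : TotalSpace F V, TangentSpace (I.prod 𝓘(ℂ, F)) u}
      {X : ∀ x : M, TangentSpace I x}, (∀ z, horPart I z (W z) = X z.proj) →
      sectionCoord (E × F) W v =ᶠ[𝓝 u] fun z => (sectionCoord E X x z.proj,
        realDeriv (I.prod 𝓘(ℂ, F)) (fibreCoord x) z (W z)) := by
    intro W X hp
    filter_upwards [eventually_proj_mem_chart h1 h2] with z hz
    rw [sectionCoord_total (v := v) W hz.1 hz.2, sectionCoord_tangent X hz.1, hp]
  have hd : ∀ {W : ∀ u : TotalSpace F V, TangentSpace (I.prod 𝓘(ℂ, F)) u},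
      HolAt (I.prod 𝓘(ℂ, F)) (E × F) W u →
      RealDiffAt (I.prod 𝓘(ℂ, F)) (sectionCoord (E × F) W v) u := fun hW =>
    (SmoothFunAt.of_hol (sectionCoord_holAt (by simpa using hu) hW)).realDiffAt
  have hfst : ∀ {W : ∀ u : TotalSpace F V, TangentSpace (I.prod 𝓘(ℂ, F)) u}
      {X : ∀ x : M, TangentSpace I x}, HolAt (I.prod 𝓘(ℂ, F)) (E × F) W u → HolAt I E X u.proj →
      (∀ z, horPart I z (W z) = X z.proj) → ∀ W' : TangentSpace (I.prod 𝓘(ℂ, F)) u,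
      (realDeriv (I.prod 𝓘(ℂ, F)) (sectionCoord (E × F) W v) u W').1
        = realDeriv I (sectionCoord E X x) u.proj (horPart I u W') := by
    intro W X hW hX hp W'
    refine (realDeriv_clm (hd hW) (ContinuousLinearMap.fst ℝ E F) W').symm.trans ?_
    rw [realDeriv_congr (g := fun z => sectionCoord E X x z.proj)
      ((hev hp).mono fun z hz => by rw [hz]; rfl)]
    exact realDeriv_comp (φ := π F V)
      (SmoothFunAt.of_hol (sectionCoord_holAt (by simpa using h1) hX)).realDiffAt
      (contMDiff_projection.mdifferentiable (by simp) u) W'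
  have hsnd : ∀ {W : ∀ u : TotalSpace F V, TangentSpace (I.prod 𝓘(ℂ, F)) u}
      {X : ∀ x : M, TangentSpace I x}, HolAt (I.prod 𝓘(ℂ, F)) (E × F) W u →
      (∀ z, horPart I z (W z) = X z.proj) → ∀ W' : TangentSpace (I.prod 𝓘(ℂ, F)) u,
      (realDeriv (I.prod 𝓘(ℂ, F)) (sectionCoord (E × F) W v) u W').2
        = realDeriv (I.prod 𝓘(ℂ, F))
          (fun z => realDeriv (I.prod 𝓘(ℂ, F)) (fibreCoord x) z (W z)) u W' := by
    intro W X hW hp W'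
    refine (realDeriv_clm (hd hW) (ContinuousLinearMap.snd ℝ E F) W').symm.trans ?_
    exact realDeriv_congr ((hev hp).mono fun z hz => by rw [hz]; rfl) _
  constructor
  · have h := congrArg Prod.fst hb
    rw [Prod.fst_sub, hfst hW₂ hX₂ hp₂, hfst hW₁ hX₁ hp₁, hp₁, hp₂,
      ← sectionCoord_mlieBracket h1 hX₁ hX₂, sectionCoord_tangent _ h1] at h
    exact (isInvertible_mfderiv_extChartAt h1).injective h
  · have h := congrArg Prod.snd hb
    rw [Prod.snd_sub, hsnd hW₂ hp₂, hsnd hW₁ hp₁] at h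
    exact h

/-- The curvature of a connection. -/
def connCurvature (D : CovariantDerivative I F V) (X Y : ∀ x : M, TangentSpace I x)
    (s : ∀ x, V x) (x : M) : V x :=
  D (fun y => D s y (Y y)) x (X x) - D (fun y => D s y (X y)) x (Y x)
    - D s x (VectorField.mlieBracket I X Y x)

/-- The Leibniz rule for minus the connection form applied to the fibre coordinate. Differentiating
the coordinate gives the first term. Differentiating the coordinates of `D_Y e_i` gives the rest,
the ordinary derivative being rewritten as `D` minus the connection form. -/
theorem realDeriv_realDeriv_horLift (hD : IsHolConnection D) {x : M} {u : TotalSpace F V}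
    (h2 : u.proj ∈ (trivializationAt F V x).baseSet)
    {Y : ∀ x : M, TangentSpace I x} (hY : HolAt I E Y u.proj)
    (W : TangentSpace (I.prod 𝓘(ℂ, F)) u) :
    realDeriv (I.prod 𝓘(ℂ, F)) (fun z => realDeriv (I.prod 𝓘(ℂ, F)) (fibreCoord x) z
        (horLift D z (Y z.proj))) u W
      = - (connForm D x u.proj (Y u.proj) (realDeriv (I.prod 𝓘(ℂ, F)) (fibreCoord x) u W)
        + ∑ i, (Module.finBasis ℂ F).repr (fibreCoord x u) i •
          (fibreCoord x (TotalSpace.mk' F u.proj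
            (D (fun y => D (frameAt F V x i) y (Y y)) u.proj (horPart I u W)))
          - connForm D x u.proj (horPart I u W)
            (connForm D x u.proj (Y u.proj) (Module.finBasis ℂ F i)))) := by
  set b := Module.finBasis ℂ F
  have hfr := fun i => hD.holAt (holAt_frameAt' h2 i) hY
  have hc : ContMDiffAt (I.prod 𝓘(ℂ, F)) 𝓘(ℂ, F) ω (fibreCoord (F := F) (V := V) x) u :=
    contMDiffAt_fibreCoord h2
  have hci : ∀ i, ContMDiffAt (I.prod 𝓘(ℂ, F)) 𝓘(ℂ, ℂ) ω
      (fun z : TotalSpace F V => b.repr (fibreCoord x z) i) u := fun i =>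
    ((b.coord i).toContinuousLinearMap.contMDiff.contMDiffAt).comp u hc
  have hs := fun i => (SmoothFunAt.of_hol (sectionCoord_holAt h2 (hfr i))).realDiffAt
  have hev : (fun z : TotalSpace F V => realDeriv (I.prod 𝓘(ℂ, F)) (fibreCoord x) z
        (horLift D z (Y z.proj))) =ᶠ[𝓝 u] fun z => ∑ i, (b.repr (fibreCoord x z) i) •
        ((-1 : ℂ) • sectionCoord F (fun y => D (frameAt F V x i) y (Y y)) x z.proj) := by
    filter_upwards [(isOpen_preimage_proj (trivializationAt F V x).open_baseSet).mem_nhds h2]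
      with z hz
    rw [realDeriv_horLift D hz, connForm, ← Finset.sum_neg_distrib]
    refine Finset.sum_congr rfl fun i _ => ?_
    rw [neg_one_smul, smul_neg]
    rfl
  have hπ : MDifferentiableAt (I.prod 𝓘(ℂ, F)) I (π F V) u :=
    contMDiff_projection.mdifferentiable (by simp) u
  have hs' : ∀ i, RealDiffAt (I.prod 𝓘(ℂ, F)) (fun z : TotalSpace F V => 
      sectionCoord F (fun y => D (frameAt F V x i) y (Y y)) x z.proj) u := fun i =>
    RealDiffAt.comp (φ := π F V) (hs i) hπ
  have hcr := fun i => (SmoothFunAt.of_hol (hci i)).realDiffAt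
  have hd1 : ∀ i, realDeriv (I.prod 𝓘(ℂ, F)) (fun z : TotalSpace F V => b.repr (fibreCoord x z) i)
      u W = b.repr (realDeriv (I.prod 𝓘(ℂ, F)) (fibreCoord x) u W) i := fun i => by
    rw [(realDeriv_of_hol ((hci i).mdifferentiableAt (by simp)) W).2]
    exact mvfderiv_clm hc (b.coord i).toContinuousLinearMap W
  have hd2 : ∀ i, realDeriv (I.prod 𝓘(ℂ, F)) (fun z : TotalSpace F V => 
      sectionCoord F (fun y => D (frameAt F V x i) y (Y y)) x z.proj) u W
      = realDeriv I (sectionCoord F (fun y => D (frameAt F V x i) y (Y y)) x) u.proj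
        (horPart I u W) := fun i => realDeriv_comp (φ := π F V) (hs i) hπ W
  have hconst : RealDiffAt (I.prod 𝓘(ℂ, F)) (fun _ : TotalSpace F V => (-1 : ℂ)) u :=
    (SmoothFunAt.const _ _).realDiffAt
  have hd3 : ∀ i, realDeriv (I.prod 𝓘(ℂ, F)) (fun z : TotalSpace F V => (-1 : ℂ) • 
      sectionCoord F (fun y => D (frameAt F V x i) y (Y y)) x z.proj) u W
      = - realDeriv I (sectionCoord F (fun y => D (frameAt F V x i) y (Y y)) x) u.proj
        (horPart I u W) := fun i => by
    rw [realDeriv_smul hconst (hs' i), realDeriv_const, hd2, zero_smul, add_zero, neg_one_smul]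
  have hterm : ∀ i, realDeriv (I.prod 𝓘(ℂ, F)) (fun z : TotalSpace F V =>
      (b.repr (fibreCoord x z) i) •
        ((-1 : ℂ) • sectionCoord F (fun y => D (frameAt F V x i) y (Y y)) x z.proj)) u W
      = - (b.repr (realDeriv (I.prod 𝓘(ℂ, F)) (fibreCoord x) u W) i •
          connForm D x u.proj (Y u.proj) (b i)
        + b.repr (fibreCoord x u) i • (fibreCoord x (TotalSpace.mk' F u.proj
            (D (fun y => D (frameAt F V x i) y (Y y)) u.proj (horPart I u W)))
          - connForm D x u.proj (horPart I u W) (connForm D x u.proj (Y u.proj) (b i)))) := by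
    intro i
    rw [realDeriv_smul (hcr i) (hconst.smul (hs' i)) W, hd1, hd3, fibreCoord_conn D h2 (hfr i),
      connForm_basis, neg_one_smul, smul_neg, smul_neg, neg_add, add_comm]
    congr 3
    exact (add_sub_cancel_right _ _).symm
  rw [realDeriv_congr hev, realDeriv_sum fun i _ => (hcr i).smul (hconst.smul (hs' i)),
    Finset.sum_congr rfl fun i _ => hterm i, Finset.sum_neg_distrib, Finset.sum_add_distrib]
  refine congrArg (fun a => -(a + _)) (Finset.sum_congr rfl fun i _ => ?_)
  rw [connForm_basis]

theorem connForm_sum {ι : Type*} (t : Finset ι) (x y : M) (X : TangentSpace I y) (c : ι → ℂ)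
    (a : ι → F) : connForm D x y X (∑ i ∈ t, c i • a i) = ∑ i ∈ t, c i • connForm D x y X (a i) := by
  let l : F →ₗ[ℂ] F := ⟨⟨connForm D x y X, connForm_add_right D x y X⟩,
    connForm_smul_right D x y X⟩
  change l _ = ∑ i ∈ t, c i • l (a i)
  simp

/-- The vertical part of the bracket of horizontal lifts is the curvature. -/
theorem bracket_horLift_horLift (hD : IsHolConnection D) {x : M} {u : TotalSpace F V}
    (h1 : u.proj ∈ (chartAt H x).source) (h2 : u.proj ∈ (trivializationAt F V x).baseSet)
    {X Y : ∀ x : M, TangentSpace I x} (hX : HolAt I E X u.proj) (hY : HolAt I E Y u.proj) :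
    horPart I u (VectorField.mlieBracket (I.prod 𝓘(ℂ, F)) (fun z : TotalSpace F V =>
      horLift D z (X z.proj)) (fun z => horLift D z (Y z.proj)) u)
      = VectorField.mlieBracket I X Y u.proj ∧
    fibreCoord x (TotalSpace.mk' F u.proj (vertPart D u (VectorField.mlieBracket (I.prod 𝓘(ℂ, F))
      (fun z : TotalSpace F V => horLift D z (X z.proj)) (fun z => horLift D z (Y z.proj)) u)))
      = - ∑ i, (Module.finBasis ℂ F).repr (fibreCoord x u) i •
        fibreCoord x (TotalSpace.mk' F u.proj (connCurvature D X Y (frameAt F V x i) u.proj)) := by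
  have hb := bracket_total h1 h2 (HolAt.horLift hD hX) (HolAt.horLift hD hY) hX hY
    (fun z => horPart_horLift D z _) fun z => horPart_horLift D z _
  refine ⟨hb.1, ?_⟩
  rw [fibreCoord_vertPart D h2, hb.1, hb.2, realDeriv_realDeriv_horLift hD h2 hX,
    realDeriv_realDeriv_horLift hD h2 hY, realDeriv_horLift D h2, realDeriv_horLift D h2,
    horPart_horLift, horPart_horLift]
  have hneg : ∀ a, connForm D x u.proj (X u.proj) (-a) = - connForm D x u.proj (X u.proj) a :=
    fun a => by simpa using connForm_smul_right D x u.proj (X u.proj) (-1) a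
  have hneg' : ∀ a, connForm D x u.proj (Y u.proj) (-a) = - connForm D x u.proj (Y u.proj) a :=
    fun a => by simpa using connForm_smul_right D x u.proj (Y u.proj) (-1) a
  have hsub : ∀ a b : V u.proj, fibreCoord x (TotalSpace.mk' F u.proj (a - b))
      = fibreCoord x (TotalSpace.mk' F u.proj a) - fibreCoord x (TotalSpace.mk' F u.proj b) :=
    fun a b => by
      have := fibreCoord_add h2 (a - b) b
      rw [sub_add_cancel] at this
      exact eq_sub_of_add_eq this.symm
  -- The terms quadratic in the connection form are symmetric in `X` and `Y`, so they cancel in the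
  -- difference; what remains is the curvature.
  rw [hneg, hneg']
  simp only [connCurvature, hsub, smul_sub, Finset.sum_sub_distrib, ← connForm_sum,
    (Module.finBasis ℂ F).sum_repr]
  have h3 : ∑ i, (Module.finBasis ℂ F).repr (fibreCoord x u) i • fibreCoord x
      (TotalSpace.mk' F u.proj (D (frameAt F V x i) u.proj (VectorField.mlieBracket I X Y u.proj)))
      = connForm D x u.proj (VectorField.mlieBracket I X Y u.proj) (fibreCoord x u) := rfl
  rw [h3]
  abel

theorem realDeriv_realDeriv_vertLift {x : M} {u : TotalSpace F V}
    (h2 : u.proj ∈ (trivializationAt F V x).baseSet)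
    {s : ∀ x, V x} (hs : HolAt I F s u.proj) (W : TangentSpace (I.prod 𝓘(ℂ, F)) u) :
    realDeriv (I.prod 𝓘(ℂ, F)) (fun z => realDeriv (I.prod 𝓘(ℂ, F)) (fibreCoord x) z
        (vertLift I z (s z.proj))) u W
      = realDeriv I (sectionCoord F s x) u.proj (horPart I u W) := by
  have hev : (fun z : TotalSpace F V => realDeriv (I.prod 𝓘(ℂ, F)) (fibreCoord x) z
        (vertLift I z (s z.proj))) =ᶠ[𝓝 u] fun z => sectionCoord F s x z.proj := by
    filter_upwards [(isOpen_preimage_proj (trivializationAt F V x).open_baseSet).mem_nhds h2]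
      with z hz
    exact realDeriv_vertLift hz _
  rw [realDeriv_congr hev]
  exact realDeriv_comp (φ := π F V) (SmoothFunAt.of_hol (sectionCoord_holAt h2 hs)).realDiffAt
    (contMDiff_projection.mdifferentiable (by simp) u) W

/-- In the fibre direction the horizontal lift is minus the connection form applied to the
coordinate, and the vertical lift is constant along the fibres. The bracket is the derivative of `s`
plus the connection form applied to `s`. -/
theorem bracket_horLift_vertLift (hD : IsHolConnection D) {u : TotalSpace F V}
    {X : ∀ x : M, TangentSpace I x} {s : ∀ x, V x} (hX : HolAt I E X u.proj)
    (hs : HolAt I F s u.proj) :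
    VectorField.mlieBracket (I.prod 𝓘(ℂ, F)) (fun z : TotalSpace F V =>
      horLift D z (X z.proj)) (fun z => vertLift I z (s z.proj)) u
      = vertLift I u (D s u.proj (X u.proj)) := by
  have h2 := mem_baseSet_trivializationAt' (F := F) (E := V) u.proj
  have hb := bracket_total (mem_chart_source H u.proj) h2 (HolAt.horLift hD hX)
    (HolAt.vertLift hs) hX (HolAt.zero u.proj)
    (fun z => horPart_horLift D z _) fun z => horPart_vertLift z _
  refine tangent_total_ext ?_ ?_
  · rw [hb.1, show VectorField.mlieBracket I X (fun _ => 0) u.proj = 0 from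
      congrFun VectorField.mlieBracket_zero_right _, horPart_vertLift]
  · rw [hb.2, realDeriv_realDeriv_vertLift h2 hs, realDeriv_realDeriv_horLift hD h2 hX,
      realDeriv_vertLift h2, horPart_vertLift, horPart_horLift, realDeriv_vertLift h2,
      fibreCoord_conn D h2 hs]
    have h0 : fibreCoord u.proj (TotalSpace.mk' F u.proj (0 : V u.proj)) = 0 := by
      simpa using fibreCoord_smul h2 0 (0 : V u.proj)
    have hz : ∀ a : F, connForm D u.proj u.proj 0 a = 0 := fun a => by simp [connForm, h0]
    simp only [map_zero, h0, hz, sub_zero, smul_zero, Finset.sum_const_zero, add_zero,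
      sub_neg_eq_add]
    rfl

theorem bracket_vertLift_vertLift {u : TotalSpace F V}
    {s t : ∀ x, V x} (hs : HolAt I F s u.proj) (ht : HolAt I F t u.proj) :
    VectorField.mlieBracket (I.prod 𝓘(ℂ, F)) (fun z : TotalSpace F V =>
      vertLift I z (s z.proj)) (fun z => vertLift I z (t z.proj)) u = 0 := by
  have h2 := mem_baseSet_trivializationAt' (F := F) (E := V) u.proj
  have hb := bracket_total (mem_chart_source H u.proj) h2 (HolAt.vertLift hs)
    (HolAt.vertLift ht) (HolAt.zero u.proj) (HolAt.zero u.proj)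
    (fun z => horPart_vertLift z _) fun z => horPart_vertLift z _
  have h0 : ∀ {s : ∀ x, V x}, HolAt I F s u.proj →
      realDeriv I (sectionCoord F s u.proj) u.proj 0 = 0 := fun {s} hs => by
    rw [(realDeriv_of_hol (hs.sectionCoord.mdifferentiableAt (by simp)) 0).2, map_zero]
  refine tangent_total_ext ?_ ?_
  · rw [hb.1, show VectorField.mlieBracket I (fun _ => 0) (fun _ => 0) u.proj = 0 from
      congrFun VectorField.mlieBracket_zero_right _, horPart, map_zero]
  · rw [hb.2, realDeriv_realDeriv_vertLift h2 hs, realDeriv_realDeriv_vertLift h2 ht,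
      horPart_vertLift, horPart_vertLift, h0 hs, h0 ht, sub_zero,
      (realDeriv_of_hol ((contMDiffAt_fibreCoord h2).mdifferentiableAt (by simp)) 0).2, map_zero]

end Brackets

/-! ### Metric, real structure and multiplication on the total space -/

section TotalStructures

variable {E : Type*} [NormedAddCommGroup E] [NormedSpace ℂ E] [FiniteDimensional ℂ E]
  {H : Type*} [TopologicalSpace H] {I : ModelWithCorners ℂ E H} [I.Boundaryless]
  {M : Type*} [TopologicalSpace M] [ChartedSpace H M] [IsManifold I ω M]
  {F : Type*} [NormedAddCommGroup F] [NormedSpace ℂ F] [FiniteDimensional ℂ F]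
  {V : M → Type*} [TopologicalSpace (TotalSpace F V)]
  [∀ x, AddCommGroup (V x)] [∀ x, Module ℂ (V x)] [∀ x, TopologicalSpace (V x)]
  [∀ x, IsTopologicalAddGroup (V x)] [∀ x, ContinuousSMul ℂ (V x)]
  [FiberBundle F V] [VectorBundle ℂ F V] [ContMDiffVectorBundle ω F V I]
  {D : CovariantDerivative I F V}
  {mulM : ∀ x : M, TangentSpace I x → TangentSpace I x → TangentSpace I x}
  {eM : ∀ x : M, TangentSpace I x}
  {gM : ∀ x : M, TangentSpace I x → TangentSpace I x → ℂ}
  {kM : ∀ x : M, TangentSpace I x → TangentSpace I x}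
  {mulV : ∀ x, V x → V x → V x} {eV : ∀ x, V x} {gV : ∀ x, V x → V x → ℂ}
  {kV : ∀ x, V x → V x} {α : ∀ x, V x → TangentSpace I x}

theorem IsAlgebraMorphism.holAt (hα : IsAlgebraMorphism I F mulM eM mulV eV α) {s : ∀ x, V x}
    {x : M} (hs : HolAt I F s x) : HolAt I E (fun x => α x (s x)) x := by
  obtain ⟨U, hU, hx, h⟩ := hs.exists_isHolSection
  exact (hα.hol U s hU h).holAt hU hx

theorem isHolMetric_totalMetric (hD : IsHolConnection D) (hgM : IsHolMetric I E gM)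
    (hgV : IsHolMetric I F gV) (hα : IsAlgebraMorphism I F mulM eM mulV eV α)
    (hg : ∀ (v : TotalSpace F V) (W : TangentSpace (I.prod 𝓘(ℂ, F)) v),
      (∀ W', totalMetric D gM gV α v W W' = 0) → W = 0) :
    IsHolMetric (I.prod 𝓘(ℂ, F)) (E × F) (totalMetric D gM gV α) := by
  have haM : ∀ x a b c, gM x a (b + c) = gM x a b + gM x a c := fun x a b c => by
    rw [hgM.symm, hgM.add_left, hgM.symm x b, hgM.symm x c]
  have hsM : ∀ x (r : ℂ) a b, gM x a (r • b) = r * gM x a b := fun x r a b => by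
    rw [hgM.symm, hgM.smul_left, hgM.symm]
  refine ⟨?_, ?_, ?_, hg, ?_⟩
  · intro u a b c
    simp only [totalMetric, horPart_add, vertPart_add, hα.add, hgM.add_left, hgV.add_left, haM]
    ring
  · intro u r a b
    simp only [totalMetric, horPart_smul, vertPart_smul, hα.smul, hgM.smul_left, hgV.smul_left, hsM]
    ring
  · intro u a b
    simp only [totalMetric]
    rw [hgM.symm u.proj (horPart I u a) (horPart I u b), hgV.symm]
    ring
  · intro U W W' hU hW hW' u hu
    have h1 := holAlong_horPart (hW.holAt hU hu)
    have h1' := holAlong_horPart (hW'.holAt hU hu)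
    have h2 := holAlong_vertPart hD (hW.holAt hU hu)
    have h2' := holAlong_vertPart hD (hW'.holAt hU hu)
    have h3 := h2.map_base hα.add hα.smul (fun s x hs => hα.holAt hs)
    have h3' := h2'.map_base hα.add hα.smul (fun s x hs => hα.holAt hs)
    exact (((HolAlong.metric hgM h1 h1').add (HolAlong.metric hgM h3 h1')).add
      (HolAlong.metric hgM h3' h1)).add (HolAlong.metric hgV h2 h2') |>.contMDiffWithinAt

theorem horPart_totalReal (u : TotalSpace F V) (W : TangentSpace (I.prod 𝓘(ℂ, F)) u) :
    horPart I u (totalReal D kM kV u W) = kM u.proj (horPart I u W) := by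
  rw [totalReal, horPart_add, horPart_horLift, horPart_vertLift, add_zero]

theorem vertPart_totalReal (u : TotalSpace F V) (W : TangentSpace (I.prod 𝓘(ℂ, F)) u) :
    vertPart D u (totalReal D kM kV u W) = kV u.proj (vertPart D u W) := by
  rw [totalReal, vertPart_add, vertPart_horLift, vertPart_vertLift, zero_add]

/-- Bundle maps along the projection preserve smoothness of antiholomorphic combinations. -/
theorem smoothAt_map_along {F' : Type*} [NormedAddCommGroup F'] [NormedSpace ℂ F']
    [FiniteDimensional ℂ F'] {V' : M → Type*} [TopologicalSpace (TotalSpace F' V')]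
    [∀ x, AddCommGroup (V' x)] [∀ x, Module ℂ (V' x)] [∀ x, TopologicalSpace (V' x)]
    [∀ x, IsTopologicalAddGroup (V' x)] [∀ x, ContinuousSMul ℂ (V' x)]
    [FiberBundle F' V'] [VectorBundle ℂ F' V'] [ContMDiffVectorBundle ω F' V' I]
    {g : ∀ x, V' x → V' x → ℂ} {k : ∀ x, V' x → V' x} (hk : IsCompatibleRealStructure I F' g k)
    {L : ∀ u : TotalSpace F V, V' u.proj → TangentSpace (I.prod 𝓘(ℂ, F)) u}
    (hL : IsHolMorphism I F' (I.prod 𝓘(ℂ, F)) (E × F) (π F V) L)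
    {P : ∀ u : TotalSpace F V, V' u.proj} {u : TotalSpace F V} (hP : HolAlong I F' P u) :
    SmoothSectionAt (I.prod 𝓘(ℂ, F)) (E × F) (fun z => L z (k z.proj (P z))) u := by
  refine SmoothSectionAt.congr (SmoothSectionAt.sum (t := Finset.univ)
    (e := fun i z => L z (k z.proj (frameAt F' V' u.proj i z.proj)))
    (fun i _ => (SmoothFunAt.of_hol (hP.alongCoeff i)).conj)
    fun i _ => hL.smooth (s := fun y => k y (frameAt F' V' u.proj i y))
      (hk.smoothAt (holAt_frameAt u.proj i))) ?_
  filter_upwards [eq_sum_alongCoeff (F' := F') P u] with z hz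
  conv_rhs => rw [hz, hk.map_sum_smul]
  exact (hL.map_sum_smul _ z _ _).symm

/-- Compatibility of the mixed terms `g_M (α v, X)` is where `α k_V = k_M α` is needed. Smoothness
follows from holomorphy of the lifts and of the components of a holomorphic field. -/
theorem isCompatibleRealStructure_totalReal (hD : IsHolConnection D)
    (hkM : IsCompatibleRealStructure I E gM kM) (hkV : IsCompatibleRealStructure I F gV kV)
    (hk : ∀ x a, α x (kV x a) = kM x (α x a)) :
    IsCompatibleRealStructure (I.prod 𝓘(ℂ, F)) (E × F) (totalMetric D gM gV α)
      (totalReal D kM kV) where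
  add u a b := by
    simp only [totalReal, horPart_add, vertPart_add, hkM.add, hkV.add, horLift_add, vertLift_add]
    exact add_add_add_comm _ _ _ _
  smul u r a := by
    simp only [totalReal, horPart_smul, vertPart_smul, hkM.smul, hkV.smul, horLift_smul,
      vertLift_smul]
    exact (smul_add _ _ _).symm
  involutive u a := by
    rw [totalReal, horPart_totalReal, vertPart_totalReal, hkM.involutive, hkV.involutive,
      horLift_add_vertLift]
  smooth U W hU hW u hu := by
    have h1 := smoothAt_map_along hkM (isHolMorphism_horLift hD)
      (holAlong_horPart (hW.holAt hU hu))
    have h2 := smoothAt_map_along hkV isHolMorphism_vertLift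
      (holAlong_vertPart hD (hW.holAt hU hu))
    exact h1.add h2
  compatible u a b := by
    simp only [totalMetric, horPart_totalReal, vertPart_totalReal, hk, hkM.compatible,
      hkV.compatible, map_add]

theorem totalReal_horLift (hkV : IsCompatibleRealStructure I F gV kV) (u : TotalSpace F V)
    (X : TangentSpace I u.proj) :
    totalReal D kM kV u (horLift D u X) = horLift D u (kM u.proj X) := by
  rw [totalReal, horPart_horLift, vertPart_horLift, hkV.map_zero]
  have h0 : vertLift I u (0 : V u.proj) = 0 := by simpa using vertLift_smul (I := I) u 0 0
  rw [h0, add_zero]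

theorem horLift_zero (u : TotalSpace F V) : horLift D u 0 = 0 := by
  simpa using horLift_smul D u 0 0

theorem vertLift_zero (u : TotalSpace F V) : vertLift I u (0 : V u.proj) = 0 := by
  simpa using vertLift_smul (I := I) u 0 0

theorem totalReal_vertLift (hkM : IsCompatibleRealStructure I E gM kM) (u : TotalSpace F V)
    (w : V u.proj) :
    totalReal D kM kV u (vertLift I u w) = vertLift I u (kV u.proj w) := by
  rw [totalReal, horPart_vertLift, vertPart_vertLift, hkM.map_zero, horLift_zero, zero_add]

section Multiplication

theorem IsHolMultiplication.mul_add {F' : Type*} [NormedAddCommGroup F'] [NormedSpace ℂ F']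
    {V' : M → Type*} [TopologicalSpace (TotalSpace F' V')]
    [∀ x, AddCommGroup (V' x)] [∀ x, Module ℂ (V' x)] [∀ x, TopologicalSpace (V' x)]
    [FiberBundle F' V'] {mul : ∀ x, V' x → V' x → V' x} {e : ∀ x, V' x}
    (h : IsHolMultiplication I F' mul e) (x : M) (a b c : V' x) :
    mul x a (b + c) = mul x a b + mul x a c := by
  rw [h.comm, h.add_mul, h.comm x b, h.comm x c]

theorem IsHolMultiplication.mul_smul {F' : Type*} [NormedAddCommGroup F'] [NormedSpace ℂ F']
    {V' : M → Type*} [TopologicalSpace (TotalSpace F' V')]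
    [∀ x, AddCommGroup (V' x)] [∀ x, Module ℂ (V' x)] [∀ x, TopologicalSpace (V' x)]
    [FiberBundle F' V'] {mul : ∀ x, V' x → V' x → V' x} {e : ∀ x, V' x}
    (h : IsHolMultiplication I F' mul e) (x : M) (r : ℂ) (a b : V' x) :
    mul x a (r • b) = r • mul x a b := by
  rw [h.comm, h.smul_mul, h.comm]

theorem IsHolMultiplication.mul_zero {F' : Type*} [NormedAddCommGroup F'] [NormedSpace ℂ F']
    {V' : M → Type*} [TopologicalSpace (TotalSpace F' V')]
    [∀ x, AddCommGroup (V' x)] [∀ x, Module ℂ (V' x)] [∀ x, TopologicalSpace (V' x)]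
    [FiberBundle F' V'] {mul : ∀ x, V' x → V' x → V' x} {e : ∀ x, V' x}
    (h : IsHolMultiplication I F' mul e) (x : M) (a : V' x) : mul x a 0 = 0 := by
  simpa using h.mul_smul x 0 a 0

theorem IsHolMultiplication.zero_mul {F' : Type*} [NormedAddCommGroup F'] [NormedSpace ℂ F']
    {V' : M → Type*} [TopologicalSpace (TotalSpace F' V')]
    [∀ x, AddCommGroup (V' x)] [∀ x, Module ℂ (V' x)] [∀ x, TopologicalSpace (V' x)]
    [FiberBundle F' V'] {mul : ∀ x, V' x → V' x → V' x} {e : ∀ x, V' x}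
    (h : IsHolMultiplication I F' mul e) (x : M) (a : V' x) : mul x 0 a = 0 := by
  rw [h.comm, h.mul_zero]

theorem IsHolMultiplication.mul_neg {F' : Type*} [NormedAddCommGroup F'] [NormedSpace ℂ F']
    {V' : M → Type*} [TopologicalSpace (TotalSpace F' V')]
    [∀ x, AddCommGroup (V' x)] [∀ x, Module ℂ (V' x)] [∀ x, TopologicalSpace (V' x)]
    [FiberBundle F' V'] {mul : ∀ x, V' x → V' x → V' x} {e : ∀ x, V' x}
    (h : IsHolMultiplication I F' mul e) (x : M) (a b : V' x) : mul x a (-b) = - mul x a b := by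
  simpa using h.mul_smul x (-1) a b

theorem IsHolMultiplication.neg_mul {F' : Type*} [NormedAddCommGroup F'] [NormedSpace ℂ F']
    {V' : M → Type*} [TopologicalSpace (TotalSpace F' V')]
    [∀ x, AddCommGroup (V' x)] [∀ x, Module ℂ (V' x)] [∀ x, TopologicalSpace (V' x)]
    [FiberBundle F' V'] {mul : ∀ x, V' x → V' x → V' x} {e : ∀ x, V' x}
    (h : IsHolMultiplication I F' mul e) (x : M) (a b : V' x) : mul x (-a) b = - mul x a b := by
  rw [h.comm, h.mul_neg, h.comm]

theorem IsHolMultiplication.holAt {F' : Type*} [NormedAddCommGroup F'] [NormedSpace ℂ F']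
    {V' : M → Type*} [TopologicalSpace (TotalSpace F' V')]
    [∀ x, AddCommGroup (V' x)] [∀ x, Module ℂ (V' x)] [∀ x, TopologicalSpace (V' x)]
    [FiberBundle F' V'] [VectorBundle ℂ F' V'] [ContMDiffVectorBundle ω F' V' I]
    {mul : ∀ x, V' x → V' x → V' x} {e : ∀ x, V' x}
    (h : IsHolMultiplication I F' mul e) {s t : ∀ x, V' x} {x : M} (hs : HolAt I F' s x)
    (ht : HolAt I F' t x) : HolAt I F' (fun y => mul y (s y) (t y)) x := by
  obtain ⟨U, hU, hx, hsU⟩ := hs.exists_isHolSection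
  obtain ⟨U', hU', hx', htU⟩ := ht.exists_isHolSection
  exact (h.hol (U ∩ U') s t (hU.inter hU') (ContMDiffOn.mono hsU inter_subset_left)
    (ContMDiffOn.mono htU inter_subset_right)).holAt (hU.inter hU') ⟨hx, hx'⟩

variable (hM : IsHolMultiplication I E mulM eM) (hV : IsHolMultiplication I F mulV eV)
  (hα : IsAlgebraMorphism I F mulM eM mulV eV α)

theorem IsAlgebraMorphism.map_zero (hα : IsAlgebraMorphism I F mulM eM mulV eV α) (x : M) :
    α x 0 = 0 := by simpa using hα.smul x 0 0

include hM hV hα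

theorem totalMul_horLift_horLift (u : TotalSpace F V) (X Y : TangentSpace I u.proj) :
    totalMul D mulM mulV α u (horLift D u X) (horLift D u Y) = horLift D u (mulM u.proj X Y) := by
  simp only [totalMul, horPart_horLift, vertPart_horLift, hα.map_zero, hM.zero_mul, hV.zero_mul,
    vertLift_zero, add_zero]

theorem totalMul_horLift_vertLift (u : TotalSpace F V) (X : TangentSpace I u.proj) (w : V u.proj) :
    totalMul D mulM mulV α u (horLift D u X) (vertLift I u w)
      = horLift D u (mulM u.proj X (α u.proj w)) := by
  simp only [totalMul, horPart_horLift, vertPart_horLift, horPart_vertLift, vertPart_vertLift,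
    hα.map_zero, hM.zero_mul, hM.mul_zero, hV.zero_mul, vertLift_zero, add_zero, zero_add]
  rw [hM.comm]

theorem totalMul_vertLift_horLift (u : TotalSpace F V) (X : TangentSpace I u.proj) (w : V u.proj) :
    totalMul D mulM mulV α u (vertLift I u w) (horLift D u X)
      = horLift D u (mulM u.proj (α u.proj w) X) := by
  simp only [totalMul, horPart_horLift, vertPart_horLift, horPart_vertLift, vertPart_vertLift,
    hα.map_zero, hM.zero_mul, hV.mul_zero, vertLift_zero, add_zero, zero_add]

theorem totalMul_vertLift_vertLift (u : TotalSpace F V) (w w' : V u.proj) :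
    totalMul D mulM mulV α u (vertLift I u w) (vertLift I u w')
      = vertLift I u (mulV u.proj w w') := by
  simp only [totalMul, horPart_vertLift, vertPart_vertLift,
    hM.mul_zero, add_zero, horLift_zero, zero_add]

end Multiplication

end TotalStructures

/-! ### The tt*-equations in terms of the real structure, and their tensoriality -/

section TTEquations

variable {E : Type*} [NormedAddCommGroup E] [NormedSpace ℂ E] [FiniteDimensional ℂ E]
  {H : Type*} [TopologicalSpace H] {I : ModelWithCorners ℂ E H} [I.Boundaryless]
  {M : Type*} [TopologicalSpace M] [ChartedSpace H M] [IsManifold I ω M]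
  {mul : ∀ x : M, TangentSpace I x → TangentSpace I x → TangentSpace I x}
  {e : ∀ x : M, TangentSpace I x}
  {g : ∀ x : M, TangentSpace I x → TangentSpace I x → ℂ}
  {k : ∀ x : M, TangentSpace I x → TangentSpace I x}

variable (I) in
/-- The tensor `∂^D φ` in terms of the real structure. -/
def ttFirst (mul : ∀ x : M, TangentSpace I x → TangentSpace I x → TangentSpace I x)
    (k : ∀ x : M, TangentSpace I x → TangentSpace I x) (Z₁ Z₂ S : ∀ x : M, TangentSpace I x)
    (x : M) : TangentSpace I x :=
  - nabla I E k (fun y => mul y (Z₂ y) (S y)) x (Z₁ x) + mul x (Z₂ x) (nabla I E k S x (Z₁ x))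
    + nabla I E k (fun y => mul y (Z₁ y) (S y)) x (Z₂ x) - mul x (Z₁ x) (nabla I E k S x (Z₂ x))
    + mul x (VectorField.mlieBracket I Z₁ Z₂ x) (S x)

variable (I) in
/-- The tensor `R + [φ, φ†]` in terms of the real structure. -/
def ttSecond (mul : ∀ x : M, TangentSpace I x → TangentSpace I x → TangentSpace I x)
    (k : ∀ x : M, TangentSpace I x → TangentSpace I x) (Z S : ∀ x : M, TangentSpace I x)
    (x : M) (b : TangentSpace I x) : TangentSpace I x :=
  nablaCurvature I E k Z S x b
    + (mul x (Z x) (k x (mul x b (k x (S x)))) - k x (mul x b (k x (mul x (Z x) (S x)))))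

theorem nabla_eq_of_neg (hk : IsCompatibleRealStructure I E g k) {s : ∀ x : M, TangentSpace I x}
    {x : M} (hs : HolAt I E s x) (X : TangentSpace I x) :
    nabla I E k (fun y => - s y) x X = - nabla I E k s x X := hk.nabla_neg hs.smooth X

/-- Invariance moves `φ_b` across `g`, and inserting `k k` in the second argument exhibits `k φ_b k`
as an adjoint. Nondegeneracy makes it the only one. -/
theorem adjointWrt_higgs (hm : IsHolMultiplication I E mul e) (hg : IsHolMetric I E g)
    (hinv : ∀ x a b c, g x (mul x a b) c = g x a (mul x b c))
    (hk : IsCompatibleRealStructure I E g k) (x : M) (b : TangentSpace I x) :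
    adjointWrt (herm g k x) (higgs (mul x) b) = fun a => - k x (mul x b (k x a)) := by
  have key : ∀ a c, herm g k x (higgs (mul x) b a) c = herm g k x a (- k x (mul x b (k x c))) := by
    intro a c
    simp only [herm, higgs, hk.map_neg, hk.involutive]
    rw [← hm.neg_mul, hm.comm, hinv, hm.neg_mul]
  have hsp := Classical.epsilon_spec (p := fun B : TangentSpace I x → TangentSpace I x =>
    ∀ a c, herm g k x (higgs (mul x) b a) c = herm g k x a (B c)) ⟨_, key⟩
  funext c
  rw [← sub_eq_zero]
  have h0 : k x (adjointWrt (herm g k x) (higgs (mul x) b) c - - k x (mul x b (k x c))) = 0 := by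
    refine hg.nondegenerate x _ fun a => ?_
    rw [hk.map_sub, hg.sub_left, hg.symm x _ a, hg.symm x _ a]
    exact sub_eq_zero.2 ((hsp a c).symm.trans (key a c))
  rw [← hk.involutive x (_ - _), h0, hk.map_zero]

/-- Once the connection and the adjoint are expressed by `k`, the metric no longer appears. Sections
on open sets become germs, and `Z₂` in the second equation becomes a single tangent vector, since
only its value matters there. -/
theorem ttStar_iff (hm : IsHolMultiplication I E mul e) (hg : IsHolMetric I E g)
    (hinv : ∀ x a b c, g x (mul x a b) c = g x a (mul x b c))
    (hk : IsCompatibleRealStructure I E g k) :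
    TTStar I mul (herm g k) ↔
      (∀ (x : M) (Z₁ Z₂ S : ∀ x : M, TangentSpace I x), HolAt I E Z₁ x → HolAt I E Z₂ x →
        HolAt I E S x → ttFirst I mul k Z₁ Z₂ S x = 0) ∧
      (∀ (x : M) (Z S : ∀ x : M, TangentSpace I x), HolAt I E Z x → HolAt I E S x →
        ∀ b, ttSecond I mul k Z S x b = 0) := by
  have h1 : ∀ (x : M) (Z₁ Z₂ S : ∀ x : M, TangentSpace I x), HolAt I E Z₁ x → HolAt I E Z₂ x →
      HolAt I E S x → (chern I E (herm g k) (fun y => higgs (mul y) (Z₂ y) (S y)) x (Z₁ x)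
        - higgs (mul x) (Z₂ x) (chern I E (herm g k) S x (Z₁ x)))
      - (chern I E (herm g k) (fun y => higgs (mul y) (Z₁ y) (S y)) x (Z₂ x)
        - higgs (mul x) (Z₁ x) (chern I E (herm g k) S x (Z₂ x)))
      - higgs (mul x) (VectorField.mlieBracket I Z₁ Z₂ x) (S x) = ttFirst I mul k Z₁ Z₂ S x := by
    intro x Z₁ Z₂ S h₁ h₂ hS
    have hS1 := hm.holAt h₁ hS
    have hS2 := hm.holAt h₂ hS
    simp only [higgs]
    rw [hg.chern_eq hk hS1.neg.smooth, hg.chern_eq hk hS2.neg.smooth, hg.chern_eq hk hS.smooth,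
      hg.chern_eq hk hS.smooth, nabla_eq_of_neg hk hS1, nabla_eq_of_neg hk hS2, ttFirst]
    abel
  have h2 : ∀ (x : M) (Z Z₂ S : ∀ x : M, TangentSpace I x), HolAt I E S x →
      chernCurvature I E (herm g k) Z Z₂ S x
      + (higgs (mul x) (Z x) (adjointWrt (herm g k x) (higgs (mul x) (Z₂ x)) (S x))
        - adjointWrt (herm g k x) (higgs (mul x) (Z₂ x)) (higgs (mul x) (Z x) (S x)))
      = ttSecond I mul k Z S x (Z₂ x) := by
    intro x Z Z₂ S hS
    rw [hg.chernCurvature_eq hk hS, adjointWrt_higgs hm hg hinv hk, ttSecond]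
    simp only [higgs, hm.mul_neg, hk.map_neg, neg_neg]
  constructor
  · rintro ⟨hf, hs⟩
    refine ⟨fun x Z₁ Z₂ S h₁ h₂ hS => ?_, fun x Z S hZ hS b => ?_⟩
    · obtain ⟨U, hU, hx, H1⟩ := h₁.exists_isHolSection
      obtain ⟨U', hU', hx', H2⟩ := h₂.exists_isHolSection
      obtain ⟨U'', hU'', hx'', H3⟩ := hS.exists_isHolSection
      rw [← h1 x Z₁ Z₂ S h₁ h₂ hS]
      exact hf (U ∩ (U' ∩ U'')) Z₁ Z₂ S (hU.inter (hU'.inter hU''))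
        (ContMDiffOn.mono H1 inter_subset_left)
        (ContMDiffOn.mono H2 fun _ h => h.2.1) (ContMDiffOn.mono H3 fun _ h => h.2.2)
        x ⟨hx, hx', hx''⟩
    -- The equation is stated for fields, so the vector `b` is extended to a holomorphic one.
    · let B : ∀ y : M, TangentSpace I y := extend E (E := (TangentSpace I : M → Type _)) b
      have hB : B x = b := extend_apply_self (F := E) (E := (TangentSpace I : M → Type _)) b
      have h₂ : HolAt I E B x := holAt_extend b
      obtain ⟨U, hU, hx, H1⟩ := hZ.exists_isHolSection
      obtain ⟨U', hU', hx', H2⟩ := h₂.exists_isHolSection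
      obtain ⟨U'', hU'', hx'', H3⟩ := hS.exists_isHolSection
      rw [← hB, ← h2 x Z B S hS]
      exact hs (U ∩ (U' ∩ U'')) Z B S (hU.inter (hU'.inter hU''))
        (ContMDiffOn.mono H1 inter_subset_left)
        (ContMDiffOn.mono H2 fun _ h => h.2.1) (ContMDiffOn.mono H3 fun _ h => h.2.2)
        x ⟨hx, hx', hx''⟩
  · rintro ⟨hf, hs⟩
    refine ⟨fun U Z₁ Z₂ S hU h₁ h₂ hS x hx => ?_, fun U Z Z₂ S hU hZ h₂ hS x hx => ?_⟩
    · rw [h1 x Z₁ Z₂ S (h₁.holAt hU hx) (h₂.holAt hU hx) (hS.holAt hU hx)]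
      exact hf x Z₁ Z₂ S (h₁.holAt hU hx) (h₂.holAt hU hx) (hS.holAt hU hx)
    · rw [h2 x Z Z₂ S (hS.holAt hU hx)]
      exact hs x Z S (hZ.holAt hU hx) (hS.holAt hU hx) _

theorem ttFirst_congr {Z₁ Z₁' Z₂ Z₂' S S' : ∀ x : M, TangentSpace I x} {x : M}
    (h₁ : ∀ᶠ y in 𝓝 x, Z₁ y = Z₁' y) (h₂ : ∀ᶠ y in 𝓝 x, Z₂ y = Z₂' y)
    (h : ∀ᶠ y in 𝓝 x, S y = S' y) :
    ttFirst I mul k Z₁ Z₂ S x = ttFirst I mul k Z₁' Z₂' S' x := by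
  have a1 : nabla I E k (fun y => mul y (Z₂ y) (S y)) x
      = nabla I E k (fun y => mul y (Z₂' y) (S' y)) x := funext fun X =>
    nabla_congr k (by filter_upwards [h₂, h] with y h h'; rw [h, h']) X
  have a2 : nabla I E k (fun y => mul y (Z₁ y) (S y)) x
      = nabla I E k (fun y => mul y (Z₁' y) (S' y)) x := funext fun X =>
    nabla_congr k (by filter_upwards [h₁, h] with y h h'; rw [h, h']) X
  have a3 : nabla I E k S x = nabla I E k S' x := funext fun X => nabla_congr k h X
  have a4 : VectorField.mlieBracket I Z₁ Z₂ x = VectorField.mlieBracket I Z₁' Z₂' x :=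
    Filter.EventuallyEq.mlieBracket_vectorField_eq h₁ h₂
  unfold ttFirst
  rw [a1, a2, a3, a4, h₁.self_of_nhds, h₂.self_of_nhds, h.self_of_nhds]

/-- With antisymmetry, tensoriality in the first slot also covers the second. -/
theorem ttFirst_swap (hm : IsHolMultiplication I E mul e) (Z₁ Z₂ S : ∀ x : M, TangentSpace I x)
    (x : M) : ttFirst I mul k Z₂ Z₁ S x = - ttFirst I mul k Z₁ Z₂ S x := by
  unfold ttFirst
  rw [VectorField.mlieBracket_swap_apply (V := Z₂), hm.neg_mul]
  abel

variable (hm : IsHolMultiplication I E mul e) (hk : IsCompatibleRealStructure I E g k)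
include hm hk

theorem ttFirst_add {Z₁ Z₂ S S' : ∀ x : M, TangentSpace I x} {x : M} (h₁ : HolAt I E Z₁ x)
    (h₂ : HolAt I E Z₂ x) (h : HolAt I E S x) (h' : HolAt I E S' x) :
    ttFirst I mul k Z₁ Z₂ (fun y => S y + S' y) x
      = ttFirst I mul k Z₁ Z₂ S x + ttFirst I mul k Z₁ Z₂ S' x := by
  unfold ttFirst
  simp only [hm.mul_add]
  rw [hk.nabla_add (hm.holAt h₂ h).smooth (hm.holAt h₂ h').smooth,
    hk.nabla_add (hm.holAt h₁ h).smooth (hm.holAt h₁ h').smooth,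
    hk.nabla_add h.smooth h'.smooth, hk.nabla_add h.smooth h'.smooth, hm.mul_add, hm.mul_add]
  abel

/-- For each of the two directions the derivative of `f` occurs once inside and once outside the
product, with opposite signs. -/
theorem ttFirst_smul {f : M → ℂ} {Z₁ Z₂ S : ∀ x : M, TangentSpace I x} {x : M}
    (hf : ContMDiffAt I 𝓘(ℂ, ℂ) ω f x) (h₁ : HolAt I E Z₁ x)
    (h₂ : HolAt I E Z₂ x) (h : HolAt I E S x) :
    ttFirst I mul k Z₁ Z₂ (fun y => f y • S y) x = f x • ttFirst I mul k Z₁ Z₂ S x := by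
  have hfs := SmoothFunAt.of_hol hf
  unfold ttFirst
  simp only [hm.mul_smul]
  rw [hk.nabla_smul hfs (hm.holAt h₂ h).smooth, hk.nabla_smul hfs (hm.holAt h₁ h).smooth,
    hk.nabla_smul hfs h.smooth, hk.nabla_smul hfs h.smooth]
  simp only [hm.mul_add, hm.mul_smul]
  module

theorem ttFirst_add_left {Z₁ Z₁' Z₂ S : ∀ x : M, TangentSpace I x} {x : M} (h₁ : HolAt I E Z₁ x)
    (h₁' : HolAt I E Z₁' x) (h : HolAt I E S x) :
    ttFirst I mul k (fun y => Z₁ y + Z₁' y) Z₂ S x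
      = ttFirst I mul k Z₁ Z₂ S x + ttFirst I mul k Z₁' Z₂ S x := by
  have hb : VectorField.mlieBracket I (fun y => Z₁ y + Z₁' y) Z₂ x
      = VectorField.mlieBracket I Z₁ Z₂ x + VectorField.mlieBracket I Z₁' Z₂ x :=
    have : IsManifold I 1 M := .of_le (n := ω) le_top
    have : CompleteSpace E := FiniteDimensional.complete ℂ E
    VectorField.mlieBracket_add_left h₁.mdifferentiableAt h₁'.mdifferentiableAt
  unfold ttFirst
  simp only [hm.add_mul, hb]
  rw [hk.nabla_add (hm.holAt h₁ h).smooth (hm.holAt h₁' h).smooth, hk.nabla_add_vec,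
    hk.nabla_add_vec, hm.mul_add]
  abel

/-- The term `(Z₂ f) Z₁ ∘ S` from differentiating the product `f Z₁ ∘ S` cancels the derivative term
of the bracket `[f Z₁, Z₂]`. -/
theorem ttFirst_smul_left {f : M → ℂ} {Z₁ Z₂ S : ∀ x : M, TangentSpace I x} {x : M}
    (hf : ContMDiffAt I 𝓘(ℂ, ℂ) ω f x) (h₁ : HolAt I E Z₁ x) (h : HolAt I E S x) :
    ttFirst I mul k (fun y => f y • Z₁ y) Z₂ S x = f x • ttFirst I mul k Z₁ Z₂ S x := by
  have hfm := hf.mdifferentiableAt (by simp)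
  have hb : VectorField.mlieBracket I (fun y => f y • Z₁ y) Z₂ x
      = - mvfderiv I f x (Z₂ x) • Z₁ x + f x • VectorField.mlieBracket I Z₁ Z₂ x :=
    have : IsManifold I 1 M := .of_le (n := ω) le_top
    have : CompleteSpace E := FiniteDimensional.complete ℂ E
    VectorField.mlieBracket_smul_left hfm h₁.mdifferentiableAt
  unfold ttFirst
  simp only [hm.smul_mul, hb]
  rw [hk.nabla_smul (SmoothFunAt.of_hol hf) (hm.holAt h₁ h).smooth, hk.nabla_smul_vec,
    hk.nabla_smul_vec, del_of_hol hfm]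
  simp only [hm.add_mul, hm.smul_mul, hm.mul_smul, hm.neg_mul, neg_smul]
  module

omit hm hk in
theorem ttSecond_congr {Z Z' S S' : ∀ x : M, TangentSpace I x} {x : M}
    (hZ : ∀ᶠ y in 𝓝 x, Z y = Z' y) (h : ∀ᶠ y in 𝓝 x, S y = S' y) (b : TangentSpace I x) :
    ttSecond I mul k Z S x b = ttSecond I mul k Z' S' x b := by
  unfold ttSecond
  rw [nablaCurvature_congr k hZ h, hZ.self_of_nhds, h.self_of_nhds]

theorem ttSecond_add {Z S S' : ∀ x : M, TangentSpace I x} {x : M} (hZ : HolAt I E Z x)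
    (h : HolAt I E S x) (h' : HolAt I E S' x) (b : TangentSpace I x) :
    ttSecond I mul k Z (fun y => S y + S' y) x b
      = ttSecond I mul k Z S x b + ttSecond I mul k Z S' x b := by
  unfold ttSecond
  rw [hk.nablaCurvature_add h h' hZ]
  simp only [hk.add, hm.mul_add]
  abel

theorem ttSecond_smul {f : M → ℂ} {Z S : ∀ x : M, TangentSpace I x} {x : M}
    (hf : ContMDiffAt I 𝓘(ℂ, ℂ) ω f x) (hZ : HolAt I E Z x)
    (h : HolAt I E S x) (b : TangentSpace I x) :
    ttSecond I mul k Z (fun y => f y • S y) x b = f x • ttSecond I mul k Z S x b := by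
  unfold ttSecond
  rw [hk.nablaCurvature_smul hf h hZ]
  simp only [hk.smul, hm.mul_smul, starRingEnd_self_apply, smul_add, smul_sub]

theorem ttSecond_add_left {Z Z' S : ∀ x : M, TangentSpace I x} {x : M} (hZ : HolAt I E Z x)
    (hZ' : HolAt I E Z' x) (h : HolAt I E S x) (b : TangentSpace I x) :
    ttSecond I mul k (fun y => Z y + Z' y) S x b
      = ttSecond I mul k Z S x b + ttSecond I mul k Z' S x b := by
  unfold ttSecond
  rw [hk.nablaCurvature_add_left h hZ hZ']
  simp only [hk.add, hm.add_mul, hm.mul_add]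
  abel

theorem ttSecond_smul_left {f : M → ℂ} {Z S : ∀ x : M, TangentSpace I x} {x : M}
    (hf : ContMDiffAt I 𝓘(ℂ, ℂ) ω f x) (hZ : HolAt I E Z x)
    (h : HolAt I E S x) (b : TangentSpace I x) :
    ttSecond I mul k (fun y => f y • Z y) S x b = f x • ttSecond I mul k Z S x b := by
  unfold ttSecond
  rw [hk.nablaCurvature_smul_left hf h hZ]
  simp only [hk.smul, hm.smul_mul, hm.mul_smul, starRingEnd_self_apply, smul_add, smul_sub]

end TTEquations

/-! ### The tt*-expressions of the total space evaluated on lifts -/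

section TotalTT

variable {E : Type*} [NormedAddCommGroup E] [NormedSpace ℂ E] [FiniteDimensional ℂ E]
  {H : Type*} [TopologicalSpace H] {I : ModelWithCorners ℂ E H} [I.Boundaryless]
  {M : Type*} [TopologicalSpace M] [ChartedSpace H M] [IsManifold I ω M]
  {F : Type*} [NormedAddCommGroup F] [NormedSpace ℂ F] [FiniteDimensional ℂ F]
  {V : M → Type*} [TopologicalSpace (TotalSpace F V)]
  [∀ x, AddCommGroup (V x)] [∀ x, Module ℂ (V x)] [∀ x, TopologicalSpace (V x)]
  [∀ x, IsTopologicalAddGroup (V x)] [∀ x, ContinuousSMul ℂ (V x)]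
  [FiberBundle F V] [VectorBundle ℂ F V] [ContMDiffVectorBundle ω F V I]
  {D : CovariantDerivative I F V}
  {mulM : ∀ x : M, TangentSpace I x → TangentSpace I x → TangentSpace I x}
  {eM : ∀ x : M, TangentSpace I x}
  {gM : ∀ x : M, TangentSpace I x → TangentSpace I x → ℂ}
  {kM : ∀ x : M, TangentSpace I x → TangentSpace I x}
  {mulV : ∀ x, V x → V x → V x} {eV : ∀ x, V x} {gV : ∀ x, V x → V x → ℂ}
  {kV : ∀ x, V x → V x} {α : ∀ x, V x → TangentSpace I x}

/-- The horizontal lift of a vector field. -/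
def horField (D : CovariantDerivative I F V) (X : ∀ x : M, TangentSpace I x)
    (v : TotalSpace F V) : TangentSpace (I.prod 𝓘(ℂ, F)) v := horLift D v (X v.proj)

theorem holAt_horField (hD : IsHolConnection D) {X : ∀ x : M, TangentSpace I x}
    {u : TotalSpace F V} (hX : HolAt I E X u.proj) :
    HolAt (I.prod 𝓘(ℂ, F)) (E × F) (horField D X) u := HolAt.horLift hD hX

theorem holAt_totalSection {s : ∀ x, V x} {u : TotalSpace F V} (hs : HolAt I F s u.proj) :
    HolAt (I.prod 𝓘(ℂ, F)) (E × F) (totalSection I s : ∀ u : TotalSpace F V, _) u :=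
  HolAt.vertLift hs

theorem isHolMorphism_alpha (hα : IsAlgebraMorphism I F mulM eM mulV eV α) :
    IsHolMorphism I F I E id (fun x => (α x : V x → TangentSpace I x)) where
  add := hα.add
  smul := hα.smul
  hol_base := contMDiff_id
  hol _ _ hs := hα.holAt hs

/-- Naturality of `k ∂̄ k` for `α`: the Chern connections correspond although `α` need not be
isometric. The right side of (iv) vanishes for this reason. -/
theorem alpha_nabla (hα : IsAlgebraMorphism I F mulM eM mulV eV α)
    (hkV : IsCompatibleRealStructure I F gV kV) (hk : ∀ x a, α x (kV x a) = kM x (α x a))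
    {s : ∀ x, V x} {x : M} (hs : SmoothSectionAt I F s x) (X : TangentSpace I x) :
    nabla I E kM (fun y => α y (s y)) x X = α x (nabla I F kV s x X) := by
  have h := (isHolMorphism_alpha hα).nabla (k' := kM) hkV (fun n a => (hk n a).symm) (n := x) hs X
  rw [mfderiv_id] at h
  exact h

theorem alpha_nablaCurvature (hα : IsAlgebraMorphism I F mulM eM mulV eV α)
    (hkV : IsCompatibleRealStructure I F gV kV) (hk : ∀ x a, α x (kV x a) = kM x (α x a))
    {s : ∀ x, V x} {X : ∀ x : M, TangentSpace I x} {x : M} (hs : HolAt I F s x)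
    (hX : HolAt I E X x) (Y : TangentSpace I x) :
    nablaCurvature I E kM X (fun y => α y (s y)) x Y = α x (nablaCurvature I F kV X s x Y) := by
  have h := (isHolMorphism_alpha hα).nablaCurvature (k' := kM) hkV (fun n a => (hk n a).symm)
    (n := x) hs hX (X' := X) (.of_forall fun y => by rw [mfderiv_id]; rfl) Y
  rw [mfderiv_id] at h
  exact h

theorem nabla_horField (hD : IsHolConnection D) (hkM : IsCompatibleRealStructure I E gM kM)
    (hkV : IsCompatibleRealStructure I F gV kV) {X : ∀ x : M, TangentSpace I x}
    {u : TotalSpace F V} (hX : SmoothSectionAt I E X u.proj)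
    (W : TangentSpace (I.prod 𝓘(ℂ, F)) u) :
    nabla (I.prod 𝓘(ℂ, F)) (E × F) (totalReal D kM kV) (horField D X) u W
      = horLift D u (nabla I E kM X u.proj (horPart I u W)) :=
  (isHolMorphism_horLift hD).nabla hkM (fun n a => totalReal_horLift hkV n a) hX W

theorem nabla_totalSection (hkM : IsCompatibleRealStructure I E gM kM)
    (hkV : IsCompatibleRealStructure I F gV kV) {s : ∀ x, V x}
    {u : TotalSpace F V} (hs : SmoothSectionAt I F s u.proj)
    (W : TangentSpace (I.prod 𝓘(ℂ, F)) u) :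
    nabla (I.prod 𝓘(ℂ, F)) (E × F) (totalReal D kM kV) (totalSection I s) u W
      = vertLift I u (nabla I F kV s u.proj (horPart I u W)) :=
  isHolMorphism_vertLift.nabla hkV (fun n a => totalReal_vertLift hkM n a) hs W

theorem nablaCurvature_zero_left (hkV : IsCompatibleRealStructure I F gV kV) {s : ∀ x, V x}
    {x : M} (Y : TangentSpace I x) : nablaCurvature I F kV (fun _ => 0) s x Y = 0 := by
  unfold nablaCurvature
  simp only [hkV.nabla_zero_vec, delbarSection_of_hol (HolAt.zero x), neg_zero]

theorem nablaCurvature_horField (hD : IsHolConnection D)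
    (hkM : IsCompatibleRealStructure I E gM kM) (hkV : IsCompatibleRealStructure I F gV kV)
    {W : ∀ u : TotalSpace F V, TangentSpace (I.prod 𝓘(ℂ, F)) u} {X : ∀ x : M, TangentSpace I x}
    (hW : ∀ z, horPart I z (W z) = X z.proj) {Z : ∀ x : M, TangentSpace I x}
    {u : TotalSpace F V} (hX : HolAt I E X u.proj) (hZ : HolAt I E Z u.proj)
    (b : TangentSpace (I.prod 𝓘(ℂ, F)) u) :
    nablaCurvature (I.prod 𝓘(ℂ, F)) (E × F) (totalReal D kM kV) W (horField D Z) u b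
      = horLift D u (nablaCurvature I E kM X Z u.proj (horPart I u b)) :=
  (isHolMorphism_horLift hD).nablaCurvature hkM (fun n a => totalReal_horLift hkV n a) hZ hX
    (.of_forall hW) b

theorem nablaCurvature_totalSection
    (hkM : IsCompatibleRealStructure I E gM kM) (hkV : IsCompatibleRealStructure I F gV kV)
    {W : ∀ u : TotalSpace F V, TangentSpace (I.prod 𝓘(ℂ, F)) u} {X : ∀ x : M, TangentSpace I x}
    (hW : ∀ z, horPart I z (W z) = X z.proj) {s : ∀ x, V x}
    {u : TotalSpace F V} (hX : HolAt I E X u.proj) (hs : HolAt I F s u.proj)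
    (b : TangentSpace (I.prod 𝓘(ℂ, F)) u) :
    nablaCurvature (I.prod 𝓘(ℂ, F)) (E × F) (totalReal D kM kV) W (totalSection I s) u b
      = vertLift I u (nablaCurvature I F kV X s u.proj (horPart I u b)) :=
  isHolMorphism_vertLift.nablaCurvature hkV (fun n a => totalReal_vertLift hkM n a) hs hX
    (.of_forall hW) b

/-- Reduction of a local tensorial statement on the total space to lifts. -/
theorem total_induction (hD : IsHolConnection D) (u : TotalSpace F V)
    (P : (∀ u : TotalSpace F V, TangentSpace (I.prod 𝓘(ℂ, F)) u) → Prop)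
    (hcongr : ∀ W W', (∀ᶠ z in 𝓝 u, W z = W' z) → P W → P W')
    (hadd : ∀ W W', HolAt (I.prod 𝓘(ℂ, F)) (E × F) W u → HolAt (I.prod 𝓘(ℂ, F)) (E × F) W' u →
      P W → P W' → P fun z => W z + W' z)
    (hsmul : ∀ (f : TotalSpace F V → ℂ) W, ContMDiffAt (I.prod 𝓘(ℂ, F)) 𝓘(ℂ, ℂ) ω f u →
      HolAt (I.prod 𝓘(ℂ, F)) (E × F) W u → P W → P fun z => f z • W z)
    (hhor : ∀ X : ∀ x : M, TangentSpace I x, HolAt I E X u.proj → P (horField D X))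
    (hvert : ∀ s : ∀ x, V x, HolAt I F s u.proj → P (totalSection I s))
    {W : ∀ u : TotalSpace F V, TangentSpace (I.prod 𝓘(ℂ, F)) u}
    (hW : HolAt (I.prod 𝓘(ℂ, F)) (E × F) W u) : P W := by
  have hzero : P fun _ => 0 := by
    refine hcongr _ _ (.of_forall fun z => ?_) (hhor _ (HolAt.zero u.proj))
    exact horLift_zero z
  have hsum : ∀ {ι : Type} (t : Finset ι)
      (Q : ι → ∀ u : TotalSpace F V, TangentSpace (I.prod 𝓘(ℂ, F)) u),
      (∀ i, HolAt (I.prod 𝓘(ℂ, F)) (E × F) (Q i) u) → (∀ i, P (Q i)) →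
      HolAt (I.prod 𝓘(ℂ, F)) (E × F) (fun z => ∑ i ∈ t, Q i z) u ∧ P fun z => ∑ i ∈ t, Q i z := by
    intro ι t Q hQ hP
    classical
    induction t using Finset.induction_on with
    | empty => simpa using ⟨HolAt.zero u, hzero⟩
    | insert a t ha ih =>
      simp only [Finset.sum_insert ha]
      exact ⟨(hQ a).add ih.1, hadd _ _ (hQ a) ih.1 (hP a) ih.2⟩
  have hh := holAlong_horPart hW
  have hv := holAlong_vertPart hD hW
  have e1 := fun i => holAt_horField hD (u := u)
    (holAt_frameAt (F := E) (V := (TangentSpace I : M → Type _)) u.proj i)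
  have e2 := fun i => holAt_totalSection (I := I) (u := u) (holAt_frameAt (F := F) (V := V) u.proj i)
  have h1 := hsum Finset.univ (fun i z => alongCoeff E (V' := (TangentSpace I : M → Type _))
    (fun z : TotalSpace F V => horPart I z (W z)) u.proj i z •
      horField D (frameAt E (TangentSpace I : M → Type _) u.proj i) z)
    (fun i => HolAt.smul (hh.alongCoeff i) (e1 i))
    (fun i => hsmul _ _ (hh.alongCoeff i) (e1 i) (hhor _ (holAt_frameAt u.proj i)))
  have h2 := hsum Finset.univ (fun i z => alongCoeff F
    (fun z : TotalSpace F V => vertPart D z (W z)) u.proj i z •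
      totalSection I (frameAt F V u.proj i) z)
    (fun i => HolAt.smul (hv.alongCoeff i) (e2 i))
    (fun i => hsmul _ _ (hv.alongCoeff i) (e2 i) (hvert _ (holAt_frameAt u.proj i)))
  refine hcongr _ _ ?_ (hadd _ _ h1.1 h2.1 h1.2 h2.2)
  filter_upwards [eq_sum_alongCoeff (F' := E) (V' := (TangentSpace I : M → Type _))
    (fun z : TotalSpace F V => horPart I z (W z)) u,
    eq_sum_alongCoeff (F' := F) (fun z : TotalSpace F V => vertPart D z (W z)) u] with z hz hz'
  rw [← horLift_add_vertLift D z (W z)]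
  conv_rhs => rw [hz, hz']
  rw [(isHolMorphism_horLift hD).map_sum_smul, isHolMorphism_vertLift.map_sum_smul]
  rfl

theorem horLift_neg (u : TotalSpace F V) (X : TangentSpace I u.proj) :
    horLift D u (-X) = - horLift D u X := by
  simpa using horLift_smul D u (-1) X

section Products

variable (hM : IsHolMultiplication I E mulM eM) (hV : IsHolMultiplication I F mulV eV)
  (hα : IsAlgebraMorphism I F mulM eM mulV eV α)
include hM hV hα

theorem totalMul_hh (X Y : ∀ x : M, TangentSpace I x) :
    (fun z => totalMul D mulM mulV α z (horField D X z) (horField D Y z))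
      = horField D fun x => mulM x (X x) (Y x) :=
  funext fun _ => totalMul_horLift_horLift hM hV hα _ _ _

theorem totalMul_hv (X : ∀ x : M, TangentSpace I x) (s : ∀ x, V x) :
    (fun z => totalMul D mulM mulV α z (horField D X z) (totalSection I s z))
      = horField D fun x => mulM x (X x) (α x (s x)) :=
  funext fun _ => totalMul_horLift_vertLift hM hV hα _ _ _

theorem totalMul_vh (X : ∀ x : M, TangentSpace I x) (s : ∀ x, V x) :
    (fun z => totalMul D mulM mulV α z (totalSection I s z) (horField D X z))
      = horField D fun x => mulM x (α x (s x)) (X x) :=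
  funext fun _ => totalMul_vertLift_horLift hM hV hα _ _ _

theorem totalMul_vv (s t : ∀ x, V x) :
    (fun z => totalMul D mulM mulV α z (totalSection I s z) (totalSection I t z))
      = totalSection I fun x => mulV x (s x) (t x) :=
  funext fun _ => totalMul_vertLift_vertLift hM hV hα _ _ _

end Products

/-- The Higgs part of the second equation. -/
def higgsBracket {W : Type*} [AddCommGroup W] (mul : W → W → W) (k : W → W) (a b c : W) : W :=
  mul a (k (mul b (k c))) - k (mul b (k (mul a c)))

variable (hM : IsHolMultiplication I E mulM eM) (hV : IsHolMultiplication I F mulV eV)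
  (hα : IsAlgebraMorphism I F mulM eM mulV eV α) (hD : IsHolConnection D)
  (hkM : IsCompatibleRealStructure I E gM kM) (hkV : IsCompatibleRealStructure I F gV kV)
  (hk : ∀ x a, α x (kV x a) = kM x (α x a))
include hM hV hα hD hkM hkV hk

/-- Every term is the lift of the corresponding term on `M`. The hypothesis `hflat` excludes a
vertical part of the bracket, which would contribute through `α`. -/
theorem ttFirst_hhh {X Y Z : ∀ x : M, TangentSpace I x} {u : TotalSpace F V}
    (hX : HolAt I E X u.proj) (hY : HolAt I E Y u.proj) (hZ : HolAt I E Z u.proj)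
    (hflat : VectorField.mlieBracket (I.prod 𝓘(ℂ, F)) (horField D X) (horField D Y) u
      = horLift D u (VectorField.mlieBracket I X Y u.proj)) :
    ttFirst (I.prod 𝓘(ℂ, F)) (totalMul D mulM mulV α) (totalReal D kM kV) (horField D X)
      (horField D Y) (horField D Z) u = horLift D u (ttFirst I mulM kM X Y Z u.proj) := by
  unfold ttFirst
  rw [totalMul_hh hM hV hα, totalMul_hh hM hV hα,
    nabla_horField hD hkM hkV (hM.holAt hY hZ).smooth,
    nabla_horField hD hkM hkV (hM.holAt hX hZ).smooth,
    nabla_horField hD hkM hkV hZ.smooth, nabla_horField hD hkM hkV hZ.smooth, hflat]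
  simp only [horField, horPart_horLift, totalMul_horLift_horLift hM hV hα, sub_eq_add_neg,
    horLift_add, horLift_neg]

/-- Products of horizontal fields with `s` see only `α s`, and `α` commutes with the connections, so
this is no condition beyond the one on `M`. -/
theorem ttFirst_hhv {X Y : ∀ x : M, TangentSpace I x} {s : ∀ x, V x} {u : TotalSpace F V}
    (hX : HolAt I E X u.proj) (hY : HolAt I E Y u.proj) (hs : HolAt I F s u.proj)
    (hflat : VectorField.mlieBracket (I.prod 𝓘(ℂ, F)) (horField D X) (horField D Y) u
      = horLift D u (VectorField.mlieBracket I X Y u.proj)) :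
    ttFirst (I.prod 𝓘(ℂ, F)) (totalMul D mulM mulV α) (totalReal D kM kV) (horField D X)
      (horField D Y) (totalSection I s) u
      = horLift D u (ttFirst I mulM kM X Y (fun x => α x (s x)) u.proj) := by
  have hαs := hα.holAt hs
  unfold ttFirst
  rw [totalMul_hv hM hV hα, totalMul_hv hM hV hα,
    nabla_horField hD hkM hkV (hM.holAt hY hαs).smooth,
    nabla_horField hD hkM hkV (hM.holAt hX hαs).smooth,
    nabla_totalSection hkM hkV hs.smooth, nabla_totalSection hkM hkV hs.smooth, hflat,
    alpha_nabla hα hkV hk hs.smooth, alpha_nabla hα hkV hk hs.smooth]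
  simp only [horField, totalSection, horPart_horLift, totalMul_horLift_vertLift hM hV hα,
    sub_eq_add_neg, horLift_add, horLift_neg]

/-- Derivatives of lifts along the vertical direction vanish, and the bracket contributes `D_X s`.
For parallel `s` what remains is condition (i). -/
theorem ttFirst_hvh {X Z : ∀ x : M, TangentSpace I x} {s : ∀ x, V x} {u : TotalSpace F V}
    (hX : HolAt I E X u.proj) (hZ : HolAt I E Z u.proj) (hs : HolAt I F s u.proj) :
    ttFirst (I.prod 𝓘(ℂ, F)) (totalMul D mulM mulV α) (totalReal D kM kV) (horField D X)
      (totalSection I s) (horField D Z) u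
      = horLift D u (- nabla I E kM (fun y => mulM y (α y (s y)) (Z y)) u.proj (X u.proj)
        + mulM u.proj (α u.proj (s u.proj)) (nabla I E kM Z u.proj (X u.proj))
        + mulM u.proj (α u.proj (D s u.proj (X u.proj))) (Z u.proj)) := by
  have hαs := hα.holAt hs
  have hb : VectorField.mlieBracket (I.prod 𝓘(ℂ, F)) (horField D X) (totalSection I s) u
    = vertLift I u (D s u.proj (X u.proj)) := bracket_horLift_vertLift hD hX hs
  unfold ttFirst
  rw [totalMul_vh hM hV hα, totalMul_hh hM hV hα,
    nabla_horField hD hkM hkV (hM.holAt hαs hZ).smooth,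
    nabla_horField hD hkM hkV (hM.holAt hX hZ).smooth,
    nabla_horField hD hkM hkV hZ.smooth, nabla_horField hD hkM hkV hZ.smooth, hb]
  simp only [horField, totalSection, horPart_horLift, horPart_vertLift, hkM.nabla_zero_vec,
    totalMul_vertLift_horLift hM hV hα, totalMul_horLift_horLift hM hV hα, hM.mul_zero,
    horLift_add, horLift_neg]
  simp only [horLift_zero, add_zero, sub_zero]

/-- The same mechanism on vertical fields; with `t` the unit the identity becomes condition (ii). -/
theorem ttFirst_hvv {X : ∀ x : M, TangentSpace I x} {s t : ∀ x, V x} {u : TotalSpace F V}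
    (hX : HolAt I E X u.proj) (ht : HolAt I F t u.proj) (hs : HolAt I F s u.proj) :
    ttFirst (I.prod 𝓘(ℂ, F)) (totalMul D mulM mulV α) (totalReal D kM kV) (horField D X)
      (totalSection I s) (totalSection I t) u
      = vertLift I u (- nabla I F kV (fun y => mulV y (s y) (t y)) u.proj (X u.proj)
        + mulV u.proj (s u.proj) (nabla I F kV t u.proj (X u.proj))
        + mulV u.proj (D s u.proj (X u.proj)) (t u.proj)) := by
  have hαt := hα.holAt ht
  have hb : VectorField.mlieBracket (I.prod 𝓘(ℂ, F)) (horField D X) (totalSection I s) u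
    = vertLift I u (D s u.proj (X u.proj)) := bracket_horLift_vertLift hD hX hs
  have hneg : ∀ a : V u.proj, vertLift I u (-a) = - vertLift I u a := fun a => by
    simpa using vertLift_smul (I := I) u (-1) a
  unfold ttFirst
  rw [totalMul_vv hM hV hα, totalMul_hv hM hV hα,
    nabla_totalSection hkM hkV (hV.holAt hs ht).smooth,
    nabla_horField hD hkM hkV (hM.holAt hX hαt).smooth,
    nabla_totalSection hkM hkV ht.smooth, nabla_totalSection hkM hkV ht.smooth, hb]
  simp only [horField, totalSection, horPart_horLift, horPart_vertLift, hkM.nabla_zero_vec,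
    hkV.nabla_zero_vec, totalMul_vertLift_vertLift hM hV hα, totalMul_horLift_vertLift hM hV hα,
    hα.map_zero, hM.mul_zero, vertLift_add, hneg]
  simp only [horLift_zero, add_zero, sub_zero]

/-- All derivatives are taken along the fibres and vertical fields commute, so each term is zero. -/
theorem ttFirst_vvh {Z : ∀ x : M, TangentSpace I x} {s t : ∀ x, V x} {u : TotalSpace F V}
    (hZ : HolAt I E Z u.proj) (ht : HolAt I F t u.proj) (hs : HolAt I F s u.proj) :
    ttFirst (I.prod 𝓘(ℂ, F)) (totalMul D mulM mulV α) (totalReal D kM kV) (totalSection I s)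
      (totalSection I t) (horField D Z) u = 0 := by
  have hαt := hα.holAt ht
  have hαs := hα.holAt hs
  have hb : VectorField.mlieBracket (I.prod 𝓘(ℂ, F)) (totalSection I s)
    (totalSection I t : ∀ u : TotalSpace F V, _) u = 0 := bracket_vertLift_vertLift hs ht
  unfold ttFirst
  rw [totalMul_vh hM hV hα, totalMul_vh hM hV hα,
    nabla_horField hD hkM hkV (hM.holAt hαt hZ).smooth,
    nabla_horField hD hkM hkV (hM.holAt hαs hZ).smooth,
    nabla_horField hD hkM hkV hZ.smooth, nabla_horField hD hkM hkV hZ.smooth, hb]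
  simp only [horField, totalSection, horPart_vertLift, hkM.nabla_zero_vec]
  rw [← vertLift_zero, totalMul_vertLift_horLift hM hV hα, totalMul_vertLift_horLift hM hV hα,
    totalMul_vertLift_horLift hM hV hα, hα.map_zero, hM.mul_zero, hM.mul_zero, hM.zero_mul,
    horLift_zero, vertLift_zero]
  simp

theorem ttFirst_vvv {r s t : ∀ x, V x} {u : TotalSpace F V}
    (hr : HolAt I F r u.proj) (ht : HolAt I F t u.proj) (hs : HolAt I F s u.proj) :
    ttFirst (I.prod 𝓘(ℂ, F)) (totalMul D mulM mulV α) (totalReal D kM kV) (totalSection I s)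
      (totalSection I t) (totalSection I r) u = 0 := by
  have hb : VectorField.mlieBracket (I.prod 𝓘(ℂ, F)) (totalSection I s)
    (totalSection I t : ∀ u : TotalSpace F V, _) u = 0 := bracket_vertLift_vertLift hs ht
  unfold ttFirst
  rw [totalMul_vv hM hV hα, totalMul_vv hM hV hα,
    nabla_totalSection hkM hkV (hV.holAt ht hr).smooth,
    nabla_totalSection hkM hkV (hV.holAt hs hr).smooth,
    nabla_totalSection hkM hkV hr.smooth, nabla_totalSection hkM hkV hr.smooth, hb]
  simp only [totalSection, horPart_vertLift, hkV.nabla_zero_vec]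
  rw [← vertLift_zero, totalMul_vertLift_vertLift hM hV hα, totalMul_vertLift_vertLift hM hV hα,
    totalMul_vertLift_vertLift hM hV hα, hV.mul_zero, hV.mul_zero, hV.zero_mul, vertLift_zero]
  simp

theorem totalMul_horLift (u : TotalSpace F V) (W : TangentSpace (I.prod 𝓘(ℂ, F)) u)
    (X : TangentSpace I u.proj) :
    totalMul D mulM mulV α u W (horLift D u X)
      = horLift D u (mulM u.proj (horPart I u W + α u.proj (vertPart D u W)) X) := by
  simp only [totalMul, horPart_horLift, vertPart_horLift, hα.map_zero, hM.zero_mul, hV.mul_zero,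
    vertLift_zero, add_zero, hM.add_mul]

theorem totalMul_vertLift (u : TotalSpace F V) (W : TangentSpace (I.prod 𝓘(ℂ, F)) u)
    (w : V u.proj) :
    totalMul D mulM mulV α u W (vertLift I u w)
      = horLift D u (mulM u.proj (horPart I u W) (α u.proj w))
        + vertLift I u (mulV u.proj (vertPart D u W) w) := by
  simp only [totalMul, horPart_vertLift, vertPart_vertLift, hM.mul_zero, add_zero, zero_add]
  rw [hM.comm]

/-- On horizontal vectors `W` acts as multiplication on `M` by its horizontal part plus `α` of its
vertical part (`totalMul_horLift`), and the curvature is pulled back. -/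
theorem ttSecond_h {W : ∀ u : TotalSpace F V, TangentSpace (I.prod 𝓘(ℂ, F)) u}
    {X Z : ∀ x : M, TangentSpace I x} (hW : ∀ z, horPart I z (W z) = X z.proj)
    {u : TotalSpace F V} (hX : HolAt I E X u.proj) (hZ : HolAt I E Z u.proj)
    (b : TangentSpace (I.prod 𝓘(ℂ, F)) u) :
    ttSecond (I.prod 𝓘(ℂ, F)) (totalMul D mulM mulV α) (totalReal D kM kV) W (horField D Z) u b
      = horLift D u (nablaCurvature I E kM X Z u.proj (horPart I u b)
        + higgsBracket (mulM u.proj) (kM u.proj)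
          (X u.proj + α u.proj (vertPart D u (W u)))
          (horPart I u b + α u.proj (vertPart D u b)) (Z u.proj)) := by
  unfold ttSecond higgsBracket
  rw [nablaCurvature_horField hD hkM hkV hW hX hZ]
  simp only [horField, totalMul_horLift hM hV hα hD hkM hkV hk, totalReal_horLift hkV, hW,
    sub_eq_add_neg, horLift_add, horLift_neg]

/-- Multiplying a vertical vector by `W` gives a horizontal and a vertical part. The horizontal term
with two vertical multipliers is absent, since such products remain vertical. -/
theorem ttSecond_v {W : ∀ u : TotalSpace F V, TangentSpace (I.prod 𝓘(ℂ, F)) u}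
    {X : ∀ x : M, TangentSpace I x} {s : ∀ x, V x} (hW : ∀ z, horPart I z (W z) = X z.proj)
    {u : TotalSpace F V} (hX : HolAt I E X u.proj) (hs : HolAt I F s u.proj)
    (b : TangentSpace (I.prod 𝓘(ℂ, F)) u) :
    ttSecond (I.prod 𝓘(ℂ, F)) (totalMul D mulM mulV α) (totalReal D kM kV) W (totalSection I s) u b
      = horLift D u (higgsBracket (mulM u.proj) (kM u.proj) (X u.proj)
            (horPart I u b + α u.proj (vertPart D u b)) (α u.proj (s u.proj))
          + higgsBracket (mulM u.proj) (kM u.proj) (α u.proj (vertPart D u (W u)))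
            (horPart I u b) (α u.proj (s u.proj)))
        + vertLift I u (nablaCurvature I F kV X s u.proj (horPart I u b)
          + higgsBracket (mulV u.proj) (kV u.proj) (vertPart D u (W u)) (vertPart D u b)
            (s u.proj)) := by
  have hK := isCompatibleRealStructure_totalReal hD hkM hkV hk
  have hvneg : ∀ a : V u.proj, vertLift I u (-a) = - vertLift I u a := fun a => by
    simpa using vertLift_smul (I := I) u (-1) a
  have hadd : ∀ c a a', totalMul D mulM mulV α u c (a + a')
      = totalMul D mulM mulV α u c a + totalMul D mulM mulV α u c a' := by
    intro c a a'
    simp only [totalMul, horPart_add, vertPart_add, hα.add, hM.mul_add, hM.add_mul, hV.mul_add,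
      horLift_add, vertLift_add]
    abel
  unfold ttSecond higgsBracket
  rw [nablaCurvature_totalSection hkM hkV hW hX hs]
  simp only [totalSection, totalMul_vertLift hM hV hα hD hkM hkV hk, totalReal_vertLift hkM,
    hK.add, totalReal_horLift hkV, hadd, totalMul_horLift hM hV hα hD hkM hkV hk, hW,
    hM.add_mul, hkM.add, hM.mul_add, hk, hα.mul, sub_eq_add_neg, horLift_add, vertLift_add,
    hvneg, horLift_neg, neg_add]
  abel

variable (D) in
/-- A vector field which is the horizontal or vertical lift of a holomorphic section. -/
def IsLiftAt (u : TotalSpace F V) (W : ∀ u : TotalSpace F V, TangentSpace (I.prod 𝓘(ℂ, F)) u) :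
    Prop :=
  (∃ X : ∀ x : M, TangentSpace I x, HolAt I E X u.proj ∧ W = horField D X) ∨
    ∃ s : ∀ x, V x, HolAt I F s u.proj ∧ W = totalSection I s

end TotalTT

/-! ### Equivalence of the tt*-equations on the total space with identities over `M` -/

section TotalTT

variable {E : Type*} [NormedAddCommGroup E] [NormedSpace ℂ E] [FiniteDimensional ℂ E]
  {H : Type*} [TopologicalSpace H] {I : ModelWithCorners ℂ E H} [I.Boundaryless]
  {M : Type*} [TopologicalSpace M] [ChartedSpace H M] [IsManifold I ω M]
  {F : Type*} [NormedAddCommGroup F] [NormedSpace ℂ F] [FiniteDimensional ℂ F]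
  {V : M → Type*} [TopologicalSpace (TotalSpace F V)]
  [∀ x, AddCommGroup (V x)] [∀ x, Module ℂ (V x)] [∀ x, TopologicalSpace (V x)]
  [∀ x, IsTopologicalAddGroup (V x)] [∀ x, ContinuousSMul ℂ (V x)]
  [FiberBundle F V] [VectorBundle ℂ F V] [ContMDiffVectorBundle ω F V I]
  {D : CovariantDerivative I F V}
  {mulM : ∀ x : M, TangentSpace I x → TangentSpace I x → TangentSpace I x}
  {eM : ∀ x : M, TangentSpace I x}
  {gM : ∀ x : M, TangentSpace I x → TangentSpace I x → ℂ}
  {kM : ∀ x : M, TangentSpace I x → TangentSpace I x}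
  {mulV : ∀ x, V x → V x → V x} {eV : ∀ x, V x} {gV : ∀ x, V x → V x → ℂ}
  {kV : ∀ x, V x → V x} {α : ∀ x, V x → TangentSpace I x}

variable (hM : IsHolMultiplication I E mulM eM) (hV : IsHolMultiplication I F mulV eV)
  (hα : IsAlgebraMorphism I F mulM eM mulV eV α) (hD : IsHolConnection D)
  (hkM : IsCompatibleRealStructure I E gM kM) (hkV : IsCompatibleRealStructure I F gV kV)
  (hk : ∀ x a, α x (kV x a) = kM x (α x a))
  (hF : IsHolMultiplication (I.prod 𝓘(ℂ, F)) (E × F) (totalMul D mulM mulV α)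
    (totalSection (F := F) I eV))
include hM hV hα hD hkM hkV hk hF

/-- Every holomorphic field is locally a combination of lifts with holomorphic coefficients
(`total_induction`), and the expression is tensorial in each slot. -/
theorem ttFirst_total_of_lifts (u : TotalSpace F V)
    (h : ∀ W₁ W₂ W₃ : ∀ u : TotalSpace F V, TangentSpace (I.prod 𝓘(ℂ, F)) u,
      IsLiftAt D u W₁ → IsLiftAt D u W₂ → IsLiftAt D u W₃ →
      ttFirst (I.prod 𝓘(ℂ, F)) (totalMul D mulM mulV α) (totalReal D kM kV) W₁ W₂ W₃ u = 0)
    {W₁ W₂ W₃ : ∀ u : TotalSpace F V, TangentSpace (I.prod 𝓘(ℂ, F)) u}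
    (h₁ : HolAt (I.prod 𝓘(ℂ, F)) (E × F) W₁ u) (h₂ : HolAt (I.prod 𝓘(ℂ, F)) (E × F) W₂ u)
    (h₃ : HolAt (I.prod 𝓘(ℂ, F)) (E × F) W₃ u) :
    ttFirst (I.prod 𝓘(ℂ, F)) (totalMul D mulM mulV α) (totalReal D kM kV) W₁ W₂ W₃ u = 0 := by
  have hK := isCompatibleRealStructure_totalReal hD hkM hkV hk
  have hlift : ∀ {W : ∀ u : TotalSpace F V, TangentSpace (I.prod 𝓘(ℂ, F)) u}, IsLiftAt D u W →
      HolAt (I.prod 𝓘(ℂ, F)) (E × F) W u := by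
    rintro W (⟨X, hX, rfl⟩ | ⟨s, hs, rfl⟩)
    · exact holAt_horField hD hX
    · exact holAt_totalSection hs
  have step1 : ∀ W₁ W₂ W₃ : ∀ u : TotalSpace F V, TangentSpace (I.prod 𝓘(ℂ, F)) u,
      IsLiftAt D u W₁ → IsLiftAt D u W₂ → HolAt (I.prod 𝓘(ℂ, F)) (E × F) W₃ u →
      ttFirst (I.prod 𝓘(ℂ, F)) (totalMul D mulM mulV α) (totalReal D kM kV) W₁ W₂ W₃ u = 0 := by
    intro W₁ W₂ W₃ h₁ h₂ h₃
    refine total_induction hD u (fun W => ttFirst (I.prod 𝓘(ℂ, F)) (totalMul D mulM mulV α)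
      (totalReal D kM kV) W₁ W₂ W u = 0) ?_ ?_ ?_ ?_ ?_ h₃
    · intro W W' hW h0
      rw [← h0]
      exact ttFirst_congr (.of_forall fun _ => rfl) (.of_forall fun _ => rfl)
        (hW.mono fun z hz => hz.symm)
    · intro W W' hW hW' h0 h0'
      rw [ttFirst_add hF hK (hlift h₁) (hlift h₂) hW hW', h0, h0', add_zero]
    · intro f W hf hW h0
      rw [ttFirst_smul hF hK hf (hlift h₁) (hlift h₂) hW, h0, smul_zero]
    · exact fun X hX => h _ _ _ h₁ h₂ (.inl ⟨X, hX, rfl⟩)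
    · exact fun s hs => h _ _ _ h₁ h₂ (.inr ⟨s, hs, rfl⟩)
  have step2 : ∀ W₁ W₂ W₃ : ∀ u : TotalSpace F V, TangentSpace (I.prod 𝓘(ℂ, F)) u,
      HolAt (I.prod 𝓘(ℂ, F)) (E × F) W₁ u → HolAt (I.prod 𝓘(ℂ, F)) (E × F) W₃ u →
      (∀ W, IsLiftAt D u W → ttFirst (I.prod 𝓘(ℂ, F)) (totalMul D mulM mulV α)
        (totalReal D kM kV) W W₂ W₃ u = 0) →
      ttFirst (I.prod 𝓘(ℂ, F)) (totalMul D mulM mulV α) (totalReal D kM kV) W₁ W₂ W₃ u = 0 := by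
    intro W₁ W₂ W₃ h₁ h₃ h
    refine total_induction hD u (fun W => ttFirst (I.prod 𝓘(ℂ, F)) (totalMul D mulM mulV α)
      (totalReal D kM kV) W W₂ W₃ u = 0) ?_ ?_ ?_ ?_ ?_ h₁
    · intro W W' hW h0
      rw [← h0]
      exact ttFirst_congr (hW.mono fun z hz => hz.symm) (.of_forall fun _ => rfl)
        (.of_forall fun _ => rfl)
    · intro W W' hW hW' h0 h0'
      rw [ttFirst_add_left hF hK hW hW' h₃, h0, h0', add_zero]
    · intro f W hf hW h0
      rw [ttFirst_smul_left hF hK hf hW h₃, h0, smul_zero]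
    · exact fun X hX => h _ (.inl ⟨X, hX, rfl⟩)
    · exact fun s hs => h _ (.inr ⟨s, hs, rfl⟩)
  refine step2 _ _ _ h₁ h₃ fun W hW => ?_
  -- After the first slot is reduced to a lift, antisymmetry brings the second slot into first
  -- position, so `step2` handles both.
  rw [ttFirst_swap hF, neg_eq_zero]
  exact step2 _ _ _ h₂ h₃ fun W' hW' => step1 _ _ _ hW' hW h₃

theorem ttSecond_total_of_lifts (u : TotalSpace F V) (b : TangentSpace (I.prod 𝓘(ℂ, F)) u)
    (h : ∀ W₁ W₂ : ∀ u : TotalSpace F V, TangentSpace (I.prod 𝓘(ℂ, F)) u,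
      IsLiftAt D u W₁ → IsLiftAt D u W₂ →
      ttSecond (I.prod 𝓘(ℂ, F)) (totalMul D mulM mulV α) (totalReal D kM kV) W₁ W₂ u b = 0)
    {W₁ W₂ : ∀ u : TotalSpace F V, TangentSpace (I.prod 𝓘(ℂ, F)) u}
    (h₁ : HolAt (I.prod 𝓘(ℂ, F)) (E × F) W₁ u) (h₂ : HolAt (I.prod 𝓘(ℂ, F)) (E × F) W₂ u) :
    ttSecond (I.prod 𝓘(ℂ, F)) (totalMul D mulM mulV α) (totalReal D kM kV) W₁ W₂ u b = 0 := by
  have hK := isCompatibleRealStructure_totalReal hD hkM hkV hk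
  have hlift : ∀ {W : ∀ u : TotalSpace F V, TangentSpace (I.prod 𝓘(ℂ, F)) u}, IsLiftAt D u W →
      HolAt (I.prod 𝓘(ℂ, F)) (E × F) W u := by
    rintro W (⟨X, hX, rfl⟩ | ⟨s, hs, rfl⟩)
    · exact holAt_horField hD hX
    · exact holAt_totalSection hs
  have step : ∀ W₁ W₂ : ∀ u : TotalSpace F V, TangentSpace (I.prod 𝓘(ℂ, F)) u,
      IsLiftAt D u W₁ → HolAt (I.prod 𝓘(ℂ, F)) (E × F) W₂ u →
      ttSecond (I.prod 𝓘(ℂ, F)) (totalMul D mulM mulV α) (totalReal D kM kV) W₁ W₂ u b = 0 := by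
    intro W₁ W₂ h₁ h₂
    refine total_induction hD u (fun W => ttSecond (I.prod 𝓘(ℂ, F)) (totalMul D mulM mulV α)
      (totalReal D kM kV) W₁ W u b = 0) ?_ ?_ ?_ ?_ ?_ h₂
    · intro W W' hW h0
      rw [← h0]
      exact ttSecond_congr (.of_forall fun _ => rfl) (hW.mono fun z hz => hz.symm) b
    · intro W W' hW hW' h0 h0'
      rw [ttSecond_add hF hK (hlift h₁) hW hW', h0, h0', add_zero]
    · intro f W hf hW h0
      rw [ttSecond_smul hF hK hf (hlift h₁) hW, h0, smul_zero]
    · exact fun X hX => h _ _ h₁ (.inl ⟨X, hX, rfl⟩)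
    · exact fun s hs => h _ _ h₁ (.inr ⟨s, hs, rfl⟩)
  refine total_induction hD u (fun W => ttSecond (I.prod 𝓘(ℂ, F)) (totalMul D mulM mulV α)
      (totalReal D kM kV) W W₂ u b = 0) ?_ ?_ ?_ ?_ ?_ h₁
  · intro W W' hW h0
    rw [← h0]
    exact ttSecond_congr (hW.mono fun z hz => hz.symm) (.of_forall fun _ => rfl) b
  · intro W W' hW hW' h0 h0'
    rw [ttSecond_add_left hF hK hW hW' h₂, h0, h0', add_zero]
  · intro f W hf hW h0
    rw [ttSecond_smul_left hF hK hf hW h₂, h0, smul_zero]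
  · exact fun X hX => step _ _ (.inl ⟨X, hX, rfl⟩) h₂
  · exact fun s hs => step _ _ (.inr ⟨s, hs, rfl⟩) h₂

omit hM hV hα hD hkM hkV hk hF in
theorem horLift_eq_zero {u : TotalSpace F V} {X : TangentSpace I u.proj}
    (h : horLift D u X = 0) : X = 0 := by
  rw [← horPart_horLift D u X, h]
  exact map_zero _

omit hM hV hα hD hkM hkV hk hF in
theorem vertLift_eq_zero {u : TotalSpace F V} {w : V u.proj}
    (h : vertLift I u w = 0) : w = 0 := by
  have hu := mem_baseSet_trivializationAt' (F := F) (E := V) u.proj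
  have h1 := realDeriv_vertLift (I := I) hu w
  rw [h, ← vertLift_zero (I := I) u, realDeriv_vertLift hu] at h1
  exact (fibreCoord_injective hu h1).symm

/-- The first equation on the total space. -/
theorem ttFirst_total_iff
    (hflat : ∀ (u : TotalSpace F V) (X Y : ∀ x : M, TangentSpace I x), HolAt I E X u.proj →
      HolAt I E Y u.proj →
      VectorField.mlieBracket (I.prod 𝓘(ℂ, F)) (horField D X) (horField D Y) u
        = horLift D u (VectorField.mlieBracket I X Y u.proj)) :
    (∀ (u : TotalSpace F V) (W₁ W₂ W₃ : ∀ u : TotalSpace F V, TangentSpace (I.prod 𝓘(ℂ, F)) u),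
      HolAt (I.prod 𝓘(ℂ, F)) (E × F) W₁ u → HolAt (I.prod 𝓘(ℂ, F)) (E × F) W₂ u →
      HolAt (I.prod 𝓘(ℂ, F)) (E × F) W₃ u →
      ttFirst (I.prod 𝓘(ℂ, F)) (totalMul D mulM mulV α) (totalReal D kM kV) W₁ W₂ W₃ u = 0) ↔
    (∀ (x : M) (Z₁ Z₂ S : ∀ x : M, TangentSpace I x), HolAt I E Z₁ x → HolAt I E Z₂ x →
      HolAt I E S x → ttFirst I mulM kM Z₁ Z₂ S x = 0) ∧
    (∀ (x : M) (X Z : ∀ x : M, TangentSpace I x) (s : ∀ x, V x), HolAt I E X x → HolAt I E Z x →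
      HolAt I F s x → nabla I E kM (fun y => mulM y (α y (s y)) (Z y)) x (X x)
        = mulM x (α x (s x)) (nabla I E kM Z x (X x)) + mulM x (α x (D s x (X x))) (Z x)) ∧
    (∀ (x : M) (X : ∀ x : M, TangentSpace I x) (s t : ∀ x, V x), HolAt I E X x → HolAt I F s x →
      HolAt I F t x → nabla I F kV (fun y => mulV y (s y) (t y)) x (X x)
        = mulV x (s x) (nabla I F kV t x (X x)) + mulV x (D s x (X x)) (t x)) := by
  constructor
  · intro h
    refine ⟨fun x Z₁ Z₂ S h₁ h₂ h₃ => ?_, fun x X Z s hX hZ hs => ?_, fun x X s t hX hs ht => ?_⟩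
    -- The identities depend on the base point alone, so any vector over `x` may be used; the zero
    -- vector is taken.
    · let u : TotalSpace F V := TotalSpace.mk' F x 0
      have := h u _ _ _ (holAt_horField hD h₁) (holAt_horField hD h₂) (holAt_horField hD h₃)
      rw [ttFirst_hhh hM hV hα hD hkM hkV hk h₁ h₂ h₃ (hflat u _ _ h₁ h₂)] at this
      exact horLift_eq_zero this
    · let u : TotalSpace F V := TotalSpace.mk' F x 0
      have := h u _ _ _ (holAt_horField hD hX) (holAt_totalSection hs) (holAt_horField hD hZ)
      rw [ttFirst_hvh hM hV hα hD hkM hkV hk hX hZ hs] at this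
      have := horLift_eq_zero this
      rw [add_assoc, neg_add_eq_zero] at this
      exact this
    · let u : TotalSpace F V := TotalSpace.mk' F x 0
      have := h u _ _ _ (holAt_horField hD hX) (holAt_totalSection hs) (holAt_totalSection ht)
      rw [ttFirst_hvv hM hV hα hD hkM hkV hk hX ht hs] at this
      have := vertLift_eq_zero this
      rw [add_assoc, neg_add_eq_zero] at this
      exact this
  · rintro ⟨h1, h2, h3⟩ u W₁ W₂ W₃ h₁ h₂ h₃
    have hvh : ∀ (X Z : ∀ x : M, TangentSpace I x) (s : ∀ x, V x), HolAt I E X u.proj →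
        HolAt I E Z u.proj → HolAt I F s u.proj → ttFirst (I.prod 𝓘(ℂ, F))
        (totalMul D mulM mulV α) (totalReal D kM kV) (horField D X) (totalSection I s)
        (horField D Z) u = 0 := by
      intro X Z s hX hZ hs
      rw [ttFirst_hvh hM hV hα hD hkM hkV hk hX hZ hs, h2 _ X Z s hX hZ hs, add_assoc,
        neg_add_cancel, horLift_zero]
    have hvv : ∀ (X : ∀ x : M, TangentSpace I x) (s t : ∀ x, V x), HolAt I E X u.proj →
        HolAt I F s u.proj → HolAt I F t u.proj → ttFirst (I.prod 𝓘(ℂ, F))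
        (totalMul D mulM mulV α) (totalReal D kM kV) (horField D X) (totalSection I s)
        (totalSection I t) u = 0 := by
      intro X s t hX hs ht
      rw [ttFirst_hvv hM hV hα hD hkM hkV hk hX ht hs, h3 _ X s t hX hs ht, add_assoc,
        neg_add_cancel, vertLift_zero]
    refine ttFirst_total_of_lifts hM hV hα hD hkM hkV hk hF u ?_ h₁ h₂ h₃
    -- Of the eight cases, two horizontal directions with a vertical third field are the equation of
    -- `M` at `α r`, two cases follow by antisymmetry, and two vertical directions contribute zero.
    rintro W₁ W₂ W₃ (⟨X, hX, rfl⟩ | ⟨s, hs, rfl⟩) (⟨Y, hY, rfl⟩ | ⟨t, ht, rfl⟩)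
      (⟨Z, hZ, rfl⟩ | ⟨r, hr, rfl⟩)
    · rw [ttFirst_hhh hM hV hα hD hkM hkV hk hX hY hZ (hflat u _ _ hX hY),
        h1 _ _ _ _ hX hY hZ, horLift_zero]
    · rw [ttFirst_hhv hM hV hα hD hkM hkV hk hX hY hr (hflat u _ _ hX hY),
        h1 _ _ _ _ hX hY (hα.holAt hr), horLift_zero]
    · exact hvh _ _ _ hX hZ ht
    · exact hvv _ _ _ hX ht hr
    · rw [ttFirst_swap hF, hvh _ _ _ hY hZ hs, neg_zero]
    · rw [ttFirst_swap hF, hvv _ _ _ hY hs hr, neg_zero]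
    · exact ttFirst_vvh hM hV hα hD hkM hkV hk hZ ht hs
    · exact ttFirst_vvv hM hV hα hD hkM hkV hk hr ht hs

-- Conjugating the commutator `[A, k B k]` by `k` gives `-[B, k A k]`. Vanishing for a pair of
-- multipliers therefore implies vanishing for the exchanged pair.
omit hV hα hD hkV hk hF in
theorem higgsBracket_conj (x : M) (a b c : TangentSpace I x) :
    higgsBracket (mulM x) (kM x) a b c = - kM x (higgsBracket (mulM x) (kM x) b a (kM x c)) := by
  simp only [higgsBracket, hkM.map_sub, hkM.involutive, neg_sub]

omit hV hα hD hkV hk hF in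
theorem higgsBracket_add_right (x : M) (a b b' c : TangentSpace I x) :
    higgsBracket (mulM x) (kM x) a (b + b') c
      = higgsBracket (mulM x) (kM x) a b c + higgsBracket (mulM x) (kM x) a b' c := by
  simp only [higgsBracket, hkM.add, hM.add_mul, hM.mul_add]
  abel

omit hV hα hD hkV hk hF in
theorem higgsBracket_zero_left (x : M) (b c : TangentSpace I x) :
    higgsBracket (mulM x) (kM x) 0 b c = 0 := by
  simp only [higgsBracket, hkM.map_zero, hM.zero_mul, hM.mul_zero, sub_zero]

omit hM hα hD hkM hk hF in
theorem higgsBracket_zero (x : M) (b c : V x) :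
    higgsBracket (mulV x) (kV x) 0 b c = 0 ∧ higgsBracket (mulV x) (kV x) b 0 c = 0 := by
  simp only [higgsBracket, hkV.map_zero, hV.zero_mul, hV.mul_zero, sub_zero, and_self]

/-- The second equation on the total space. -/
theorem ttSecond_total_iff :
    (∀ (u : TotalSpace F V) (W₁ W₂ : ∀ u : TotalSpace F V, TangentSpace (I.prod 𝓘(ℂ, F)) u),
      HolAt (I.prod 𝓘(ℂ, F)) (E × F) W₁ u → HolAt (I.prod 𝓘(ℂ, F)) (E × F) W₂ u → ∀ b,
      ttSecond (I.prod 𝓘(ℂ, F)) (totalMul D mulM mulV α) (totalReal D kM kV) W₁ W₂ u b = 0) ↔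
    (∀ (x : M) (Z S : ∀ x : M, TangentSpace I x), HolAt I E Z x → HolAt I E S x → ∀ b,
      ttSecond I mulM kM Z S x b = 0) ∧
    (∀ (x : M) (X : ∀ x : M, TangentSpace I x) (s : ∀ x, V x), HolAt I E X x → HolAt I F s x →
      ∀ Y, nablaCurvature I F kV X s x Y = 0) ∧
    (∀ x a (b : V x) c, higgsBracket (mulM x) (kM x) a (α x b) c = 0) ∧
    (∀ x a b c, higgsBracket (mulV x) (kV x) a b c = 0) := by
  have hh : ∀ (X : ∀ x : M, TangentSpace I x) (z : TotalSpace F V),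
      horPart I z (horField D X z) = X z.proj := fun X z => horPart_horLift D z (X z.proj)
  have hv : ∀ (s : ∀ x, V x) (z : TotalSpace F V), horPart I z (totalSection I s z)
      = (fun _ => 0 : ∀ x : M, TangentSpace I x) z.proj :=
    fun s z => horPart_vertLift (I := I) z (s z.proj)
  have hZM := higgsBracket_zero_left hM hkM
  have hZV := higgsBracket_zero hV hkV
  constructor
  · intro h
    refine ⟨fun x Z S hZ hS b => ?_, fun x X s hX hs Y => ?_, fun x a b c => ?_,
      fun x a b c => ?_⟩
    · let u : TotalSpace F V := TotalSpace.mk' F x 0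
      have := h u _ _ (holAt_horField hD hZ) (holAt_horField hD hS) (horLift D u b)
      rw [ttSecond_h (u := u) hM hV hα hD hkM hkV hk (hh Z) hZ hS] at this
      have := horLift_eq_zero this
      simp only [horField, vertPart_horLift, horPart_horLift, hα.map_zero, add_zero] at this
      exact this
    · let u : TotalSpace F V := TotalSpace.mk' F x 0
      have := h u _ _ (holAt_horField hD hX) (holAt_totalSection hs) (horLift D u Y)
      rw [ttSecond_v (u := u) hM hV hα hD hkM hkV hk (hh X) hX hs] at this
      have := congrArg (vertPart D u) this
      rw [vertPart_add, vertPart_horLift, vertPart_vertLift, zero_add] at this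
      simp only [horField, vertPart_horLift, horPart_horLift, (hZV _ _ _).1, add_zero] at this
      rw [this, ← horLift_zero (D := D) u, vertPart_horLift]
    · let u : TotalSpace F V := TotalSpace.mk' F x 0
      let X : ∀ y : M, TangentSpace I y := extend E (E := (TangentSpace I : M → Type _)) a
      have hXa : X x = a := extend_apply_self (F := E) (E := (TangentSpace I : M → Type _)) a
      have hX : HolAt I E X x := holAt_extend a
      let Z : ∀ y : M, TangentSpace I y := extend E (E := (TangentSpace I : M → Type _)) c
      have hZc : Z x = c := extend_apply_self (F := E) (E := (TangentSpace I : M → Type _)) c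
      have hZ : HolAt I E Z x := holAt_extend c
      -- A vertical `b` has zero projection, which removes the curvature and isolates the mixed
      -- commutator.
      have := h u _ _ (holAt_horField hD hX) (holAt_horField hD hZ) (vertLift I u b)
      rw [ttSecond_h (u := u) hM hV hα hD hkM hkV hk (hh X) hX hZ] at this
      have := horLift_eq_zero this
      simp only [horField, vertPart_horLift, horPart_vertLift, vertPart_vertLift,
        hα.map_zero, add_zero, zero_add] at this
      rw [← hXa, ← hZc, ← this]
      have h0 : nablaCurvature I E kM X Z x 0 = 0 := by
        rw [nablaCurvature, ← zero_smul ℂ (0 : TangentSpace I x), delbarSection_smul_vec]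
        simp
      have h1 : higgsBracket (mulM x) (kM x) (X x) (α x b) (Z x)
        = nablaCurvature I E kM X Z x 0
          + higgsBracket (mulM x) (kM x) (X x) (α x b) (Z x) := by rw [h0, zero_add]
      exact h1
    · let u : TotalSpace F V := TotalSpace.mk' F x 0
      have hs : HolAt I F (extend F a) x := holAt_extend a
      have ht : HolAt I F (extend F c) x := holAt_extend c
      -- With all three arguments vertical, the vertical component is the commutator on `V`.
      have := h u _ _ (holAt_totalSection hs) (holAt_totalSection ht) (vertLift I u b)
      rw [ttSecond_v (u := u) hM hV hα hD hkM hkV hk (hv _) (HolAt.zero x) ht] at this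
      have := congrArg (vertPart D u) this
      rw [vertPart_add, vertPart_horLift, vertPart_vertLift, zero_add,
        nablaCurvature_zero_left hkV, zero_add] at this
      simp only [totalSection, vertPart_vertLift] at this
      have h0 : vertPart D u 0 = 0 := by rw [← horLift_zero (D := D) u, vertPart_horLift]
      rw [h0] at this
      simpa [u] using this
  · rintro ⟨h1, h2, h3, h4⟩ u W₁ W₂ h₁ h₂ b
    have h3' : ∀ x (a : V x) b c, higgsBracket (mulM x) (kM x) (α x a) b c = 0 := by
      intro x a b c
      rw [higgsBracket_conj hM hkM, h3, hkM.map_zero, neg_zero]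
    refine ttSecond_total_of_lifts hM hV hα hD hkM hkV hk hF u b ?_ h₁ h₂
    -- Since `α` carries the zero curvature of `V` to the curvature of `M` on `α s`, the equation of
    -- `M` at `α s` reduces to its commutator. This is the horizontal component still required in
    -- the mixed case.
    have hE : ∀ (X : ∀ x : M, TangentSpace I x) (s : ∀ x, V x), HolAt I E X u.proj →
        HolAt I F s u.proj → ∀ Y, higgsBracket (mulM u.proj) (kM u.proj) (X u.proj) Y
        (α u.proj (s u.proj)) = 0 := by
      intro X s hX hs Y
      have := h1 _ X _ hX (hα.holAt hs) Y
      rw [ttSecond, alpha_nablaCurvature hα hkV hk hs hX, h2 _ _ _ hX hs, hα.map_zero,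
        zero_add] at this
      exact this
    rintro W₁ W₂ (⟨X, hX, rfl⟩ | ⟨s, hs, rfl⟩) (⟨Y, hY, rfl⟩ | ⟨t, ht, rfl⟩)
    · rw [ttSecond_h (u := u) hM hV hα hD hkM hkV hk (hh X) hX hY]
      simp only [horField, vertPart_horLift, hα.map_zero, add_zero,
        higgsBracket_add_right hM hkM, h3]
      exact (congrArg _ (h1 _ X Y hX hY _)).trans (horLift_zero u)
    · rw [ttSecond_v (u := u) hM hV hα hD hkM hkV hk (hh X) hX ht, h2 _ _ _ hX ht]
      simp only [horField, vertPart_horLift, hα.map_zero, add_zero, hZM, hZV, hE X t hX ht,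
        horLift_zero, vertLift_zero]
    · rw [ttSecond_h (u := u) hM hV hα hD hkM hkV hk (hv s) (HolAt.zero _) hY]
      simp only [nablaCurvature_zero_left hkM, totalSection, vertPart_vertLift, h3', zero_add,
        horLift_zero]
    · rw [ttSecond_v (u := u) hM hV hα hD hkM hkV hk (hv s) (HolAt.zero _) ht]
      simp only [nablaCurvature_zero_left hkV, totalSection, vertPart_vertLift, h3', hZM, h4,
        add_zero, horLift_zero, vertLift_zero]

end TotalTT

/-! ### Parallel sections of a flat analytic connection form near the origin -/

section Radial

variable {E : Type*} [NormedAddCommGroup E] [NormedSpace ℂ E]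
  {F : Type*} [NormedAddCommGroup F] [NormedSpace ℂ F] [CompleteSpace F]
  {P Q R : Type*} [NormedAddCommGroup P] [NormedSpace ℂ P] [NormedAddCommGroup Q]
  [NormedSpace ℂ Q] [NormedAddCommGroup R] [NormedSpace ℂ R]

/-- A bilinear map applied pointwise to paths. -/
def pathBilin (b : P →L[ℂ] Q →L[ℂ] R) :
    C(unitInterval, P) →L[ℂ] C(unitInterval, Q) →L[ℂ] C(unitInterval, R) :=
  LinearMap.mkContinuous₂
    (LinearMap.mk₂ ℂ (fun f g => (⟨fun t => b (f t) (g t), by fun_prop⟩ : C(unitInterval, R)))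
      (fun f f' g => by ext t; simp) (fun c f g => by ext t; simp)
      (fun f g g' => by ext t; simp) (fun c f g => by ext t; simp)) ‖b‖ fun f g => by
    refine (ContinuousMap.norm_le _ (by positivity)).2 fun t => ?_
    exact (b.le_opNorm₂ _ _).trans (by gcongr <;> exact ContinuousMap.norm_coe_le_norm _ t)

theorem pathBilin_apply (b : P →L[ℂ] Q →L[ℂ] R) (f : C(unitInterval, P)) (g : C(unitInterval, Q))
    (t : unitInterval) : pathBilin b f g t = b (f t) (g t) := rfl

/-- The path extended to the real line by constants. -/
def extendPath (f : C(unitInterval, F)) (τ : ℝ) : F := f (projIcc 0 1 zero_le_one τ)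

theorem continuous_extendPath (f : C(unitInterval, F)) : Continuous (extendPath f) :=
  f.continuous.comp continuous_projIcc

theorem norm_extendPath_le (f : C(unitInterval, F)) (τ : ℝ) : ‖extendPath f τ‖ ≤ ‖f‖ :=
  f.norm_coe_le_norm _

/-- The primitive of a path vanishing at `0`. -/
def pathPrimitive : C(unitInterval, F) →L[ℂ] C(unitInterval, F) :=
  LinearMap.mkContinuous
    { toFun := fun f => ⟨fun t => ∫ τ in (0 : ℝ)..t, extendPath f τ,
        (intervalIntegral.continuous_primitive
          (fun a b => (continuous_extendPath f).intervalIntegrable a b) 0).comp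
          continuous_subtype_val⟩
      map_add' := fun f g => by
        ext t
        exact intervalIntegral.integral_add ((continuous_extendPath f).intervalIntegrable _ _)
          ((continuous_extendPath g).intervalIntegrable _ _)
      map_smul' := fun c f => by
        ext t
        exact intervalIntegral.integral_smul c _ } 1 fun f => by
    rw [one_mul]
    refine (ContinuousMap.norm_le _ (norm_nonneg f)).2 fun t => ?_
    have h := intervalIntegral.norm_integral_le_of_norm_le_const (a := (0 : ℝ)) (b := t)
      (f := extendPath f) (C := ‖f‖) fun τ _ => norm_extendPath_le f τ
    refine h.trans (mul_le_of_le_one_right (norm_nonneg f) ?_)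
    rw [sub_zero, abs_of_nonneg t.2.1]
    exact t.2.2

theorem pathPrimitive_apply (f : C(unitInterval, F)) (t : unitInterval) :
    pathPrimitive f t = ∫ τ in (0 : ℝ)..t, extendPath f τ := rfl

theorem norm_pathMonomial_aux (n : ℕ) (v : P) :
    ‖(⟨fun t => ((t : ℝ) : ℂ) ^ n • v, by fun_prop⟩ : C(unitInterval, P))‖ ≤ 1 * ‖v‖ := by
  rw [one_mul]
  refine (ContinuousMap.norm_le _ (norm_nonneg v)).2 fun t => ?_
  have : ‖((t : ℝ) : ℂ) ^ n‖ ≤ 1 := by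
    rw [norm_pow, Complex.norm_real, Real.norm_of_nonneg t.2.1]
    exact pow_le_one₀ t.2.1 t.2.2
  exact (norm_smul_le _ _).trans (mul_le_of_le_one_left (norm_nonneg v) this)

/-- The monomial path `t ↦ t ^ n • v`. -/
def pathMonomial (n : ℕ) : P →L[ℂ] C(unitInterval, P) :=
  LinearMap.mkContinuous
    { toFun := fun v => ⟨fun t => ((t : ℝ) : ℂ) ^ n • v, by fun_prop⟩
      map_add' := fun v w => by ext t; simp
      map_smul' := fun c v => by ext t; exact smul_comm _ _ _ } 1 (norm_pathMonomial_aux n)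

theorem norm_pathMonomial_apply_le (n : ℕ) (v : P) : ‖pathMonomial n v‖ ≤ ‖v‖ :=
  (norm_pathMonomial_aux n v).trans_eq (one_mul _)

theorem pathMonomial_apply (n : ℕ) (v : P) (t : unitInterval) :
    pathMonomial n v t = ((t : ℝ) : ℂ) ^ n • v := rfl

/-- The power series of the restrictions to rays. -/
def raySeries (p : FormalMultilinearSeries ℂ E P) :
    FormalMultilinearSeries ℂ E C(unitInterval, P) :=
  fun n => (pathMonomial n).compContinuousMultilinearMap (p n)

/-- Homogeneity of degree `n` moves the factor `t ^ n` into the argument. -/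
theorem raySeries_apply (p : FormalMultilinearSeries ℂ E P) (n : ℕ) (x : E) (t : unitInterval) :
    raySeries p n (fun _ => x) t = p n fun _ => ((t : ℝ) : ℂ) • x := by
  have h := (p n).map_smul_univ (fun _ => ((t : ℝ) : ℂ)) fun _ => x
  rw [Finset.prod_const, Finset.card_univ, Fintype.card_fin] at h
  exact h.symm

/-- Since `|t ^ n| ≤ 1` on the unit interval, passing to rays does not increase the norms of the
coefficients. -/
theorem radius_le_raySeries (p : FormalMultilinearSeries ℂ E P) :
    p.radius ≤ (raySeries p).radius := by
  have hqn : ∀ n, ‖raySeries p n‖ ≤ ‖p n‖ := fun n =>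
    ContinuousMultilinearMap.opNorm_le_bound (norm_nonneg _) fun m =>
      (norm_pathMonomial_apply_le n (p n m)).trans ((p n).le_opNorm m)
  refine ENNReal.le_of_forall_nnreal_lt fun s hs => ?_
  obtain ⟨C, hC, h⟩ := p.norm_mul_pow_le_of_lt_radius hs
  exact (raySeries p).le_radius_of_bound C fun n =>
    (mul_le_mul_of_nonneg_right (hqn n) (by positivity)).trans (h n)

/-- Restriction of an analytic map to rays is analytic, as a map to the space of paths. -/
theorem exists_analytic_rays [CompleteSpace P] {Γ : E → P} (hΓ : AnalyticAt ℂ Γ 0) :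
    ∃ A : E → C(unitInterval, P), AnalyticAt ℂ A 0 ∧
      ∀ᶠ x in 𝓝 0, ∀ t : unitInterval, A x t = Γ (((t : ℝ) : ℂ) • x) := by
  obtain ⟨p, r, hp⟩ := hΓ
  have hrad := radius_le_raySeries p
  have hq := (raySeries p).hasFPowerSeriesOnBall (hp.r_pos.trans_le (hp.r_le.trans hrad))
  refine ⟨(raySeries p).sum, hq.analyticAt, ?_⟩
  filter_upwards [Metric.eball_mem_nhds (0 : E) hp.r_pos] with x hx t
  have hxq : x ∈ Metric.eball (0 : E) (raySeries p).radius := Metric.eball_subset_eball (hp.r_le.trans hrad) hx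
  have htx : ((t : ℝ) : ℂ) • x ∈ Metric.eball (0 : E) r := by
    rw [Metric.mem_eball, edist_zero_right] at hx ⊢
    refine lt_of_le_of_lt ?_ hx
    rw [enorm_smul]
    refine mul_le_of_le_one_left (by positivity) ?_
    rw [← ofReal_norm, Complex.norm_real, Real.norm_of_nonneg t.2.1]
    exact ENNReal.ofReal_le_one.2 t.2.2
  have h1 : HasSum (fun n => raySeries p n (fun _ => x) t) ((raySeries p).sum (0 + x) t) :=
    ContinuousMap.hasSum_apply (hq.hasSum hxq) t
  have h2 := hp.hasSum htx
  simp only [raySeries_apply] at h1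
  rw [← zero_add x, h1.unique h2, zero_add, zero_add]

/-- Analytic dependence on the parameter of the solution of a linear equation. -/
theorem exists_analytic_solution {G₁ G₂ G E' : Type*} [NormedAddCommGroup G₁] [NormedSpace ℂ G₁]
    [NormedAddCommGroup G₂] [NormedSpace ℂ G₂] [NormedAddCommGroup G] [NormedSpace ℂ G]
    [NormedAddCommGroup E'] [NormedSpace ℂ E'] [CompleteSpace G]
    (B₁ : G₁ →L[ℂ] E' →L[ℂ] G₂) (B₂ : G₂ →L[ℂ] G →L[ℂ] G) (J : G →L[ℂ] G) (L : E →L[ℂ] E')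
    {A : E → G₁} (hA : ContDiffAt ℂ ω A 0) (c : G) :
    ∃ f : E → G, ContDiffAt ℂ ω f 0 ∧
      ∀ᶠ x in 𝓝 0, ∀ g, g + J (B₂ (B₁ (A x) (L x)) g) = c ↔ g = f x := by
  -- The factor `L x` makes `T` vanish at `0`, so `1 + T x` is invertible for small `x`. Inversion
  -- is analytic on the units of a Banach algebra, which gives analytic dependence on `x`.
  let T : E → G →L[ℂ] G := fun x => J ∘L B₂ (B₁ (A x) (L x))
  have hTd : ContDiffAt ℂ ω T 0 := by
    have h1 : ContDiffAt ℂ ω (fun x => B₁ (A x)) 0 := B₁.contDiff.contDiffAt.comp 0 hA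
    have h2 : ContDiffAt ℂ ω (fun x => B₁ (A x) (L x)) 0 := h1.clm_apply L.contDiff.contDiffAt
    have h3 : ContDiffAt ℂ ω (fun x => B₂ (B₁ (A x) (L x))) 0 :=
      B₂.contDiff.contDiffAt.comp 0 h2
    exact contDiffAt_const.clm_comp h3
  have hT0 : T 0 = 0 := by
    ext f
    simp [T]
  have hunit : ∀ᶠ x in 𝓝 0, IsUnit (1 + T x) := by
    have hc : ContinuousAt (fun x => 1 + T x) 0 := continuousAt_const.add hTd.continuousAt
    refine hc.eventually_mem (Units.isOpen.mem_nhds ?_)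
    rw [hT0, add_zero]
    exact isUnit_one
  refine ⟨fun x => Ring.inverse (1 + T x) c, ?_, ?_⟩
  · have h1 : ContDiffAt ℂ ω (fun x => Ring.inverse (1 + T x)) 0 := by
      have h2 : ContDiffAt ℂ ω (Ring.inverse : (G →L[ℂ] G) → _) (1 + T 0) := by
        rw [hT0, add_zero]
        exact contDiffAt_ringInverse ℂ (1 : (G →L[ℂ] G)ˣ)
      exact h2.comp (f := fun x => 1 + T x) 0 (contDiffAt_const.add hTd)
    exact h1.clm_apply contDiffAt_const
  · filter_upwards [hunit] with x hx g
    constructor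
    · rintro rfl
      exact (DFunLike.congr_fun (Ring.inverse_mul_cancel _ hx) g).symm
    · rintro rfl
      exact DFunLike.congr_fun (Ring.mul_inverse_cancel _ hx) c

/-- The radial part of the equation for parallel sections, in integral form. -/
theorem exists_radial_integral [CompleteSpace P] (b₁ : P →L[ℂ] E →L[ℂ] Q)
    (b₂ : Q →L[ℂ] F →L[ℂ] F) {Γ : E → P} (hΓ : AnalyticAt ℂ Γ 0) (a : F) :
    ∃ σ : E → F, ContDiffAt ℂ ω σ 0 ∧ σ 0 = a ∧ ∀ᶠ x in 𝓝 0, ∃ ρ : C(unitInterval, F),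
      ∀ t : unitInterval, ρ t = b₂ (b₁ (Γ (((t : ℝ) : ℂ) • x)) x) (σ (((t : ℝ) : ℂ) • x)) ∧
        σ (((t : ℝ) : ℂ) • x) = a - pathPrimitive ρ t := by
  obtain ⟨A, hA, hAΓ⟩ := exists_analytic_rays hΓ
  -- In the space of paths this is the integral form of `ρ' = -Γ (t x) x ρ`, `ρ 0 = a`, along the
  -- ray through `x`; `pathMonomial 0` makes `x` a constant path.
  obtain ⟨f, hfd, hf⟩ := exists_analytic_solution (pathBilin b₁) (pathBilin b₂) pathPrimitive
    (pathMonomial 0) hA.contDiffAt (ContinuousMap.const unitInterval a)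
  obtain ⟨r, hr, hball⟩ := Metric.eventually_nhds_iff_ball.1 (hAΓ.and hf)
  have hT : ∀ x ∈ Metric.ball (0 : E) r, ∀ (g : C(unitInterval, F)) (t : unitInterval),
      pathPrimitive (pathBilin b₂ (pathBilin b₁ (A x) (pathMonomial 0 x)) g) t
        = ∫ τ in (0 : ℝ)..t, b₂ (b₁ (Γ (((projIcc 0 1 zero_le_one τ : ℝ) : ℂ) • x)) x)
          (g (projIcc 0 1 zero_le_one τ)) := by
    intro x hx g t
    simp only [pathPrimitive_apply, extendPath, pathBilin_apply, pathMonomial_apply, pow_zero,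
      one_smul, (hball x hx).1]
  have hint : ∀ x ∈ Metric.ball (0 : E) r, ∀ t : unitInterval, f x t = a - ∫ τ in (0 : ℝ)..t,
      b₂ (b₁ (Γ (((projIcc 0 1 zero_le_one τ : ℝ) : ℂ) • x)) x)
        (f x (projIcc 0 1 zero_le_one τ)) := by
    intro x hx t
    have h := DFunLike.congr_fun (((hball x hx).2 _).2 rfl) t
    rw [ContinuousMap.add_apply, hT x hx] at h
    exact eq_sub_of_add_eq h
  have hσ : ContDiffAt ℂ ω (fun x => f x 1) 0 :=
    (ContinuousMap.evalCLM ℂ (1 : unitInterval) : C(unitInterval, F) →L[ℂ] F).contDiff.contDiffAt.comp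
      0 hfd
  refine ⟨fun x => f x 1, hσ, ?_, ?_⟩
  · refine (hint 0 (Metric.mem_ball_self hr) 1).trans ?_
    simp
  filter_upwards [Metric.ball_mem_nhds (0 : E) hr] with x hx
  -- The candidate `σ x` is the endpoint `f x 1`. It remains to see that its restriction to a ray is
  -- the whole solution on that ray.
  have hray : ∀ t : unitInterval, f (((t : ℝ) : ℂ) • x) 1 = f x t := fun t => ?_
  · refine ⟨pathBilin b₂ (pathBilin b₁ (A x) (pathMonomial 0 x)) (f x), fun t => ⟨?_, ?_⟩⟩
    · simp only [pathBilin_apply, pathMonomial_apply, pow_zero, one_smul, (hball x hx).1, hray]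
    · rw [hray, hint x hx, hT x hx]
  have htx : ((t : ℝ) : ℂ) • x ∈ Metric.ball (0 : E) r := by
    rw [mem_ball_zero_iff] at hx ⊢
    refine lt_of_le_of_lt ?_ hx
    rw [norm_smul, Complex.norm_real, Real.norm_of_nonneg t.2.1]
    exact mul_le_of_le_one_left (norm_nonneg x) t.2.2
  -- The solution for `x` on `[0, t]`, reparametrized to the unit interval, solves the equation for
  -- `t x` by the substitution `τ ↦ t τ`; uniqueness identifies it with `f (t x)`.
  let g : C(unitInterval, F) := ⟨fun s => f x (t * s), by fun_prop⟩
  have hg : g = f (((t : ℝ) : ℂ) • x) := by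
    refine ((hball _ htx).2 _).1 ?_
    ext s
    rw [ContinuousMap.add_apply, hT _ htx]
    change f x (t * s) + _ = a
    rw [hint x hx (t * s)]
    have h1 := intervalIntegral.smul_integral_comp_mul_left (a := (0 : ℝ)) (b := s)
      (fun τ => b₂ (b₁ (Γ (((projIcc 0 1 zero_le_one τ : ℝ) : ℂ) • x)) x) (f x (projIcc 0 1 zero_le_one τ)))
      (t : ℝ)
    rw [mul_zero] at h1
    rw [Set.Icc.coe_mul, ← h1, ← intervalIntegral.integral_smul, sub_add_eq_add_sub, sub_eq_iff_eq_add]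
    congr 1
    refine intervalIntegral.integral_congr fun τ hτ => ?_
    rw [uIcc_of_le s.2.1] at hτ
    have hτ1 : τ ∈ Icc (0 : ℝ) 1 := ⟨hτ.1, hτ.2.trans s.2.2⟩
    have hτt : (t : ℝ) * τ ∈ Icc (0 : ℝ) 1 := unitInterval.mul_mem t.2 hτ1
    simp only [projIcc_of_mem _ hτ1, projIcc_of_mem _ hτt, map_smul, smul_smul]
    rw [show ((τ : ℂ) * ((t : ℝ) : ℂ)) = (((t : ℝ) * τ : ℝ) : ℂ) by push_cast; ring]
    rfl
  rw [← hg]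
  simp [g]

theorem HasFDerivAt.hasDerivAt_ray {σ : E → F} {x : E} {t : ℝ} {σ' : E →L[ℂ] F}
    (h : HasFDerivAt σ σ' ((t : ℂ) • x)) : HasDerivAt (fun t : ℝ => σ ((t : ℂ) • x)) (σ' x) t := by
  have h1 : HasDerivAt (fun t : ℝ => (t : ℂ) • x) x t := by
    simpa using (HasDerivAt.ofReal_comp (hasDerivAt_id t)).smul_const x
  exact (h.restrictScalars ℝ).comp_hasDerivAt t h1

/-- The radial part of the equation for parallel sections. -/
theorem exists_radial_solution [CompleteSpace P] (b₁ : P →L[ℂ] E →L[ℂ] Q)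
    (b₂ : Q →L[ℂ] F →L[ℂ] F) {Γ : E → P} (hΓ : AnalyticAt ℂ Γ 0) (a : F) :
    ∃ σ : E → F, ContDiffAt ℂ ω σ 0 ∧ σ 0 = a ∧
      ∀ᶠ y in 𝓝 0, fderiv ℂ σ y y + b₂ (b₁ (Γ y) y) (σ y) = 0 := by
  obtain ⟨σ, hσ, h0, h⟩ := exists_radial_integral b₁ b₂ hΓ a
  refine ⟨σ, hσ, h0, ?_⟩
  -- The ray through `2 y` passes `y` at time `1 / 2`, an interior point of the interval, where the
  -- two-sided derivative exists. The resulting factor `2` is cancelled at the end.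
  have h2 : Filter.Tendsto (fun y : E => (2 : ℂ) • y) (𝓝 0) (𝓝 0) := by
    simpa using (continuous_const_smul (2 : ℂ)).tendsto (0 : E)
  filter_upwards [h2.eventually h, (hσ.eventually (by simp)).mono fun y hy =>
    hy.differentiableAt (by simp)] with y ⟨ρ, hρ⟩ hy
  let c : unitInterval := ⟨1 / 2, by norm_num, by norm_num⟩
  have hc : (((1 / 2 : ℝ) : ℝ) : ℂ) • (2 : ℂ) • y = y := by
    rw [smul_smul]; norm_num
  have hd1 : HasDerivAt (fun t : ℝ => σ ((t : ℂ) • (2 : ℂ) • y)) (fderiv ℂ σ y ((2 : ℂ) • y))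
      (1 / 2) := by
    refine HasFDerivAt.hasDerivAt_ray ?_
    rw [hc]
    exact hy.hasFDerivAt
  have hd2 : HasDerivAt (fun t : ℝ => a - ∫ τ in (0 : ℝ)..t, extendPath ρ τ)
      (- extendPath ρ (1 / 2)) (1 / 2) :=
    ((continuous_extendPath ρ).integral_hasStrictDerivAt 0 (1 / 2)).hasDerivAt.const_sub a
  have heq : (fun t : ℝ => σ ((t : ℂ) • (2 : ℂ) • y))
      =ᶠ[𝓝 (1 / 2)] fun t : ℝ => a - ∫ τ in (0 : ℝ)..t, extendPath ρ τ := by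
    filter_upwards [Icc_mem_nhds (by norm_num : (0 : ℝ) < 1 / 2) (by norm_num : (1 / 2 : ℝ) < 1)]
      with t ht
    exact (hρ ⟨t, ht⟩).2
  have hρc : extendPath ρ (1 / 2) = b₂ (b₁ (Γ y) ((2 : ℂ) • y)) (σ y) := by
    have h3 := (hρ c).1
    rw [show ((c : ℝ) : ℂ) • (2 : ℂ) • y = y from hc] at h3
    rw [← h3, extendPath, projIcc_of_mem zero_le_one c.2]
  have h4 := hd1.unique (hd2.congr_of_eventuallyEq heq)
  rw [hρc, map_smul, map_smul, map_smul, smul_apply, ← smul_neg] at h4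
  exact eq_neg_iff_add_eq_zero.1 (smul_right_injective F (two_ne_zero' ℂ) h4)

/-- Parallel sections of a flat holomorphic connection form on a neighbourhood of `0`. -/
theorem exists_parallel_solution [CompleteSpace P] (b₁ : P →L[ℂ] E →L[ℂ] Q)
    (b₂ : Q →L[ℂ] F →L[ℂ] F) {Γ : E → P} (hΓ : AnalyticAt ℂ Γ 0)
    (hflat : ∀ᶠ y in 𝓝 0, ∀ ξ η a, b₂ (b₁ (fderiv ℂ Γ y ξ) η) a - b₂ (b₁ (fderiv ℂ Γ y η) ξ) a
      + b₂ (b₁ (Γ y) ξ) (b₂ (b₁ (Γ y) η) a) - b₂ (b₁ (Γ y) η) (b₂ (b₁ (Γ y) ξ) a) = 0) (a : F) :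
    ∃ σ : E → F, ContDiffAt ℂ ω σ 0 ∧ σ 0 = a ∧
      ∀ᶠ y in 𝓝 0, ∀ ξ, fderiv ℂ σ y ξ + b₂ (b₁ (Γ y) ξ) (σ y) = 0 := by
  obtain ⟨σ, hσ, h0, h⟩ := exists_radial_solution b₁ b₂ hΓ a
  refine ⟨σ, hσ, h0, ?_⟩
  obtain ⟨r, hr, hball⟩ := Metric.eventually_nhds_iff_ball.1
    ((h.and hflat).and ((hσ.eventually (by simp)).and (hΓ.contDiffAt.eventually (n := ω) (by simp))))
  have hΓd : ∀ y ∈ Metric.ball (0 : E) r, HasFDerivAt Γ (fderiv ℂ Γ y) y := fun y hy =>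
    ((hball y hy).2.2.differentiableAt (by simp)).hasFDerivAt
  have hσd : ∀ y ∈ Metric.ball (0 : E) r, HasFDerivAt σ (fderiv ℂ σ y) y := fun y hy =>
    ((hball y hy).2.1.differentiableAt (by simp)).hasFDerivAt
  have hσd2 : ∀ y ∈ Metric.ball (0 : E) r,
      HasFDerivAt (fderiv ℂ σ) (fderiv ℂ (fderiv ℂ σ) y) y := fun y hy =>
    (((hball y hy).2.1.fderiv_right (m := ω) (by simp)).differentiableAt (by simp)).hasFDerivAt
  have hB : ∀ y ∈ Metric.ball (0 : E) r, ∀ ξ : E, HasFDerivAt (fun z => b₂ (b₁ (Γ z) ξ))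
      (b₂ ∘L b₁.flip ξ ∘L fderiv ℂ Γ y) y := fun y hy ξ =>
    (b₂ ∘L b₁.flip ξ).hasFDerivAt.comp y (hΓd y hy)
  -- The failure of `σ` to be parallel in direction `ξ`. Flatness yields a linear differential
  -- equation for it along rays.
  let q : E → E → F := fun ξ y => fderiv ℂ σ y ξ + b₂ (b₁ (Γ y) ξ) (σ y)
  have hq : ∀ y ∈ Metric.ball (0 : E) r, ∀ ξ, ∃ q' : E →L[ℂ] F, HasFDerivAt (q ξ) q' y ∧
      q' y = - q ξ y - b₂ (b₁ (Γ y) y) (q ξ y) := by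
    intro y hy ξ
    have h1 := ((hσd2 y hy).clm_apply (hasFDerivAt_const ξ y)).add
      ((hB y hy ξ).clm_apply (hσd y hy))
    refine ⟨_, h1, ?_⟩
    have hΓy : HasFDerivAt (fun z => b₂ (b₁ (Γ z) z)) _ y :=
      b₂.hasFDerivAt.comp y ((b₁.hasFDerivAt.comp y (hΓd y hy)).clm_apply (hasFDerivAt_id y))
    -- The radial equation holds on the whole ball, so it may be differentiated in direction `ξ`.
    have h2 := ((hσd2 y hy).clm_apply (hasFDerivAt_id y)).add (hΓy.clm_apply (hσd y hy))
    have hR : (fun z => fderiv ℂ σ z z + b₂ (b₁ (Γ z) z) (σ z)) =ᶠ[𝓝 y] fun _ => 0 := by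
      filter_upwards [Metric.isOpen_ball.mem_nhds hy] with z hz
      exact (hball z hz).1.1
    have h3 := DFunLike.congr_fun (h2.unique ((hasFDerivAt_const (0 : F) y).congr_of_eventuallyEq hR)) ξ
    -- Symmetry of the second derivative of `σ` and flatness at the pair `ξ`, `y` turn the
    -- differentiated radial equation into the derivative of `q ξ` along `y`.
    have hsymm := (hball y hy).2.1.isSymmSndFDerivAt (by simp) ξ y
    have hrad := (hball y hy).1.1
    have hfl := (hball y hy).1.2 ξ y (σ y)
    simp [q] at h3 hfl ⊢
    rw [hsymm] at h3
    rw [eq_neg_of_add_eq_zero_left hrad, map_neg]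
    linear_combination (norm := module) h3 - hfl
  have hKx : ∀ x ∈ Metric.ball (0 : E) r, ∀ t ∈ Icc (0 : ℝ) 1,
      (t : ℂ) • x ∈ Metric.ball (0 : E) r := by
    intro x hx t ht
    rw [mem_ball_zero_iff] at hx ⊢
    refine lt_of_le_of_lt ?_ hx
    rw [norm_smul, Complex.norm_real, Real.norm_of_nonneg ht.1]
    exact mul_le_of_le_one_left (norm_nonneg x) ht.2
  filter_upwards [Metric.ball_mem_nhds (0 : E) hr] with x hx ξ
  have hB' : ContinuousOn (fun t : ℝ => b₂ (b₁ (Γ ((t : ℂ) • x)) x)) (Icc 0 1) := fun t ht =>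
    (HasDerivAt.continuousAt (HasFDerivAt.hasDerivAt_ray
      (hB _ (hKx x hx t ht) x))).continuousWithinAt
  obtain ⟨K, hK⟩ := isCompact_Icc.exists_bound_of_continuousOn hB'
  -- The factor `t` absorbs the term `-q ξ` of the equation, leaving `N' = -Γ (t x) x N` with `N 0 =
  -- 0`. Grönwall's inequality gives `N = 0`, and `N 1 = q ξ x`.
  let N : ℝ → F := fun t => (t : ℂ) • q ξ ((t : ℂ) • x)
  have hN : ∀ t ∈ Icc (0 : ℝ) 1, HasDerivAt N (- b₂ (b₁ (Γ ((t : ℂ) • x)) x) (N t)) t := by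
    intro t ht
    obtain ⟨q', h1, h2⟩ := hq _ (hKx x hx t ht) ξ
    have h3 := (HasDerivAt.ofReal_comp (hasDerivAt_id t)).smul (HasFDerivAt.hasDerivAt_ray h1)
    have h4 : ((id t : ℝ) : ℂ) • q' x + ((1 : ℝ) : ℂ) • q ξ ((t : ℂ) • x)
        = - b₂ (b₁ (Γ ((t : ℂ) • x)) x) (N t) := by
      simp only [map_smul, smul_apply] at h2
      simp only [N, map_smul, id, h2, Complex.ofReal_one, one_smul]
      abel
    rw [h4] at h3
    exact h3
  have hgr := norm_le_gronwallBound_of_norm_deriv_right_le (f := N) (δ := 0) (K := K) (ε := 0)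
    (fun t ht => (hN t ht).continuousAt.continuousWithinAt)
    (fun t ht => (hN t (Ico_subset_Icc_self ht)).hasDerivWithinAt) (by simp [N])
    (fun t ht => by
      rw [norm_neg, add_zero]
      exact ContinuousLinearMap.le_of_opNorm_le _ (hK t (Ico_subset_Icc_self ht)) _) 1
    (right_mem_Icc.2 zero_le_one)
  rw [gronwallBound_ε0_δ0] at hgr
  simpa [N, q] using hgr

end Radial

/-! ### Flatness of `D` and the derivation property from the F-manifold identity -/

section FManifold

variable {E : Type*} [NormedAddCommGroup E] [NormedSpace ℂ E] [FiniteDimensional ℂ E]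
  {H : Type*} [TopologicalSpace H] {I : ModelWithCorners ℂ E H} [I.Boundaryless]
  {M : Type*} [TopologicalSpace M] [ChartedSpace H M] [IsManifold I ω M]
  {F : Type*} [NormedAddCommGroup F] [NormedSpace ℂ F] [FiniteDimensional ℂ F]
  {V : M → Type*} [TopologicalSpace (TotalSpace F V)]
  [∀ x, AddCommGroup (V x)] [∀ x, Module ℂ (V x)] [∀ x, TopologicalSpace (V x)]
  [∀ x, IsTopologicalAddGroup (V x)] [∀ x, ContinuousSMul ℂ (V x)]
  [FiberBundle F V] [VectorBundle ℂ F V] [ContMDiffVectorBundle ω F V I]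
  {D : CovariantDerivative I F V}
  {mulM : ∀ x : M, TangentSpace I x → TangentSpace I x → TangentSpace I x}
  {eM : ∀ x : M, TangentSpace I x}
  {mulV : ∀ x, V x → V x → V x} {eV : ∀ x, V x} {α : ∀ x, V x → TangentSpace I x}

theorem vertPart_zero (u : TotalSpace F V) : vertPart D u 0 = 0 := by
  rw [← horLift_zero (D := D) u, vertPart_horLift]

theorem vertPart_neg (u : TotalSpace F V) (W : TangentSpace (I.prod 𝓘(ℂ, F)) u) :
    vertPart D u (-W) = - vertPart D u W := by
  rw [← neg_one_smul ℂ W, vertPart_smul, neg_one_smul]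

theorem vertPart_sub (u : TotalSpace F V) (W W' : TangentSpace (I.prod 𝓘(ℂ, F)) u) :
    vertPart D u (W - W') = vertPart D u W - vertPart D u W' := by
  rw [sub_eq_add_neg, vertPart_add, vertPart_neg, sub_eq_add_neg]

theorem vertPart_totalMul (u : TotalSpace F V) (W W' : TangentSpace (I.prod 𝓘(ℂ, F)) u) :
    vertPart D u (totalMul D mulM mulV α u W W')
      = mulV u.proj (vertPart D u W) (vertPart D u W') := by
  rw [totalMul, vertPart_add, vertPart_horLift, vertPart_vertLift, zero_add]

theorem IsFManifold.integrable_holAt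
    {E' : Type*} [NormedAddCommGroup E'] [NormedSpace ℂ E'] [FiniteDimensional ℂ E']
    {H' : Type*} [TopologicalSpace H'] {J : ModelWithCorners ℂ E' H'} [J.Boundaryless]
    {N : Type*} [TopologicalSpace N] [ChartedSpace H' N] [IsManifold J ω N]
    {mul : ∀ x : N, TangentSpace J x → TangentSpace J x → TangentSpace J x}
    {e : ∀ x : N, TangentSpace J x} (h : IsFManifold J mul e)
    {X Y Z T : ∀ x : N, TangentSpace J x} {x : N} (hX : HolAt J E' X x) (hY : HolAt J E' Y x)
    (hZ : HolAt J E' Z x) (hT : HolAt J E' T x) :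
    lieDerivMul J mul (fun y => mul y (X y) (Y y)) Z T x
      = mul x (X x) (lieDerivMul J mul Y Z T x) + mul x (Y x) (lieDerivMul J mul X Z T x) := by
  obtain ⟨A, hA, hxA, hXA⟩ := hX.exists_isHolSection
  obtain ⟨B, hB, hxB, hYB⟩ := hY.exists_isHolSection
  obtain ⟨C, hC, hxC, hZC⟩ := hZ.exists_isHolSection
  obtain ⟨G, hG, hxG, hTG⟩ := hT.exists_isHolSection
  exact h.integrable ((A ∩ B) ∩ (C ∩ G)) X Y Z T ((hA.inter hB).inter (hC.inter hG))
    (ContMDiffOn.mono hXA fun _ h => h.1.1) (ContMDiffOn.mono hYB fun _ h => h.1.2)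
    (ContMDiffOn.mono hZC fun _ h => h.2.1) (ContMDiffOn.mono hTG fun _ h => h.2.2)
    x ⟨⟨hxA, hxB⟩, hxC, hxG⟩

/-- The vertical part of a product is the product of the vertical parts, so both correction terms of
the Lie derivative vanish on arguments horizontal at `u`. -/
theorem vertPart_lieDerivMul (hV : IsHolMultiplication I F mulV eV) {u : TotalSpace F V}
    (W W₁ W₂ : ∀ u : TotalSpace F V, TangentSpace (I.prod 𝓘(ℂ, F)) u)
    (h₁ : vertPart D u (W₁ u) = 0) (h₂ : vertPart D u (W₂ u) = 0) :
    vertPart D u (lieDerivMul (I.prod 𝓘(ℂ, F)) (totalMul D mulM mulV α) W W₁ W₂ u)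
      = vertPart D u (VectorField.mlieBracket (I.prod 𝓘(ℂ, F)) W
        (fun z => totalMul D mulM mulV α z (W₁ z) (W₂ z)) u) := by
  rw [lieDerivMul, vertPart_sub, vertPart_sub, vertPart_totalMul, vertPart_totalMul, h₁, h₂,
    hV.mul_zero, hV.zero_mul, sub_zero, sub_zero]

theorem IsHolMultiplication.unit_holAt (hV : IsHolMultiplication I F mulV eV) (x : M) :
    HolAt I F eV x :=
  hV.unit_hol.holAt isOpen_univ (mem_univ x)

variable (hM : IsHolMultiplication I E mulM eM) (hV : IsHolMultiplication I F mulV eV)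
  (hα : IsAlgebraMorphism I F mulM eM mulV eV α) (hD : IsHolConnection D)
  (hF : IsFManifold (I.prod 𝓘(ℂ, F)) (totalMul D mulM mulV α)
    (totalSection (F := F) I eV))
include hM hV hα hD hF

/-- The unit field of the total space is vertical, but the lift of `eM` still acts as the identity
on horizontal lifts. This lets the F-manifold identity reach plain brackets of lifts. -/
theorem totalMul_unit (X : ∀ x : M, TangentSpace I x) :
    (fun z => totalMul D mulM mulV α z (horField D X z) (horField D eM z)) = horField D X := by
  rw [totalMul_hh hM hV hα]
  congr 1
  funext x
  rw [hM.comm, hM.one_mul]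

/-- Horizontal lifts are closed under brackets. -/
theorem bracket_horField (u : TotalSpace F V) {X Y : ∀ x : M, TangentSpace I x}
    (hX : HolAt I E X u.proj) (hY : HolAt I E Y u.proj) :
    VectorField.mlieBracket (I.prod 𝓘(ℂ, F)) (horField D X) (horField D Y) u
      = horLift D u (VectorField.mlieBracket I X Y u.proj) := by
  have he := hM.unit_holAt u.proj
  -- With the lifts of `X`, `eM`, `Y`, `eM` in the four places, the right side has vertical part
  -- zero, because products with horizontal vectors are horizontal. The left side has the vertical
  -- part of the bracket of the lifts.
  have h := congrArg (vertPart D u) (hF.integrable_holAt (x := u) (holAt_horField hD hX)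
    (holAt_horField hD he) (holAt_horField hD hY) (holAt_horField hD he))
  have hz : ∀ X : ∀ x : M, TangentSpace I x, vertPart D u (horField D X u) = 0 :=
    fun X => vertPart_horLift D u _
  rw [vertPart_add, vertPart_totalMul, vertPart_totalMul, hz, hz, hV.zero_mul, hV.zero_mul,
    add_zero, vertPart_lieDerivMul hV _ _ _ (hz _) (hz _), totalMul_unit hM hV hα hD hF,
    totalMul_unit hM hV hα hD hF] at h
  have h2 := (bracket_horLift_horLift hD (mem_chart_source H u.proj)
    (mem_baseSet_trivializationAt' (F := F) (E := V) u.proj) hX hY).1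
  rw [← horLift_add_vertLift D u (VectorField.mlieBracket (I.prod 𝓘(ℂ, F)) (horField D X)
    (horField D Y) u), h, vertLift_zero, add_zero]
  exact congrArg _ h2

/-- The connection is flat. -/
theorem connCurvature_frameAt {x y : M} (h1 : y ∈ (chartAt H x).source)
    (h2 : y ∈ (trivializationAt F V x).baseSet) {X Y : ∀ x : M, TangentSpace I x}
    (hX : HolAt I E X y) (hY : HolAt I E Y y) (i : Fin (Module.finrank ℂ F)) :
    connCurvature D X Y (frameAt F V x i) y = 0 := by
  -- The vertical part of the bracket at a vector is minus the curvature applied to it, so it is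
  -- evaluated at the frame vector itself.
  let u : TotalSpace F V := TotalSpace.mk' F y (frameAt F V x i y)
  have h3 := (bracket_horLift_horLift (u := u) hD h1 h2 hX hY).2
  have h4 := bracket_horField hM hV hα hD hF u hX hY
  rw [show VectorField.mlieBracket (I.prod 𝓘(ℂ, F)) (fun z : TotalSpace F V =>
    horLift D z (X z.proj)) (fun z => horLift D z (Y z.proj)) u = _ from h4,
    vertPart_horLift, fibreCoord_frameAt h2] at h3
  have h0 : fibreCoord x (TotalSpace.mk' F y (0 : V y)) = 0 := by
    simpa using fibreCoord_smul h2 0 (0 : V y)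
  refine fibreCoord_injective h2 ?_
  rw [h0]
  simp only [Module.Basis.repr_self, Finsupp.single_apply, ite_smul, one_smul, zero_smul,
    Finset.sum_ite_eq, Finset.mem_univ, if_true] at h3
  rw [show fibreCoord x (TotalSpace.mk' F u.proj (0 : V u.proj)) = 0 from h0] at h3
  exact neg_eq_zero.1 h3.symm

/-- The connection acts by derivations of the multiplication. -/
theorem conn_mul {s t : ∀ x, V x} {X : ∀ x : M, TangentSpace I x} {x : M} (hs : HolAt I F s x)
    (ht : HolAt I F t x) (hX : HolAt I E X x) :
    D (fun y => mulV y (s y) (t y)) x (X x)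
      = mulV x (s x) (D t x (X x)) + mulV x (D s x (X x)) (t x) := by
  let u : TotalSpace F V := TotalSpace.mk' F x 0
  have he := hM.unit_holAt x
  -- Each Lie derivative along a vertical field, evaluated at the lifts of `X` and `eM`, has
  -- vertical part minus the covariant derivative along `X`; the identity becomes the Leibniz rule.
  have h := congrArg (vertPart D u) (hF.integrable_holAt (x := u) (holAt_totalSection hs)
    (holAt_totalSection ht) (holAt_horField hD hX) (holAt_horField hD he))
  have hz : ∀ X : ∀ x : M, TangentSpace I x, vertPart D u (horField D X u) = 0 :=
    fun X => vertPart_horLift D u _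
  have hb : ∀ {s : ∀ x, V x}, HolAt I F s x → vertPart D u (VectorField.mlieBracket
      (I.prod 𝓘(ℂ, F)) (totalSection I s) (horField D X) u) = - D s x (X x) := by
    intro s hs
    have h1 : VectorField.mlieBracket (I.prod 𝓘(ℂ, F)) (horField D X) (totalSection I s) u
      = vertLift I u (D s x (X x)) := bracket_horLift_vertLift (u := u) hD hX hs
    rw [VectorField.mlieBracket_swap_apply, h1, vertPart_neg, vertPart_vertLift]
  rw [vertPart_add, vertPart_totalMul, vertPart_totalMul, totalMul_vv hM hV hα,
    vertPart_lieDerivMul hV _ _ _ (hz _) (hz _), vertPart_lieDerivMul hV _ _ _ (hz _) (hz _),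
    vertPart_lieDerivMul hV _ _ _ (hz _) (hz _), totalMul_unit hM hV hα hD hF, hb hs, hb ht,
    hb (hV.holAt hs ht), hV.mul_neg, hV.mul_neg, ← neg_add, neg_inj] at h
  simp only [totalSection, vertPart_vertLift] at h
  rw [h]
  congr 1
  exact hV.comm _ _ _

end FManifold

/-! ### Parallel sections through every vector of the bundle -/

section Parallel

variable {E : Type*} [NormedAddCommGroup E] [NormedSpace ℂ E] [FiniteDimensional ℂ E]
  {H : Type*} [TopologicalSpace H] {I : ModelWithCorners ℂ E H} [I.Boundaryless]
  {M : Type*} [TopologicalSpace M] [ChartedSpace H M] [IsManifold I ω M]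
  {F : Type*} [NormedAddCommGroup F] [NormedSpace ℂ F] [FiniteDimensional ℂ F]
  {V : M → Type*} [TopologicalSpace (TotalSpace F V)]
  [∀ x, AddCommGroup (V x)] [∀ x, Module ℂ (V x)] [∀ x, TopologicalSpace (V x)]
  [∀ x, IsTopologicalAddGroup (V x)] [∀ x, ContinuousSMul ℂ (V x)]
  [FiberBundle F V] [VectorBundle ℂ F V] [ContMDiffVectorBundle ω F V I]
  {D : CovariantDerivative I F V}

variable (F) in
/-- The section with constant coordinate `a` in the preferred trivialization at `x`. -/
def constSection (V : M → Type*) [TopologicalSpace (TotalSpace F V)]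
    [∀ x, AddCommGroup (V x)] [∀ x, TopologicalSpace (V x)] [FiberBundle F V]
    (x : M) (a : F) (y : M) : V y := (trivializationAt F V x).symm y a

theorem sectionCoord_constSection {x y : M} (hy : y ∈ (trivializationAt F V x).baseSet) (a : F) :
    sectionCoord F (constSection F V x a) x y = a := fibreCoord_symm hy a

theorem sectionCoord_constSection_eventually {x y : M}
    (hy : y ∈ (trivializationAt F V x).baseSet) (a : F) :
    sectionCoord F (constSection F V x a) x =ᶠ[𝓝 y] fun _ => a := by
  filter_upwards [(trivializationAt F V x).open_baseSet.mem_nhds hy] with z hz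
  exact sectionCoord_constSection hz a

theorem holAt_constSection {x y : M} (hy : y ∈ (trivializationAt F V x).baseSet) (a : F) :
    HolAt I F (constSection F V x a) y :=
  holAt_of_sectionCoord' hy
    (contMDiffAt_const.congr_of_eventuallyEq (sectionCoord_constSection_eventually hy a))

theorem contDiffAt_sectionCoord_chart {x y : M} (hy : y ∈ (chartAt H x).source)
    (hyb : y ∈ (trivializationAt F V x).baseSet) {s : ∀ x, V x} (hs : HolAt I F s y) :
    ContDiffAt ℂ ω (fun u => sectionCoord F s x ((extChartAt I x).symm u)) (extChartAt I x y) := by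
  have hys : y ∈ (extChartAt I x).source := by rwa [extChartAt_source]
  have h1 := sectionCoord_holAt hyb hs
  have h2 : ContMDiffAt 𝓘(ℂ, E) I ω (extChartAt I x).symm (extChartAt I x y) :=
    (contMDiffOn_extChartAt_symm x).contMDiffAt
      ((isOpen_extChartAt_target x).mem_nhds ((extChartAt I x).map_source hys))
  have h3 : ContMDiffAt I 𝓘(ℂ, F) ω (sectionCoord F s x)
      ((extChartAt I x).symm (extChartAt I x y)) := by
    rwa [(extChartAt I x).left_inv hys]
  exact (h3.comp _ h2).contDiffAt

theorem realDeriv_sectionCoord_chart {x y : M} (hy : y ∈ (chartAt H x).source)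
    (hyb : y ∈ (trivializationAt F V x).baseSet) {s : ∀ x, V x} (hs : HolAt I F s y)
    (X : ∀ y : M, TangentSpace I y) :
    realDeriv I (sectionCoord F s x) y (X y)
      = fderiv ℂ (fun u => sectionCoord F s x ((extChartAt I x).symm u)) (extChartAt I x y)
        (sectionCoord E X x y) := by
  have hd := (contDiffAt_sectionCoord_chart hy hyb hs).differentiableAt (by simp)
  rw [realDeriv_eq_fderiv_chart (hd.restrictScalars ℝ) hy, hd.fderiv_restrictScalars ℝ,
    sectionCoord_tangent _ hy]
  rfl

/-- Fields with constant coordinates in one chart commute, so the bracket term disappears from the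
curvature in coordinates. -/
theorem mlieBracket_constSection {x y : M} (hy : y ∈ (chartAt H x).source) (ξ η : E) :
    VectorField.mlieBracket I (constSection E (TangentSpace I : M → Type _) x ξ)
      (constSection E (TangentSpace I : M → Type _) x η) y = 0 := by
  have hb : y ∈ (trivializationAt E (TangentSpace I : M → Type _) x).baseSet := by simpa using hy
  have h := sectionCoord_mlieBracket hy (holAt_constSection (I := I) hb ξ)
    (holAt_constSection (I := I) hb η)
  rw [realDeriv_congr (sectionCoord_constSection_eventually hb η),
    realDeriv_congr (sectionCoord_constSection_eventually hb ξ), realDeriv_const, realDeriv_const,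
    sub_zero] at h
  refine fibreCoord_injective (F := E) hb (h.trans ?_)
  simpa using (fibreCoord_smul (F := E) hb 0 (0 : TangentSpace I y)).symm

variable (D) in
/-- The derivative of a frame section in a coordinate direction, in coordinates. -/
def christoffel (x : M) (ξ : E) (i : Fin (Module.finrank ℂ F)) (z : E) : F :=
  sectionCoord F (fun y => D (frameAt F V x i) y (constSection E (TangentSpace I : M → Type _) x ξ y))
    x ((extChartAt I x).symm z)

/-- The pairing of a family with the coordinates of a vector. -/
def coordPairing (W : Type*) [NormedAddCommGroup W] [NormedSpace ℂ W] [FiniteDimensional ℂ W]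
    (G : Type*) [NormedAddCommGroup G] [NormedSpace ℂ G] :
    (Fin (Module.finrank ℂ W) → G) →L[ℂ] W →L[ℂ] G :=
  ∑ j, ContinuousLinearMap.smulRightL ℂ W G
    (LinearMap.toContinuousLinearMap ((Module.finBasis ℂ W).coord j)) ∘L .proj j

theorem coordPairing_apply {W : Type*} [NormedAddCommGroup W] [NormedSpace ℂ W]
    [FiniteDimensional ℂ W] {G : Type*} [NormedAddCommGroup G] [NormedSpace ℂ G]
    (p : Fin (Module.finrank ℂ W) → G) (w : W) :
    coordPairing W G p w = ∑ j, (Module.finBasis ℂ W).repr w j • p j := by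
  simp [coordPairing]

variable (D) in
/-- The connection form in the chart and trivialization at `x`. -/
def chartConn (x : M) (z : E) : Fin (Module.finrank ℂ E) → Fin (Module.finrank ℂ F) → F :=
  fun j i => christoffel D x (Module.finBasis ℂ E j) i z

theorem contDiffAt_christoffel (hD : IsHolConnection D) {x y : M} (hy : y ∈ (chartAt H x).source)
    (hyb : y ∈ (trivializationAt F V x).baseSet) (ξ : E) (i : Fin (Module.finrank ℂ F)) :
    ContDiffAt ℂ ω (christoffel D x ξ i) (extChartAt I x y) :=
  contDiffAt_sectionCoord_chart hy hyb
    (hD.holAt (holAt_frameAt' hyb i) (holAt_constSection (by simpa using hy) ξ))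

theorem contDiffAt_chartConn (hD : IsHolConnection D) {x y : M} (hy : y ∈ (chartAt H x).source)
    (hyb : y ∈ (trivializationAt F V x).baseSet) :
    ContDiffAt ℂ ω (chartConn D x) (extChartAt I x y) :=
  contDiffAt_pi.2 fun _ => contDiffAt_pi.2 fun _ => contDiffAt_christoffel hD hy hyb _ _

/-- Expanding `ξ` in a basis identifies the family of coefficients with the connection form. The two
pairings are the bilinear maps to which `exists_parallel_solution` is applied. -/
theorem chartConn_eq_connForm {x y : M} (hy : y ∈ (chartAt H x).source)
    (hyb : y ∈ (trivializationAt F V x).baseSet) (ξ : E) (a : F) :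
    coordPairing F F (coordPairing E _ (chartConn D x (extChartAt I x y)) ξ) a
      = connForm D x y (constSection E (TangentSpace I : M → Type _) x ξ y) a := by
  have hys : y ∈ (extChartAt I x).source := by rwa [extChartAt_source]
  have hb : y ∈ (trivializationAt E (TangentSpace I : M → Type _) x).baseSet := by simpa using hy
  have hc : ∀ ξ : E, fibreCoord x (TotalSpace.mk' E y
      (constSection E (TangentSpace I : M → Type _) x ξ y)) = ξ := fun ξ =>
    sectionCoord_constSection (F := E) hb ξ
  have hξ : constSection E (TangentSpace I : M → Type _) x ξ y
      = ∑ j, (Module.finBasis ℂ E).repr ξ j •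
        constSection E (TangentSpace I : M → Type _) x (Module.finBasis ℂ E j) y := by
    refine fibreCoord_injective (F := E) hb ?_
    rw [fibreCoord_sum hb]
    simp only [fibreCoord_smul (F := E) hb, hc]
    exact ((Module.finBasis ℂ E).sum_repr ξ).symm
  rw [hξ, coordPairing_apply, coordPairing_apply]
  simp only [connForm, map_sum, map_smul, fibreCoord_sum hyb, fibreCoord_smul hyb, chartConn,
    christoffel, (extChartAt I x).left_inv hys, Finset.sum_apply, Pi.smul_apply]
  rfl

theorem christoffel_eq {x y : M} (hy : y ∈ (chartAt H x).source)
    (hyb : y ∈ (trivializationAt F V x).baseSet) (ξ : E) (i : Fin (Module.finrank ℂ F)) :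
    christoffel D x ξ i (extChartAt I x y)
      = coordPairing F F (coordPairing E _ (chartConn D x (extChartAt I x y)) ξ)
        (Module.finBasis ℂ F i) := by
  have hys : y ∈ (extChartAt I x).source := by rwa [extChartAt_source]
  rw [chartConn_eq_connForm hy hyb, connForm_basis, christoffel, (extChartAt I x).left_inv hys]
  rfl

theorem fderiv_bilin_bilin {P Q E' G W : Type*} [NormedAddCommGroup P] [NormedSpace ℂ P]
    [NormedAddCommGroup Q] [NormedSpace ℂ Q] [NormedAddCommGroup E'] [NormedSpace ℂ E']
    [NormedAddCommGroup G] [NormedSpace ℂ G] [NormedAddCommGroup W] [NormedSpace ℂ W]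
    (b₁ : P →L[ℂ] E' →L[ℂ] Q) (b₂ : Q →L[ℂ] W →L[ℂ] G) {p : E' → P} {z : E'}
    (hp : DifferentiableAt ℂ p z) (ξ η : E') (a : W) :
    fderiv ℂ (fun z => b₂ (b₁ (p z) η) a) z ξ = b₂ (b₁ (fderiv ℂ p z ξ) η) a := by
  have h := (b₂.flip a ∘L b₁.flip η).hasFDerivAt.comp z hp.hasFDerivAt
  exact DFunLike.congr_fun (HasFDerivAt.fderiv h) ξ

theorem fderiv_christoffel (hD : IsHolConnection D) {x y : M} (hy : y ∈ (chartAt H x).source)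
    (hyb : y ∈ (trivializationAt F V x).baseSet) (ξ η : E) (i : Fin (Module.finrank ℂ F)) :
    fderiv ℂ (christoffel D x η i) (extChartAt I x y) ξ
      = coordPairing F F (coordPairing E _ (fderiv ℂ (chartConn D x) (extChartAt I x y) ξ) η)
        (Module.finBasis ℂ F i) := by
  have hys : y ∈ (extChartAt I x).source := by rwa [extChartAt_source]
  have hev : christoffel D x η i =ᶠ[𝓝 (extChartAt I x y)]
      fun z => coordPairing F F (coordPairing E _ (chartConn D x z) η)
        (Module.finBasis ℂ F i) := by
    have hO := (chartAt H x).open_source.inter (trivializationAt F V x).open_baseSet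
    have hc : ContinuousAt (extChartAt I x).symm (extChartAt I x y) :=
      continuousAt_extChartAt_symm' hys
    have hm : (extChartAt I x).symm (extChartAt I x y) ∈
        (chartAt H x).source ∩ (trivializationAt F V x).baseSet := by
      rw [(extChartAt I x).left_inv hys]
      exact ⟨hy, hyb⟩
    filter_upwards [hc.eventually_mem (hO.mem_nhds hm),
      (isOpen_extChartAt_target x).mem_nhds ((extChartAt I x).map_source hys)] with z hz hzt
    have h := christoffel_eq (D := D) hz.1 hz.2 η i
    rwa [(extChartAt I x).right_inv hzt] at h
  rw [hev.fderiv_eq]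
  exact fderiv_bilin_bilin _ _ ((contDiffAt_chartConn hD hy hyb).differentiableAt (by simp)) _ _ _

/-- The curvature in coordinates. -/
theorem chartConn_flat (hD : IsHolConnection D)
    (hflat : ∀ {x y : M}, y ∈ (chartAt H x).source → y ∈ (trivializationAt F V x).baseSet →
      ∀ {X Y : ∀ x : M, TangentSpace I x}, HolAt I E X y → HolAt I E Y y →
      ∀ i : Fin (Module.finrank ℂ F), connCurvature D X Y (frameAt F V x i) y = 0)
    {x y : M} (hy : y ∈ (chartAt H x).source)
    (hyb : y ∈ (trivializationAt F V x).baseSet) (ξ η : E) (a : F) :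
    coordPairing F F (coordPairing E _ (fderiv ℂ (chartConn D x) (extChartAt I x y) ξ) η) a
      - coordPairing F F (coordPairing E _ (fderiv ℂ (chartConn D x) (extChartAt I x y) η) ξ) a
      + coordPairing F F (coordPairing E _ (chartConn D x (extChartAt I x y)) ξ)
        (coordPairing F F (coordPairing E _ (chartConn D x (extChartAt I x y)) η) a)
      - coordPairing F F (coordPairing E _ (chartConn D x (extChartAt I x y)) η)
        (coordPairing F F (coordPairing E _ (chartConn D x (extChartAt I x y)) ξ) a) = 0 := by
  have hys : y ∈ (extChartAt I x).source := by rwa [extChartAt_source]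
  have hb : y ∈ (trivializationAt E (TangentSpace I : M → Type _) x).baseSet := by simpa using hy
  set C := coordPairing F F
  set Γ := coordPairing E _ (chartConn D x (extChartAt I x y))
  set Γ' := fun ξ => coordPairing E _ (fderiv ℂ (chartConn D x) (extChartAt I x y) ξ)
  -- The second covariant derivative of a frame section in coordinates: the derivative of the form
  -- plus the composite of two forms. Antisymmetrizing gives the curvature.
  have key : ∀ (ξ η : E) i, fibreCoord x (TotalSpace.mk' F y (D (fun z => D (frameAt F V x i) z
      (constSection E (TangentSpace I : M → Type _) x η z)) y
      (constSection E (TangentSpace I : M → Type _) x ξ y)))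
      = C (Γ' ξ η) (Module.finBasis ℂ F i) + C (Γ ξ) (C (Γ η) (Module.finBasis ℂ F i)) := by
    intro ξ η i
    have hs := hD.holAt (holAt_frameAt' hyb i) (holAt_constSection (I := I) hb η)
    have h1 := christoffel_eq (D := D) hy hyb η i
    rw [christoffel, (extChartAt I x).left_inv hys] at h1
    rw [fibreCoord_conn D hyb hs, realDeriv_sectionCoord_chart hy hyb hs,
      sectionCoord_constSection (F := E) hb, ← chartConn_eq_connForm hy hyb, h1]
    exact congrArg (· + _) (fderiv_christoffel hD hy hyb ξ η i)
  have hlin : (C (Γ' ξ η) - C (Γ' η ξ) + C (Γ ξ) ∘L C (Γ η) - C (Γ η) ∘L C (Γ ξ) : F →L[ℂ] F)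
      = 0 := by
    refine ContinuousLinearMap.coe_injective ((Module.finBasis ℂ F).ext fun i => ?_)
    have h := hflat hy hyb (holAt_constSection (I := I) hb ξ) (holAt_constSection (I := I) hb η) i
    rw [connCurvature, mlieBracket_constSection hy, map_zero, sub_zero, sub_eq_zero] at h
    have h2 := congrArg (fun v => fibreCoord x (TotalSpace.mk' F y v)) h
    simp only [key] at h2
    change C (Γ' ξ η) _ - C (Γ' η ξ) _ + C (Γ ξ) (C (Γ η) _) - C (Γ η) (C (Γ ξ) _) = 0
    linear_combination (norm := module) h2
  exact DFunLike.congr_fun hlin a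

/-- A flat holomorphic connection has parallel sections with arbitrary values at a point. -/
theorem exists_parallel_section (hD : IsHolConnection D)
    (hflat : ∀ {x y : M}, y ∈ (chartAt H x).source → y ∈ (trivializationAt F V x).baseSet →
      ∀ {X Y : ∀ x : M, TangentSpace I x}, HolAt I E X y → HolAt I E Y y →
      ∀ i : Fin (Module.finrank ℂ F), connCurvature D X Y (frameAt F V x i) y = 0)
    {x : M} (a : V x) :
    ∃ s : ∀ y, V y, HolAt I F s x ∧ s x = a ∧ ∀ᶠ y in 𝓝 x, D s y = 0 := by
  have := FiniteDimensional.complete ℂ F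
  have := FiniteDimensional.complete ℂ E
  -- The solution theorem is stated at the origin, so the chart is translated by the image of `x`.
  set z₀ := extChartAt I x x with hz₀
  have hx := mem_chart_source H x
  have hxb := mem_baseSet_trivializationAt' (F := F) (E := V) x
  have hshift : Filter.Tendsto (fun w : E => (extChartAt I x).symm (z₀ + w)) (𝓝 0) (𝓝 x) := by
    have h1 := continuousAt_extChartAt_symm (I := I) x
    have h2 : Filter.Tendsto (fun w : E => z₀ + w) (𝓝 0) (𝓝 z₀) := by
      simpa using (continuous_const_add z₀).tendsto (0 : E)
    have h3 := h1.tendsto.comp h2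
    rwa [extChartAt_to_inv] at h3
  have hO := ((chartAt H x).open_source.inter (trivializationAt F V x).open_baseSet).mem_nhds
    ⟨hx, hxb⟩
  have hΓ : AnalyticAt ℂ (fun w => chartConn D x (z₀ + w)) 0 := by
    have h1 := contDiffAt_chartConn hD hx hxb
    rw [← hz₀, ← add_zero z₀] at h1
    exact (h1.comp (0 : E) (contDiffAt_const.add contDiffAt_id)).analyticAt
  have htarget : ∀ᶠ w : E in 𝓝 0, z₀ + w ∈ (extChartAt I x).target := by
    have h2 : Filter.Tendsto (fun w : E => z₀ + w) (𝓝 0) (𝓝 z₀) := by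
      simpa using (continuous_const_add z₀).tendsto (0 : E)
    exact h2.eventually_mem ((isOpen_extChartAt_target x).mem_nhds (mem_extChartAt_target x))
  obtain ⟨σ, hσ, h0, h⟩ := exists_parallel_solution (coordPairing E _) (coordPairing F F) hΓ (by
    filter_upwards [htarget, hshift.eventually_mem hO] with w hw hwO ξ η b
    have h1 := chartConn_flat hD hflat hwO.1 hwO.2 ξ η b
    rw [(extChartAt I x).right_inv hw] at h1
    rw [fderiv_comp_add_left]
    exact h1) (fibreCoord x (TotalSpace.mk' F x a))
  have hsub : Filter.Tendsto (fun y => extChartAt I x y - z₀) (𝓝 x) (𝓝 0) := by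
    have h1 := (continuousAt_extChartAt (I := I) x).tendsto.sub_const z₀
    rwa [← hz₀, sub_self] at h1
  set s : ∀ y, V y := fun y => (trivializationAt F V x).symm y (σ (extChartAt I x y - z₀)) with hs
  have hcoord : ∀ y ∈ (trivializationAt F V x).baseSet,
      sectionCoord F s x y = σ (extChartAt I x y - z₀) := fun y hy => fibreCoord_symm hy _
  have hhol : HolAt I F s x := by
    refine holAt_of_sectionCoord' hxb ?_
    have h1 : ContMDiffAt I 𝓘(ℂ, E) ω (fun y => extChartAt I x y - z₀) x :=
      (contMDiffAt_extChartAt' hx).sub contMDiffAt_const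
    have h2 : ContDiffAt ℂ ω σ (extChartAt I x x - z₀) := by rwa [← hz₀, sub_self]
    refine (h2.contMDiffAt.comp x h1).congr_of_eventuallyEq ?_
    filter_upwards [(trivializationAt F V x).open_baseSet.mem_nhds hxb] with y hy
    exact hcoord y hy
  refine ⟨s, hhol, ?_, ?_⟩
  · rw [hs]
    simp only [← hz₀, sub_self, h0]
    exact symm_fibreCoord hxb a
  · filter_upwards [hhol.eventually, hO, hsub.eventually h] with y hy hyO hyσ
    have hb : y ∈ (trivializationAt E (TangentSpace I : M → Type _) x).baseSet := by
      simpa using hyO.1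
    have hys : y ∈ (extChartAt I x).source := by rw [extChartAt_source]; exact hyO.1
    ext X
    -- Any tangent vector at `y` is the value of the field with these constant coordinates, which
    -- reduces parallelism to the equation for `σ`.
    set ξ := fibreCoord x (TotalSpace.mk' E y X) with hξ
    have hX : constSection E (TangentSpace I : M → Type _) x ξ y = X := symm_fibreCoord hb X
    rw [← hX]
    refine fibreCoord_injective hyO.2 ?_
    rw [fibreCoord_conn D hyO.2 hy, realDeriv_sectionCoord_chart hyO.1 hyO.2 hy,
      sectionCoord_constSection (F := E) hb, hcoord y hyO.2, ← chartConn_eq_connForm hyO.1 hyO.2]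
    have h1 : (fun u => sectionCoord F s x ((extChartAt I x).symm u))
        =ᶠ[𝓝 (extChartAt I x y)] fun u => σ (u - z₀) := by
      have hm : (extChartAt I x).symm (extChartAt I x y) ∈ (trivializationAt F V x).baseSet := by
        rw [(extChartAt I x).left_inv hys]
        exact hyO.2
      filter_upwards [(continuousAt_extChartAt_symm' hys).eventually_mem
        ((trivializationAt F V x).open_baseSet.mem_nhds hm),
        (isOpen_extChartAt_target x).mem_nhds ((extChartAt I x).map_source hys)] with u hu hut
      rw [hcoord _ hu, (extChartAt I x).right_inv hut]
    rw [h1.fderiv_eq, fderiv_comp_sub]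
    have h2 := hyσ ξ
    rw [add_sub_cancel] at h2
    rw [h2]
    simpa using (fibreCoord_smul hyO.2 0 (0 : V y)).symm

end Parallel

/-! ### Conditions (i), (ii) and (iv) in terms of `k ∂̄ k` -/

section Conditions

variable {E : Type*} [NormedAddCommGroup E] [NormedSpace ℂ E] [FiniteDimensional ℂ E]
  {H : Type*} [TopologicalSpace H] {I : ModelWithCorners ℂ E H} [I.Boundaryless]
  {M : Type*} [TopologicalSpace M] [ChartedSpace H M] [IsManifold I ω M]
  {F : Type*} [NormedAddCommGroup F] [NormedSpace ℂ F] [FiniteDimensional ℂ F]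
  {V : M → Type*} [TopologicalSpace (TotalSpace F V)]
  [∀ x, AddCommGroup (V x)] [∀ x, Module ℂ (V x)] [∀ x, TopologicalSpace (V x)]
  [∀ x, IsTopologicalAddGroup (V x)] [∀ x, ContinuousSMul ℂ (V x)]
  [FiberBundle F V] [VectorBundle ℂ F V] [ContMDiffVectorBundle ω F V I]
  {D : CovariantDerivative I F V}
  {mulM : ∀ x : M, TangentSpace I x → TangentSpace I x → TangentSpace I x}
  {eM : ∀ x : M, TangentSpace I x}
  {gM : ∀ x : M, TangentSpace I x → TangentSpace I x → ℂ}
  {kM : ∀ x : M, TangentSpace I x → TangentSpace I x}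
  {mulV : ∀ x, V x → V x → V x} {eV : ∀ x, V x} {gV : ∀ x, V x → V x → ℂ}
  {kV : ∀ x, V x → V x} {α : ∀ x, V x → TangentSpace I x}

theorem IsHolMetric.add_right (hg : IsHolMetric I F gV) (x : M) (a b c : V x) :
    gV x a (b + c) = gV x a b + gV x a c := by
  rw [hg.symm, hg.add_left, hg.symm x b, hg.symm x c]

theorem IsHolMetric.zero_left (hg : IsHolMetric I F gV) (x : M) (a : V x) : gV x 0 a = 0 := by
  simpa using hg.smul_left x 0 0 a

/-- All terms with values in `g_M` are instances of `g_M (a ∘ b, c)`, which is symmetric in its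
three arguments; the two sides differ by permutations of these arguments. -/
theorem totalMetric_invariant (hgM : IsHolMetric I E gM) (hM : IsHolMultiplication I E mulM eM)
    (hiM : ∀ x a b c, gM x (mulM x a b) c = gM x a (mulM x b c))
    (hiV : ∀ x a b c, gV x (mulV x a b) c = gV x a (mulV x b c))
    (hα : IsAlgebraMorphism I F mulM eM mulV eV α) (u : TotalSpace F V)
    (a b c : TangentSpace (I.prod 𝓘(ℂ, F)) u) :
    totalMetric D gM gV α u (totalMul D mulM mulV α u a b) c
      = totalMetric D gM gV α u a (totalMul D mulM mulV α u b c) := by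
  have hh : ∀ a b : TangentSpace (I.prod 𝓘(ℂ, F)) u,
      horPart I u (totalMul D mulM mulV α u a b)
        = mulM u.proj (horPart I u a) (horPart I u b)
          + mulM u.proj (α u.proj (vertPart D u a)) (horPart I u b)
          + mulM u.proj (α u.proj (vertPart D u b)) (horPart I u a) := fun a b => by
    rw [totalMul, horPart_add, horPart_horLift, horPart_vertLift, add_zero]
  simp only [totalMetric, hh, vertPart_totalMul, hα.mul, hgM.add_left, hgM.add_right, ← hiM, hiV]
  generalize horPart I u a = a₁
  generalize horPart I u b = b₁
  generalize horPart I u c = c₁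
  generalize α u.proj (vertPart D u a) = a₂
  generalize α u.proj (vertPart D u b) = b₂
  generalize α u.proj (vertPart D u c) = c₂
  have hT : ∀ a b c, gM u.proj (mulM u.proj a b) c = gM u.proj (mulM u.proj b a) c :=
    fun a b c => by rw [hM.comm]
  have hT' : ∀ a b c, gM u.proj (mulM u.proj a b) c = gM u.proj (mulM u.proj a c) b :=
    fun a b c => by rw [hiM, hM.comm, ← hiM]
  rw [hT b₂ a₁ c₁, hT c₂ a₁ b₁, hT' a₁ c₂ b₁, hT c₂ a₂ b₁, hT c₂ b₂ a₁, hT' b₂ c₂ a₁]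
  ring

theorem higgsBracket_eq (hV : IsHolMultiplication I F mulV eV)
    (hkV : IsCompatibleRealStructure I F gV kV) (x : M) (a b c : V x) :
    higgs (mulV x) a (kV x (higgs (mulV x) b (kV x c)))
      - kV x (higgs (mulV x) b (kV x (higgs (mulV x) a c)))
      = higgsBracket (mulV x) (kV x) a b c := by
  simp only [higgs, higgsBracket, hkV.map_neg, hV.mul_neg, neg_neg]

/-- Tensoriality: a locally additive and homogeneous expression vanishes on sections vanishing at
the point. -/
theorem tensor_eq_zero {W : Type*} [AddCommGroup W] [Module ℂ W] {x : M}
    (T : (∀ x, V x) → W) (hcongr : ∀ s t, (∀ᶠ y in 𝓝 x, s y = t y) → HolAt I F s x → T s = T t)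
    (hadd : ∀ s t, HolAt I F s x → HolAt I F t x → T (fun y => s y + t y) = T s + T t)
    (hsmul : ∀ (f : M → ℂ) s, ContMDiffAt I 𝓘(ℂ, ℂ) ω f x → HolAt I F s x →
      T (fun y => f y • s y) = f x • T s) {s : ∀ x, V x} (hs : HolAt I F s x) (h0 : s x = 0) :
    T s = 0 := by
  classical
  have hz : T (fun _ => 0) = 0 := by
    have h := hadd _ _ (HolAt.zero (I := I) (F := F) (V := V) x) (HolAt.zero x)
    simpa using h
  have hsum : ∀ t : Finset (Fin (Module.finrank ℂ F)),
      HolAt I F (fun y => ∑ i ∈ t, frameCoeff (F := F) s x i y • frameAt F V x i y) x ∧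
      T (fun y => ∑ i ∈ t, frameCoeff (F := F) s x i y • frameAt F V x i y) = 0 := by
    intro t
    induction t using Finset.induction_on with
    | empty => exact ⟨by simpa using HolAt.zero x, by simpa using hz⟩
    | insert a t ha ih =>
      simp only [Finset.sum_insert ha]
      have h1 := HolAt.smul (hs.frameCoeff a) (holAt_frameAt (F := F) (V := V) x a)
      refine ⟨h1.add ih.1, ?_⟩
      rw [hadd _ _ h1 ih.1, ih.2, hsmul _ _ (hs.frameCoeff a) (holAt_frameAt (F := F) (V := V) x a)]
      -- All frame coefficients vanish at `x` together with the section, so homogeneity kills every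
      -- term.
      have hc : frameCoeff (F := F) s x a x = 0 := by
        have h2 : sectionCoord F s x x = 0 := by
          have hb := mem_baseSet_trivializationAt' (F := F) (E := V) x
          rw [show sectionCoord F s x x = fibreCoord x (TotalSpace.mk' F x (s x)) from rfl, h0]
          simpa using fibreCoord_smul hb 0 (0 : V x)
        rw [frameCoeff, h2]
        simp
      rw [hc, zero_smul, zero_add]
  rw [hcongr _ _ (eq_sum_frame (F := F) s x) hs]
  exact (hsum _).2

variable (hM : IsHolMultiplication I E mulM eM) (hV : IsHolMultiplication I F mulV eV)
  (hα : IsAlgebraMorphism I F mulM eM mulV eV α) (hD : IsHolConnection D)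
  (hgM : IsHolMetric I E gM) (hgV : IsHolMetric I F gV)
  (hkM : IsCompatibleRealStructure I E gM kM) (hkV : IsCompatibleRealStructure I F gV kV)
  (hk : ∀ x a, α x (kV x a) = kM x (α x a))
include hM hV hα hD hgM hgV hkM hkV hk

/-- Compatibility of the Chern connection of `M` with multiplication by sections of `V`: reduction
to parallel sections. -/
theorem nabla_action_iff
    (hflat : ∀ {x y : M}, y ∈ (chartAt H x).source → y ∈ (trivializationAt F V x).baseSet →
      ∀ {X Y : ∀ x : M, TangentSpace I x}, HolAt I E X y → HolAt I E Y y →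
      ∀ i : Fin (Module.finrank ℂ F), connCurvature D X Y (frameAt F V x i) y = 0) :
    (∀ (U : Set M) (s : ∀ x, V x) (X Z : ∀ x : M, TangentSpace I x), IsOpen U →
        IsHolSection I F U s → (∀ x ∈ U, D s x = 0) →
        IsHolSection I E U X → IsHolSection I E U Z → ∀ x ∈ U,
        chern I E (herm gM kM) (fun y => mulM y (α y (s y)) (Z y)) x (X x)
          = mulM x (α x (s x)) (chern I E (herm gM kM) Z x (X x))) ↔
    (∀ (x : M) (X Z : ∀ x : M, TangentSpace I x) (s : ∀ x, V x), HolAt I E X x → HolAt I E Z x →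
      HolAt I F s x → nabla I E kM (fun y => mulM y (α y (s y)) (Z y)) x (X x)
        = mulM x (α x (s x)) (nabla I E kM Z x (X x)) + mulM x (α x (D s x (X x))) (Z x)) := by
  constructor
  · intro h x X Z s hX hZ hs
    -- The defect of the identity. Both connections differentiate a holomorphic coefficient in the
    -- same way, so these terms cancel and `T` is tensorial in `s`.
    let T : (∀ x, V x) → TangentSpace I x := fun s =>
      nabla I E kM (fun y => mulM y (α y (s y)) (Z y)) x (X x)
        - (mulM x (α x (s x)) (nabla I E kM Z x (X x)) + mulM x (α x (D s x (X x))) (Z x))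
    have hadd : ∀ s t, HolAt I F s x → HolAt I F t x → T (fun y => s y + t y) = T s + T t := by
      intro s t hs ht
      simp only [T, hα.add, hM.add_mul, conn_add D hs ht]
      rw [hkM.nabla_add (hM.holAt (hα.holAt hs) hZ).smooth (hM.holAt (hα.holAt ht) hZ).smooth]
      abel
    have hsmul : ∀ (f : M → ℂ) s, ContMDiffAt I 𝓘(ℂ, ℂ) ω f x → HolAt I F s x →
        T (fun y => f y • s y) = f x • T s := by
      intro f s hf hs
      simp only [T, hα.smul, hα.add, hM.smul_mul, hM.add_mul, conn_smul D hf hs]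
      rw [hkM.nabla_smul (SmoothFunAt.of_hol hf) (hM.holAt (hα.holAt hs) hZ).smooth,
        del_of_hol (hf.mdifferentiableAt (by simp))]
      module
    have hcongr : ∀ s t, (∀ᶠ y in 𝓝 x, s y = t y) → HolAt I F s x → T s = T t := by
      intro s t hst hs
      simp only [T, hst.self_of_nhds, conn_congr D hs hst]
      rw [nabla_congr kM (hst.mono fun y hy => by rw [hy])]
    -- A parallel section with the same value at `x`: the hypothesis gives `T p = 0`, and
    -- tensoriality gives `T (s - p) = 0`.
    obtain ⟨p, hp, hpx, hDp⟩ := exists_parallel_section hD hflat (s x)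
    have hTp : T p = 0 := by
      obtain ⟨A, hA, hxA, hpA⟩ := hp.exists_isHolSection
      obtain ⟨B, hB, hxB, hXB⟩ := hX.exists_isHolSection
      obtain ⟨C, hC, hxC, hZC⟩ := hZ.exists_isHolSection
      obtain ⟨G, hG, hGo, hxG⟩ := eventually_nhds_iff.1 hDp
      have h1 := h ((A ∩ B) ∩ (C ∩ G)) p X Z ((hA.inter hB).inter (hC.inter hGo))
        (ContMDiffOn.mono hpA fun _ h => h.1.1) (fun y hy => hG y hy.2.2)
        (ContMDiffOn.mono hXB fun _ h => h.1.2) (ContMDiffOn.mono hZC fun _ h => h.2.1)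
        x ⟨⟨hxA, hxB⟩, hxC, hxG⟩
      rw [hgM.chern_eq hkM (hM.holAt (hα.holAt hp) hZ).smooth, hgM.chern_eq hkM hZ.smooth] at h1
      simp only [T, h1, hG x hxG, zero_apply, hα.map_zero, hM.zero_mul,
        add_zero, sub_self]
    have hdiff : T (fun y => s y - p y) = 0 :=
      tensor_eq_zero T hcongr hadd hsmul (hs.sub hp) (by rw [hpx, sub_self])
    have h2 := hadd _ _ (hs.sub hp) hp
    simp only [sub_add_cancel, hdiff, hTp, add_zero] at h2
    exact sub_eq_zero.1 h2
  · intro h U s X Z hU hs hDs hX hZ x hx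
    have hs' := hs.holAt hU hx
    have hX' := hX.holAt hU hx
    have hZ' := hZ.holAt hU hx
    rw [hgM.chern_eq hkM (hM.holAt (hα.holAt hs') hZ').smooth, hgM.chern_eq hkM hZ'.smooth,
      h x X Z s hX' hZ' hs', hDs x hx, zero_apply, hα.map_zero, hM.zero_mul,
      add_zero]

/-- The Chern connection of `V` in terms of `D`. -/
theorem nabla_mul_iff
    (hder : ∀ {s t : ∀ x, V x} {X : ∀ x : M, TangentSpace I x} {x : M}, HolAt I F s x →
      HolAt I F t x → HolAt I E X x → D (fun y => mulV y (s y) (t y)) x (X x)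
        = mulV x (s x) (D t x (X x)) + mulV x (D s x (X x)) (t x)) :
    (∀ (U : Set M) (s : ∀ x, V x) (X : ∀ x : M, TangentSpace I x), IsOpen U →
        IsHolSection I F U s → IsHolSection I E U X → ∀ x ∈ U,
        chern I F (herm gV kV) s x (X x)
          = D s x (X x) + mulV x (chern I F (herm gV kV) eV x (X x)) (s x)) ↔
    (∀ (x : M) (X : ∀ x : M, TangentSpace I x) (s t : ∀ x, V x), HolAt I E X x → HolAt I F s x →
      HolAt I F t x → nabla I F kV (fun y => mulV y (s y) (t y)) x (X x)
        = mulV x (s x) (nabla I F kV t x (X x)) + mulV x (D s x (X x)) (t x)) := by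
  constructor
  · intro h x X s t hX hs ht
    have h' : ∀ {s : ∀ x, V x}, HolAt I F s x → nabla I F kV s x (X x)
        = D s x (X x) + mulV x (nabla I F kV eV x (X x)) (s x) := by
      intro s hs
      obtain ⟨A, hA, hxA, hsA⟩ := hs.exists_isHolSection
      obtain ⟨B, hB, hxB, hXB⟩ := hX.exists_isHolSection
      have h1 := h (A ∩ B) s X (hA.inter hB) (ContMDiffOn.mono hsA inter_subset_left)
        (ContMDiffOn.mono hXB inter_subset_right) x ⟨hxA, hxB⟩
      rwa [hgV.chern_eq hkV hs.smooth, hgV.chern_eq hkV (hV.unit_holAt x).smooth] at h1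
    -- The formula for the connection is used on `s ∘ t` and on `t`; the terms containing the
    -- derivative of the unit agree by associativity, and the rest is the derivation property of
    -- `D`.
    rw [h' (hV.holAt hs ht), h' ht, hder hs ht hX, hV.mul_add, ← hV.assoc _ _ (s x),
      ← hV.assoc _ (s x), hV.comm x (s x) (nabla I F kV eV x (X x))]
    abel
  · intro h U s X hU hs hX x hx
    have hs' := hs.holAt hU hx
    -- Conversely, taking `t` to be the unit isolates the derivative of `s`.
    have h1 := h x X s eV (hX.holAt hU hx) hs' (hV.unit_holAt x)
    rw [show (fun y => mulV y (s y) (eV y)) = s from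
      funext fun y => by rw [hV.comm, hV.one_mul]] at h1
    rw [hgV.chern_eq hkV hs'.smooth, hgV.chern_eq hkV (hV.unit_holAt x).smooth, h1,
      hV.comm x _ (eV x), hV.one_mul, add_comm, hV.comm]

/-- The curvature condition amounts to flatness of the Chern connection of `V`. -/
theorem chernCurvature_condition_iff
    (hg : ∀ (v : TotalSpace F V) (W : TangentSpace (I.prod 𝓘(ℂ, F)) v),
      (∀ W', totalMetric D gM gV α v W W' = 0) → W = 0) :
    (∀ (U : Set M) (X Y : ∀ x : M, TangentSpace I x) (s s₁ : ∀ x, V x), IsOpen U →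
        IsHolSection I E U X → IsHolSection I E U Y →
        IsHolSection I F U s → IsHolSection I F U s₁ → ∀ x ∈ U,
        herm gV kV x (chernCurvature I F (herm gV kV) X Y s x) (s₁ x)
          - herm gM kM x
              (chernCurvature I E (herm gM kM) X Y (fun y => α y (s y)) x) (α x (s₁ x))
        = herm gM kM x
            (chern I E (herm gM kM) (fun y => α y (s y)) x (X x)
              - α x (chern I F (herm gV kV) s x (X x)))
            (chern I E (herm gM kM) (fun y => α y (s₁ y)) x (Y x)
              - α x (chern I F
                  (fun y a b => herm gV kV y a b - herm gM kM y (α y a) (α y b)) s₁ x (Y x)))) ↔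
    (∀ (x : M) (X : ∀ x : M, TangentSpace I x) (s : ∀ x, V x), HolAt I E X x → HolAt I F s x →
      ∀ Y, nablaCurvature I F kV X s x Y = 0) := by
  -- The first argument on the right of (iv) is zero since `α` commutes with the Chern connections,
  -- so the second argument, and with it the connection of `h_V - α^* h_M`, is irrelevant.
  have hrhs : ∀ {x : M} {s : ∀ x, V x} (X : TangentSpace I x) (w : TangentSpace I x),
      HolAt I F s x → herm gM kM x (chern I E (herm gM kM) (fun y => α y (s y)) x X
        - α x (chern I F (herm gV kV) s x X)) w = 0 := by
    intro x s X w hs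
    rw [hgM.chern_eq hkM (hα.holAt hs).smooth, hgV.chern_eq hkV hs.smooth,
      alpha_nabla hα hkV hk hs.smooth, sub_self]
    exact hgM.zero_left x _
  have hR : ∀ {x : M} {s : ∀ x, V x} {X : ∀ x : M, TangentSpace I x}
      (Y : ∀ x : M, TangentSpace I x), HolAt I F s x → HolAt I E X x →
      chernCurvature I E (herm gM kM) X Y (fun y => α y (s y)) x
        = α x (nablaCurvature I F kV X s x (Y x)) := by
    intro x s X Y hs hX
    rw [hgM.chernCurvature_eq hkM (hα.holAt hs), alpha_nablaCurvature hα hkV hk hs hX]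
  constructor
  · intro h x X s hX hs b
    set R := nablaCurvature I F kV X s x b with hRdef
    -- With a section through `k c` in the second argument, (iv) says that `g_V - α^* g_M`
    -- annihilates the curvature vector `R`.
    have key : ∀ c, gV x R c - gM x (α x R) (α x c) = 0 := by
      intro c
      let Y : ∀ y : M, TangentSpace I y := extend E (E := (TangentSpace I : M → Type _)) b
      have hYx : Y x = b := extend_apply_self (F := E) (E := (TangentSpace I : M → Type _)) b
      have hY : HolAt I E Y x := holAt_extend b
      have hs₁ : HolAt I F (extend F (kV x c)) x := holAt_extend _
      obtain ⟨A, hA, hxA, hsA⟩ := hs.exists_isHolSection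
      obtain ⟨B, hB, hxB, hXB⟩ := hX.exists_isHolSection
      obtain ⟨C, hC, hxC, hYC⟩ := hY.exists_isHolSection
      obtain ⟨G, hG, hxG, hsG⟩ := hs₁.exists_isHolSection
      have h1 := h ((A ∩ B) ∩ (C ∩ G)) X Y s _ ((hA.inter hB).inter (hC.inter hG))
        (ContMDiffOn.mono hXB fun _ h => h.1.2) (ContMDiffOn.mono hYC fun _ h => h.2.1)
        (ContMDiffOn.mono hsA fun _ h => h.1.1) (ContMDiffOn.mono hsG fun _ h => h.2.2)
        x ⟨⟨hxA, hxB⟩, hxC, hxG⟩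
      rw [hrhs _ _ hs, hR Y hs hX, hgV.chernCurvature_eq hkV hs, hYx, ← hRdef, extend_apply_self,
        herm, herm, hkV.involutive, ← hk, hkV.involutive] at h1
      exact h1
    let u : TotalSpace F V := TotalSpace.mk' F x 0
    -- The vertical vector `R` minus the horizontal lift of `α R` is orthogonal to horizontal
    -- vectors by construction and to vertical ones by `key`, so it vanishes. In this way
    -- nondegeneracy upstairs gives nondegeneracy of `g_V - α^* g_M`.
    have h2 := hg u (horLift D u (- α x R) + vertLift I u R) fun W' => by
      simp only [totalMetric, horPart_add, horPart_horLift, horPart_vertLift, vertPart_add,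
        vertPart_horLift, vertPart_vertLift, add_zero, zero_add]
      have hneg : ∀ a b, gM x (-a) b = - gM x a b := fun a b => by
        simpa using hgM.smul_left x (-1) a b
      have h3 := key (vertPart D u W')
      change gM x (- α x R) _ + gM x (α x R) _ + gM x _ (- α x R) + gV x R _ = 0
      rw [hgM.symm x _ (- α x R), hneg, hneg]
      linear_combination h3
    have h3 := congrArg (vertPart D u) h2
    rwa [vertPart_add, vertPart_horLift, vertPart_vertLift, zero_add, vertPart_zero] at h3
  · intro h U X Y s s₁ hU hX hY hs hs₁ x hx
    have hs' := hs.holAt hU hx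
    have hX' := hX.holAt hU hx
    rw [hrhs _ _ hs', hR Y hs' hX', hgV.chernCurvature_eq hkV hs', h x X s hX' hs',
      hα.map_zero]
    simp only [herm, hgV.zero_left, hgM.zero_left, sub_zero]

end Conditions

end TTGeometry

end

/-! ### The theorem -/

open TTGeometry in
theorem theorem5p2
    {E : Type*} [NormedAddCommGroup E] [NormedSpace ℂ E] [FiniteDimensional ℂ E]
    {F : Type*} [NormedAddCommGroup F] [NormedSpace ℂ F] [FiniteDimensional ℂ F]
    -- the complex manifold `M` and the holomorphic vector bundle `V`
    {M : Type*} [TopologicalSpace M] [ChartedSpace E M] [IsManifold 𝓘(ℂ, E) ω M]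
    {V : M → Type*} [TopologicalSpace (TotalSpace F V)]
    [∀ x, AddCommGroup (V x)] [∀ x, Module ℂ (V x)] [∀ x, TopologicalSpace (V x)]
    [∀ x, IsTopologicalAddGroup (V x)] [∀ x, ContinuousSMul ℂ (V x)]
    [FiberBundle F V] [VectorBundle ℂ F V] [ContMDiffVectorBundle ω F V 𝓘(ℂ, E)]
    -- the structures on `M` and on `V`
    (mulM : ∀ x : M, TangentSpace 𝓘(ℂ, E) x → TangentSpace 𝓘(ℂ, E) x → TangentSpace 𝓘(ℂ, E) x)
    (eM : ∀ x : M, TangentSpace 𝓘(ℂ, E) x)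
    (gM : ∀ x : M, TangentSpace 𝓘(ℂ, E) x → TangentSpace 𝓘(ℂ, E) x → ℂ)
    (kM : ∀ x : M, TangentSpace 𝓘(ℂ, E) x → TangentSpace 𝓘(ℂ, E) x)
    (mulV : ∀ x, V x → V x → V x) (eV : ∀ x, V x) (gV : ∀ x, V x → V x → ℂ)
    (kV : ∀ x, V x → V x)
    (D : CovariantDerivative 𝓘(ℂ, E) F V) (α : ∀ x, V x → TangentSpace 𝓘(ℂ, E) x)
    (hM : IsFrobeniusManifold 𝓘(ℂ, E) mulM eM gM)
    (hV : IsFrobeniusAlgebraBundle 𝓘(ℂ, E) F mulV eV gV)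
    (hD : IsHolConnection D)
    (hα : IsAlgebraMorphism 𝓘(ℂ, E) F mulM eM mulV eV α)
    -- the induced metric on the total space is nondegenerate
    (hg : ∀ (v : TotalSpace F V) (W : TangentSpace (𝓘(ℂ, E).prod 𝓘(ℂ, F)) v),
      (∀ W', totalMetric D gM gV α v W W' = 0) → W = 0)
    -- the total space is an F-manifold
    (hF : IsFManifold (𝓘(ℂ, E).prod 𝓘(ℂ, F)) (totalMul D mulM mulV α)
      (totalSection (F := F) 𝓘(ℂ, E) eV))
    (hkM : IsCompatibleRealStructure 𝓘(ℂ, E) E gM kM)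
    (hkV : IsCompatibleRealStructure 𝓘(ℂ, E) F gV kV)
    (hk : ∀ x a, α x (kV x a) = kM x (α x a)) :
    TTStar (𝓘(ℂ, E).prod 𝓘(ℂ, F)) (totalMul D mulM mulV α)
        (herm (totalMetric D gM gV α) (totalReal D kM kV)) ↔
      TTStar 𝓘(ℂ, E) mulM (herm gM kM) ∧
      -- (i)
      (∀ (U : Set M) (s : ∀ x, V x) (X Z : ∀ x : M, TangentSpace 𝓘(ℂ, E) x), IsOpen U →
        IsHolSection 𝓘(ℂ, E) F U s → (∀ x ∈ U, D s x = 0) →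
        IsHolSection 𝓘(ℂ, E) E U X → IsHolSection 𝓘(ℂ, E) E U Z → ∀ x ∈ U,
        chern 𝓘(ℂ, E) E (herm gM kM) (fun y => mulM y (α y (s y)) (Z y)) x (X x)
          = mulM x (α x (s x)) (chern 𝓘(ℂ, E) E (herm gM kM) Z x (X x))) ∧
      -- (ii)
      (∀ (U : Set M) (s : ∀ x, V x) (X : ∀ x : M, TangentSpace 𝓘(ℂ, E) x), IsOpen U →
        IsHolSection 𝓘(ℂ, E) F U s → IsHolSection 𝓘(ℂ, E) E U X → ∀ x ∈ U,
        chern 𝓘(ℂ, E) F (herm gV kV) s x (X x)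
          = D s x (X x) + mulV x (chern 𝓘(ℂ, E) F (herm gV kV) eV x (X x)) (s x)) ∧
      -- (iii)
      ((∀ (x : M) (X Z : TangentSpace 𝓘(ℂ, E) x) (a : V x),
          higgs (mulM x) X (kM x (higgs (mulM x) (α x a) (kM x Z)))
            - kM x (higgs (mulM x) (α x a) (kM x (higgs (mulM x) X Z))) = 0) ∧
        (∀ (x : M) (a b c : V x),
          higgs (mulV x) a (kV x (higgs (mulV x) b (kV x c)))
            - kV x (higgs (mulV x) b (kV x (higgs (mulV x) a c))) = 0)) ∧
      -- (iv)
      (∀ (U : Set M) (X Y : ∀ x : M, TangentSpace 𝓘(ℂ, E) x) (s s₁ : ∀ x, V x), IsOpen U →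
        IsHolSection 𝓘(ℂ, E) E U X → IsHolSection 𝓘(ℂ, E) E U Y →
        IsHolSection 𝓘(ℂ, E) F U s → IsHolSection 𝓘(ℂ, E) F U s₁ → ∀ x ∈ U,
        herm gV kV x (chernCurvature 𝓘(ℂ, E) F (herm gV kV) X Y s x) (s₁ x)
          - herm gM kM x
              (chernCurvature 𝓘(ℂ, E) E (herm gM kM) X Y (fun y => α y (s y)) x) (α x (s₁ x))
        = herm gM kM x
            (chern 𝓘(ℂ, E) E (herm gM kM) (fun y => α y (s y)) x (X x)
              - α x (chern 𝓘(ℂ, E) F (herm gV kV) s x (X x)))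
            (chern 𝓘(ℂ, E) E (herm gM kM) (fun y => α y (s₁ y)) x (Y x)
              - α x (chern 𝓘(ℂ, E) F
                  (fun y a b => herm gV kV y a b - herm gM kM y (α y a) (α y b)) s₁ x (Y x)))) := by
  have hhM := hM.almost.mult
  have hhV := hV.mult
  have hgM := hM.almost.metric
  have hgV := hV.metric
  have hflat : ∀ {x y : M}, y ∈ (chartAt E x).source → y ∈ (trivializationAt F V x).baseSet →
      ∀ {X Y : ∀ x : M, TangentSpace 𝓘(ℂ, E) x}, HolAt 𝓘(ℂ, E) E X y → HolAt 𝓘(ℂ, E) E Y y →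
      ∀ i : Fin (Module.finrank ℂ F), connCurvature D X Y (frameAt F V x i) y = 0 :=
    connCurvature_frameAt hhM hhV hα hD hF
  -- Both sides become conjunctions of the same identities for `k ∂̄ k`, its curvature and the
  -- commutators, up to order.
  rw [ttStar_iff hF.mult (isHolMetric_totalMetric hD hgM hgV hα hg)
      (totalMetric_invariant hgM hhM hM.almost.invariant hV.invariant hα)
      (isCompatibleRealStructure_totalReal hD hkM hkV hk),
    ttStar_iff hhM hgM hM.almost.invariant hkM,
    ttFirst_total_iff hhM hhV hα hD hkM hkV hk hF.mult
      (fun u X Y => bracket_horField hhM hhV hα hD hF u),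
    ttSecond_total_iff hhM hhV hα hD hkM hkV hk hF.mult,
    nabla_action_iff hhM hhV hα hD hgM hgV hkM hkV hk hflat,
    nabla_mul_iff hhM hhV hα hD hgM hgV hkM hkV hk (conn_mul hhM hhV hα hD hF),
    chernCurvature_condition_iff hhM hhV hα hD hgM hgV hkM hkV hk hg]
  simp only [higgsBracket_eq hhV hkV, higgsBracket_eq hhM hkM]
  constructor
  · rintro ⟨⟨h1, h2, h3⟩, h4, h5, h6, h7⟩
    exact ⟨⟨h1, h4⟩, h2, h3, ⟨fun x X Z a => h6 x X a Z, h7⟩, h5⟩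
  · rintro ⟨⟨h1, h4⟩, h2, h3, ⟨h6, h7⟩, h5⟩
    exact ⟨⟨h1, h2, h3⟩, h4, h5, fun x a b c => h6 x a c b, h7⟩
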